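/- Let $d\ge 0$ be an integer. Write $\mathcal F f(\omega)=\int_{\mathbb R^d} f(t)e^{-2\pi i t\cdot\omega}\,dt$ (extended to $\mathcal S'(\mathbb R^d)$), $T_xf(t)=f(t-x)$, $M_\omega f(t)=e^{2\pi i t\cdot\omega}f(t)$, $\mathcal I f(t)=f(-t)$, and let $V_gf(x,\omega)=\langle f,M_\omega T_xg\rangle=\int f(y)\overline{g(y-x)}e^{-2\pi i y\cdot\omega}\,dy$ be the short-time Fourier transform, where the bracket is linear in the first and conjugate-linear in the second entry and denotes the duality between $\mathcal S'$ and $\mathcal S$, resp. between the modulation spaces $M^\infty(\mathbb R^d)=\{f\in\mathcal S': V_\gamma f\in L^\infty\}$ and $M^1(\mathbb R^d)=\{f\in\mathcal S': V_\gamma f\in L^1\}$ ($\gamma$ the $L^2$-normalized Gaussian), the latter being $\langle f,g\rangle=\int_{\mathbb R^{2d}} V_\gamma f\,\overline{V_\gamma g}$. For a symbol $m$ on $\mathbb R^d$ put $(1\otimes m)(x,\omega)=m(\omega)$; the STFT multiplier $A^{g_1,g_2}_{1\otimes m}$ with analysis window $g_1$ and synthesis window $g_2$ is the operator defined weakly by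 $$\langle A^{g_1,g_2}_{1\otimes m}f,g\rangle=\langle 1\otimes m,\overline{V_{g_1}f}\,V_{g_2}g\rangle ,$$ formally $\iint m(\omega)\,V_{g_1}f(x,\omega)\,\overline{V_{g_2}g(x,\omega)}\,dx\,d\omega$. The Fourier multiplier with symbol $m_2$ is $T_{m_2}f=\mathcal F^{-1}(m_2\,\mathcal F f)=\mathcal F^{-1}m_2*f$. The window correlation function is $\mathcal C_{g_1,g_2}=\mathcal I g_2*\overline{g_1}$. Assume one of the following: 1. $m,m_2\in\mathcal S'(\mathbb R^d)$ and $g_1,g_2\in\mathcal S(\mathbb R^d)$ (resp. $m,m_2\in M^\infty(\mathbb R^d)$ and $g_1,g_2\in M^1(\mathbb R^d)$); 2. $m,m_2\in\mathcal S(\mathbb R^d)$ and $(g_1,g_2)\in\mathcal S'(\mathbb R^d)\times\mathcal S(\mathbb R^d)$ (resp. $m,m_2\in M^1(\mathbb R^d)$ and $(g_1,g_2)\in M^\infty(\mathbb R^d)\times M^1(\mathbb R^d)$); 3. $m,m_2\in\mathcal S(\mathbb R^d)$ and $(g_1,g_2)\in\mathcal S(\mathbb R^d)\times\mathcal S'(\mathbb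 R^d)$ (resp. $m,m_2\in M^1(\mathbb R^d)$ and $(g_1,g_2)\in M^1(\mathbb R^d)\times M^\infty(\mathbb R^d)$). Then the weak formula determines a unique operator $A^{g_1,g_2}_{1\otimes m}$ from $\mathcal S(\mathbb R^d)$ to $\mathcal S'(\mathbb R^d)$, which is linear and continuous (for the topology of pointwise convergence on $\mathcal S'$) (resp. a unique map from $M^1(\mathbb R^d)$ to $M^\infty(\mathbb R^d)$), and $$A^{g_1,g_2}_{1\otimes m}=T_{m_2}\quad\text{on } \mathcal S(\mathbb R^d)\ (\text{resp. on } M^1(\mathbb R^d))$$ holds if and only if $$m_2=m*\mathcal F^{-1}(\mathcal C_{g_1,g_2})\quad\text{in } \mathcal S'(\mathbb R^d)\ (\text{resp. in } M^\infty(\mathbb R^d)).$$ -/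

import Mathlib

open MeasureTheory SchwartzMap FourierTransform
open scoped ComplexConjugate

set_option linter.unusedSectionVars false

noncomputable section

namespace TimeFreq

section Exponentials

/-! ### Characters and Gaussians -/

theorem iteratedDeriv_cexp_ofReal (c : ℂ) (n : ℕ) :
    iteratedDeriv n (fun s : ℝ => Complex.exp (c * s)) = fun s : ℝ => c ^ n * Complex.exp (c * s) := by
  induction n with
  | zero => simp
  | succ n ih =>
    rw [iteratedDeriv_succ, ih]
    funext s
    have h : HasDerivAt (fun s : ℝ => c * (s : ℂ)) c s := by
      simpa using (Complex.ofRealCLM.hasDerivAt (x := s)).const_mul c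
    have := (h.cexp.const_mul (c ^ n)).deriv
    rw [this]; ring

theorem contDiff_cexp_ofReal (c : ℂ) {N : WithTop ℕ∞} :
    ContDiff ℝ N (fun s : ℝ => Complex.exp (c * s)) :=
  (contDiff_const.mul Complex.ofRealCLM.contDiff).cexp

variable {V : Type*} [NormedAddCommGroup V] [InnerProductSpace ℝ V]

/-- The character `t ↦ e^{2πi t·ω}`. -/
def charFn (ω : V) : V → ℂ := fun t => Complex.exp (2 * Real.pi * Complex.I * (inner ℝ t ω : ℝ))

theorem charFn_hasTemperateGrowth (ω : V) : (charFn ω).HasTemperateGrowth := by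
  have h1 : (fun s : ℝ => Complex.exp (2 * Real.pi * Complex.I * s)).HasTemperateGrowth := by
    refine ⟨contDiff_cexp_ofReal _, fun n => ⟨0, ‖(2 * Real.pi * Complex.I : ℂ)‖ ^ n, fun s => ?_⟩⟩
    rw [norm_iteratedFDeriv_eq_norm_iteratedDeriv, iteratedDeriv_cexp_ofReal]
    simp [Complex.norm_exp]
  exact h1.comp (Function.hasTemperateGrowth_inner_left ω)

theorem gauss_decay (k n : ℕ) : ∃ C : ℝ, ∀ x : V, ‖x‖ ^ k *
    ‖iteratedFDeriv ℝ n (fun t : V => Complex.exp (-(Real.pi : ℂ) * ((‖t‖ ^ 2 : ℝ) : ℂ))) x‖ ≤ C := by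
  obtain ⟨l, C, hC, hq⟩ :=
    (Function.hasTemperateGrowth_norm_sq V).norm_iteratedFDeriv_le_uniform n
  -- polynomial times Gaussian is bounded
  obtain ⟨B, hB⟩ : ∃ B : ℝ, ∀ r : ℝ, 0 ≤ r →
      (1 + r) ^ (k + l * n) * Real.exp (-Real.pi * r ^ 2) ≤ B := by
    refine ⟨((k + l * n).factorial : ℝ) * Real.exp 2, fun r hr => ?_⟩
    have h1 : (1 + r) ^ (k + l * n) ≤ (k + l * n).factorial * Real.exp (1 + r) := by
      have := Real.pow_div_factorial_le_exp (1 + r) (by positivity) (k + l * n)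
      rw [div_le_iff₀ (by positivity)] at this
      linarith [mul_comm (Real.exp (1 + r)) ((k + l * n).factorial : ℝ)]
    have h2 : Real.exp (1 + r) * Real.exp (-Real.pi * r ^ 2) ≤ Real.exp 2 := by
      rw [← Real.exp_add]
      apply Real.exp_le_exp.2
      nlinarith [Real.pi_gt_three, sq_nonneg (r - 1), sq_nonneg r,
        mul_nonneg (sub_nonneg.2 Real.pi_gt_three.le) (sq_nonneg r)]
    calc _ ≤ ((k + l * n).factorial * Real.exp (1 + r)) * Real.exp (-Real.pi * r ^ 2) := by gcongr
      _ = (k + l * n).factorial * (Real.exp (1 + r) * Real.exp (-Real.pi * r ^ 2)) := by ring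
      _ ≤ _ := by gcongr
  refine ⟨n.factorial * (1 + Real.pi) ^ n * (C + 1) ^ n * B, fun x => ?_⟩
  have hg : ∀ i, i ≤ n → ‖iteratedFDeriv ℝ i (fun s : ℝ => Complex.exp (-(Real.pi : ℂ) * s))
      (‖x‖ ^ 2)‖ ≤ (1 + Real.pi) ^ n * Real.exp (-Real.pi * ‖x‖ ^ 2) := by
    intro i hi
    rw [norm_iteratedFDeriv_eq_norm_iteratedDeriv, iteratedDeriv_cexp_ofReal]
    have e : ‖Complex.exp (-(Real.pi : ℂ) * ((‖x‖ ^ 2 : ℝ) : ℂ))‖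
        = Real.exp (-Real.pi * ‖x‖ ^ 2) := by
      rw [Complex.norm_exp]; congr 1
      rw [← Complex.ofReal_neg, ← Complex.ofReal_mul, Complex.ofReal_re]
    rw [norm_mul, e, norm_pow, norm_neg, Complex.norm_real, Real.norm_of_nonneg Real.pi_pos.le]
    gcongr
    calc Real.pi ^ i ≤ (1 + Real.pi) ^ i := by gcongr; linarith
      _ ≤ _ := pow_le_pow_right₀ (by linarith [Real.pi_pos]) hi
  have hf : ∀ i, 1 ≤ i → i ≤ n → ‖iteratedFDeriv ℝ i (fun t : V => ‖t‖ ^ 2) x‖ ≤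
      ((C + 1) * (1 + ‖x‖) ^ l) ^ i := by
    intro i h1 hi
    refine (hq i hi x).trans ?_
    have hx : 1 ≤ (1 + ‖x‖) ^ l := one_le_pow₀ (by linarith [norm_nonneg x])
    have : 1 ≤ (C + 1) * (1 + ‖x‖) ^ l := one_le_mul_of_one_le_of_one_le (by linarith) hx
    calc C * (1 + ‖x‖) ^ l ≤ (C + 1) * (1 + ‖x‖) ^ l := by gcongr; linarith
      _ ≤ _ := le_self_pow₀ this (by omega)
  have main := norm_iteratedFDeriv_comp_le (contDiff_cexp_ofReal (-(Real.pi : ℂ)) (N := n))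
    (contDiff_norm_sq ℝ (E := V)) le_rfl x hg hf
  have hxk : ‖x‖ ^ k ≤ (1 + ‖x‖) ^ k := by gcongr; linarith
  calc _ ≤ (1 + ‖x‖) ^ k * (n.factorial * ((1 + Real.pi) ^ n * Real.exp (-Real.pi * ‖x‖ ^ 2)) *
        ((C + 1) * (1 + ‖x‖) ^ l) ^ n) := by gcongr; exact main
    _ = n.factorial * (1 + Real.pi) ^ n * (C + 1) ^ n *
        ((1 + ‖x‖) ^ (k + l * n) * Real.exp (-Real.pi * ‖x‖ ^ 2)) := by
      rw [mul_pow, pow_add, pow_mul]; ring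
    _ ≤ _ := by gcongr; exact hB _ (norm_nonneg x)

/-- The Gaussian `e^{-π|t|²}` as a Schwartz function. -/
def gauss0 (V : Type*) [NormedAddCommGroup V] [InnerProductSpace ℝ V] : 𝓢(V, ℂ) where
  toFun t := Complex.exp (-(Real.pi : ℂ) * ((‖t‖ ^ 2 : ℝ) : ℂ))
  smooth' := (contDiff_cexp_ofReal _).comp (contDiff_norm_sq ℝ)
  decay' := gauss_decay

end Exponentials

section Basic

variable {V : Type*} [NormedAddCommGroup V] [InnerProductSpace ℝ V] [FiniteDimensional ℝ V]
  [MeasurableSpace V] [BorelSpace V]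

/-! ### Operations on functions -/

/-- Reflection `(𝓘 f)(t) = f (-t)` of a function. -/
def reflFun (f : V → ℂ) : V → ℂ := fun t => f (-t)

/-- Pointwise complex conjugate of a function. -/
def conjFun (f : V → ℂ) : V → ℂ := fun t => conj (f t)

/-- Short-time Fourier transform of a function `f` with window a function `g`:
`V_g f(x, ω) = 𝓕 (f · conj (T_x g)) (ω) = ∫ f(y) conj(g(y - x)) e^{-2πi y·ω} dy`. -/
def stft (g f : V → ℂ) (x ω : V) : ℂ :=
  𝓕 (fun y => f y * conj (g (y - x))) ω

/-! ### Operations on Schwartz functions -/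

/-- Modulation `M_ω` on Schwartz functions. -/
def modS (ω : V) : 𝓢(V, ℂ) →L[ℂ] 𝓢(V, ℂ) := SchwartzMap.smulLeftCLM ℂ (charFn ω)

/-- Translation `T_x` on Schwartz functions. -/
def translS (x : V) : 𝓢(V, ℂ) →L[ℂ] 𝓢(V, ℂ) := SchwartzMap.compSubConstCLM ℂ x

/-- Reflection `𝓘` on Schwartz functions. -/
def reflS : 𝓢(V, ℂ) →L[ℂ] 𝓢(V, ℂ) :=
  SchwartzMap.compCLMOfContinuousLinearEquiv ℂ (ContinuousLinearEquiv.neg ℝ)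

/-- Complex conjugation on Schwartz functions. -/
def conjS : 𝓢(V, ℂ) →L[ℝ] 𝓢(V, ℂ) :=
  SchwartzMap.postcompCLM (𝕜 := ℝ) (Complex.conjCLE : ℂ →L[ℝ] ℂ)

theorem modS_translS_apply (x ω : V) (g : 𝓢(V, ℂ)) (t : V) :
    modS ω (translS x g) t = charFn ω t * g (t - x) := by
  simp [modS, translS, SchwartzMap.smulLeftCLM_apply_apply (charFn_hasTemperateGrowth ω)]

theorem reflS_apply (g : 𝓢(V, ℂ)) (t : V) : reflS g t = g (-t) := rfl

theorem conjS_apply (g : 𝓢(V, ℂ)) (t : V) : conjS g t = conj (g t) := rfl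

/-- Convolution of Schwartz functions. -/
def convS (f g : 𝓢(V, ℂ)) : 𝓢(V, ℂ) :=
  SchwartzMap.convolution (ContinuousLinearMap.mul ℂ ℂ) f g

/-! ### Operations on tempered distributions -/

/-- The time-frequency shift `M_ω T_x u`, i.e. `(M_ω T_x u)(φ) = u (T_{-x} (e^{2πi ω·} φ))`. -/
def tfShiftD (x ω : V) (u : 𝓢'(V, ℂ)) : 𝓢'(V, ℂ) :=
  PointwiseConvergenceCLM.precomp ℂ (translS (-x) ∘L modS ω) u

/-- Reflection `(𝓘 u)(φ) = u (𝓘 φ)`. -/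
def reflD (u : 𝓢'(V, ℂ)) : 𝓢'(V, ℂ) :=
  PointwiseConvergenceCLM.precomp ℂ reflS u

/-- Complex conjugate of a distribution, `ū(φ) = conj (u (conj φ))`. -/
def conjD (u : 𝓢'(V, ℂ)) : 𝓢'(V, ℂ) :=
  ContinuousLinearMap.toPointwiseConvergenceCLM _ _ _ _
    { toFun := fun φ => conj (u (conjS φ))
      map_add' := by intro φ ψ; simp
      map_smul' := by
        intro c φ
        have : conjS (c • φ) = conj c • conjS φ := by ext t; simp [conjS]
        simp [this]
      cont := Complex.continuous_conj.comp (u.continuous.comp conjS.continuous) }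
/-- Convolution of `u ∈ 𝓢'` and `ψ ∈ 𝓢` as a tempered distribution, `(u ∗ ψ)(φ) = u (𝓘ψ ∗ φ)`. -/
def convD (u : 𝓢'(V, ℂ)) (ψ : 𝓢(V, ℂ)) : 𝓢'(V, ℂ) :=
  PointwiseConvergenceCLM.precomp ℂ
    (SchwartzMap.convolution (ContinuousLinearMap.mul ℂ ℂ) (reflS ψ)) u

/-- The duality bracket `⟨u, φ⟩ = u (conj φ)` between `𝓢'` and `𝓢`, linear in `u` and
conjugate-linear in `φ`. -/
def dualBr (u : 𝓢'(V, ℂ)) (φ : 𝓢(V, ℂ)) : ℂ := u (conjS φ)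

/-- STFT of a tempered distribution with a Schwartz window, `V_g u(x, ω) = ⟨u, M_ω T_x g⟩`. -/
def stftD (g : 𝓢(V, ℂ)) (u : 𝓢'(V, ℂ)) (x ω : V) : ℂ :=
  dualBr u (modS ω (translS x g))

/-- STFT of a Schwartz function with a distributional window,
`V_g f(x, ω) = ⟨f, M_ω T_x g⟩ = conj ⟨M_ω T_x g, f⟩`. -/
def stftWinD (g : 𝓢'(V, ℂ)) (f : 𝓢(V, ℂ)) (x ω : V) : ℂ :=
  conj (dualBr (tfShiftD x ω g) f)

/-- The tempered distribution `φ ↦ ∫ f φ` of an essentially bounded function `f`. -/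
def distOf (f : V → ℂ) : 𝓢'(V, ℂ) :=
  open Classical in
  if h : MemLp f ⊤ (volume : Measure V) then Lp.toTemperedDistribution (h.toLp f) else 0

/-! ### The modulation spaces `M¹` and `M^∞` -/

variable (V) in
/-- The `L²`-normalized Gaussian `γ(t) = 2^{n/4} e^{-π|t|²}`, `n = dim V`. -/
def gaussWin : 𝓢(V, ℂ) :=
  (((2 : ℝ) ^ ((Module.finrank ℝ V : ℝ) / 4) : ℝ) : ℂ) • gauss0 V

theorem gaussWin_apply (t : V) : gaussWin V t =
    (((2 : ℝ) ^ ((Module.finrank ℝ V : ℝ) / 4) : ℝ) : ℂ) *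
      Complex.exp (-(Real.pi : ℂ) * ((‖t‖ ^ 2 : ℝ) : ℂ)) := rfl

/-- Membership in `M^∞`: a tempered distribution with bounded (Gaussian) STFT.
(The STFT is continuous, so this is `V_γ u ∈ L^∞`.) -/
def MemMInf (u : 𝓢'(V, ℂ)) : Prop :=
  ∃ C : ℝ, ∀ x ω : V, ‖stftD (gaussWin V) u x ω‖ ≤ C

/-- Membership in `M¹` (Feichtinger's algebra): a continuous integrable function with integrable
(Gaussian) STFT. Every tempered distribution with integrable STFT is given by exactly one such
function. -/
def MemM1 (f : V → ℂ) : Prop :=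
  Continuous f ∧ Integrable f ∧
    Integrable (fun z : V × V => stft (gaussWin V) f z.1 z.2)

/-- The duality bracket `⟨u, f⟩ = ∫ V_γ u(z) conj (V_γ f(z)) dz` between `M^∞` and `M¹`, linear in
`u` and conjugate-linear in `f`, with `γ` the normalized Gaussian. -/
def pairing (u : 𝓢'(V, ℂ)) (f : V → ℂ) : ℂ :=
  ∫ z : V × V, stftD (gaussWin V) u z.1 z.2 * conj (stft (gaussWin V) f z.1 z.2)

/-- STFT of `f ∈ M¹` with a window `g ∈ M^∞`, `V_g f(x, ω) = ⟨f, M_ω T_x g⟩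
= conj ⟨M_ω T_x g, f⟩`. -/
def stftWinM (g : 𝓢'(V, ℂ)) (f : V → ℂ) (x ω : V) : ℂ :=
  conj (pairing (tfShiftD x ω g) f)

/-- Convolution of `u ∈ M^∞` and `h ∈ M¹`, the (bounded continuous) function
`(u ∗ h)(x) = ⟨u, conj (T_x 𝓘 h)⟩`. -/
def convM (u : 𝓢'(V, ℂ)) (h : V → ℂ) : V → ℂ :=
  fun x => pairing u (fun t => conj (h (x - t)))

variable (V) in
/-- The space `M¹(V)`. -/
abbrev M1 : Type _ := {f : V → ℂ // MemM1 f}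

variable (V) in
/-- The space `M^∞(V)`. -/
abbrev MInf : Type _ := {u : 𝓢'(V, ℂ) // MemMInf u}

/-! ### Window correlation functions `C_{g₁,g₂} = 𝓘 g₂ ∗ conj g₁` -/

/-- `g₁, g₂ ∈ 𝓢`. -/
def corrSS (g₁ g₂ : 𝓢(V, ℂ)) : 𝓢(V, ℂ) := convS (reflS g₂) (conjS g₁)

/-- `g₁ ∈ 𝓢'`, `g₂ ∈ 𝓢`. -/
def corrDS (g₁ : 𝓢'(V, ℂ)) (g₂ : 𝓢(V, ℂ)) : 𝓢'(V, ℂ) := convD (conjD g₁) (reflS g₂)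

/-- `g₁ ∈ 𝓢`, `g₂ ∈ 𝓢'`. -/
def corrSD (g₁ : 𝓢(V, ℂ)) (g₂ : 𝓢'(V, ℂ)) : 𝓢'(V, ℂ) := convD (reflD g₂) (conjS g₁)

/-- `g₁, g₂ ∈ M¹`. -/
def corrM11 (g₁ g₂ : V → ℂ) : V → ℂ :=
  MeasureTheory.convolution (reflFun g₂) (conjFun g₁) (ContinuousLinearMap.mul ℂ ℂ) volume

/-- `g₁ ∈ M^∞`, `g₂ ∈ M¹`. -/
def corrMInf1 (g₁ : 𝓢'(V, ℂ)) (g₂ : V → ℂ) : V → ℂ := convM (conjD g₁) (reflFun g₂)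

/-- `g₁ ∈ M¹`, `g₂ ∈ M^∞`. -/
def corrM1Inf (g₁ : V → ℂ) (g₂ : 𝓢'(V, ℂ)) : V → ℂ := convM (reflD g₂) (conjFun g₁)

/-! ### Fourier multipliers -/

/-- The Fourier multiplier `T_m f = 𝓕⁻¹ (m · 𝓕 f)` with symbol `m ∈ 𝓢'`, for `f ∈ 𝓢`. -/
def fourierMultS (m : 𝓢'(V, ℂ)) (f : 𝓢(V, ℂ)) : 𝓢'(V, ℂ) :=
  𝓕⁻ (TemperedDistribution.smulLeftCLM ℂ (⇑(𝓕 f : 𝓢(V, ℂ))) m)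

/-- The Fourier multiplier `T_m f = 𝓕⁻¹ m ∗ f` with symbol `m ∈ M^∞`, for `f ∈ M¹`. -/
def fourierMultM (m : 𝓢'(V, ℂ)) (f : V → ℂ) : 𝓢'(V, ℂ) :=
  distOf (convM (𝓕⁻ m) f)

/-! ### The time-frequency plane and STFT multipliers -/

variable (V) in
/-- The time-frequency plane `V × V` with its Euclidean structure; a point is `(x, ω)`. -/
abbrev Plane : Type _ := WithLp 2 (V × V)

variable (V) in
/-- The inclusion `η ↦ (0, η)`. -/
def inclSnd : V →L[ℝ] Plane V :=
  ((WithLp.prodContinuousLinearEquiv 2 ℝ V V).symm : V × V →L[ℝ] Plane V) ∘L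
    ContinuousLinearMap.inr ℝ V V

theorem inclSnd_apply (η : V) : inclSnd V η = WithLp.toLp 2 (0, η) := rfl

theorem inclSnd_antilipschitz : AntilipschitzWith 1 (inclSnd V) := by
  refine AntilipschitzWith.of_le_mul_dist fun a b => ?_
  rw [dist_eq_norm, dist_eq_norm, ← map_sub, inclSnd_apply]
  simp

variable (V) in
/-- The map `Φ ↦ (ω ↦ ∫ Φ(x, ω) dx)` on Schwartz functions, written as the inverse Fourier
transform of the restriction of `𝓕 Φ` to `{0} × V`; see `partialInt_apply`. -/
def partialInt : 𝓢(Plane V, ℂ) →L[ℂ] 𝓢(V, ℂ) :=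
  fourierInvCLM ℂ 𝓢(V, ℂ) ∘L
    SchwartzMap.compCLMOfAntilipschitz ℂ (inclSnd V).hasTemperateGrowth inclSnd_antilipschitz ∘L
    fourierCLM ℂ 𝓢(Plane V, ℂ)

theorem partialInt_apply (Φ : 𝓢(Plane V, ℂ)) (ω : V) :
    partialInt V Φ ω = ∫ x : V, Φ (WithLp.toLp 2 (x, ω)) := by
  have hmp := WithLp.volume_preserving_toLp V V
  have hemb : MeasurableEmbedding (WithLp.toLp 2 : V × V → Plane V) :=
    (MeasurableEquiv.toLp 2 (V × V)).measurableEmbedding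
  have hint : Integrable (fun z : V × V => Φ (WithLp.toLp 2 z)) (volume.prod volume) :=
    (hmp.integrable_comp_emb hemb).2 Φ.integrable
  set F : V → ℂ := fun ω => ∫ x : V, Φ (WithLp.toLp 2 (x, ω)) with hF
  have hFint : Integrable F := hint.integral_prod_right
  -- the Fourier transform of the partial integral is the restriction of the Fourier transform
  have hFT : 𝓕 F = fun η => (𝓕 Φ : 𝓢(Plane V, ℂ)) (inclSnd V η) := by
    funext η
    rw [SchwartzMap.fourier_coe, Real.fourier_eq, Real.fourier_eq,
      ← hmp.integral_comp hemb, Measure.volume_eq_prod, integral_prod_symm]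
    · congr 1
      funext w
      simp only [hF, inclSnd_apply, WithLp.prod_inner_apply, Circle.smul_def, inner_zero_right,
        zero_add]
      rw [integral_smul]
    · refine (hmp.integrable_comp_emb hemb (g := fun v =>
        Real.fourierChar (-inner ℝ v (inclSnd V η)) • Φ v)).2 ?_
      exact (Real.fourierIntegral_convergent_iff _).2 Φ.integrable
  have hcont : Continuous F := by
    obtain ⟨C, hC⟩ : ∃ C : ℝ, ∀ w : Plane V, (1 + ‖w‖) ^ (Module.finrank ℝ V + 1) * ‖Φ w‖ ≤ C :=
      ⟨_, fun w => by
        simpa using SchwartzMap.one_add_le_sup_seminorm_apply (𝕜 := ℝ)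
          (m := (Module.finrank ℝ V + 1, 0)) le_rfl le_rfl Φ w⟩
    refine continuous_of_dominated (F := fun ω x => Φ (WithLp.toLp 2 (x, ω)))
      (bound := fun x => C * (1 + ‖x‖) ^ (-((Module.finrank ℝ V + 1 : ℕ) : ℝ))) ?_ ?_ ?_ ?_
    · intro ω
      exact (Φ.continuous.comp (by fun_prop)).aestronglyMeasurable
    · intro ω
      filter_upwards with x
      have hx : ‖x‖ ≤ ‖(WithLp.toLp 2 (x, ω) : Plane V)‖ :=
        WithLp.norm_fst_le V (WithLp.toLp 2 (x, ω) : Plane V)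
      rw [Real.rpow_neg (by positivity), Real.rpow_natCast, ← div_eq_mul_inv,
        le_div_iff₀ (by positivity), mul_comm]
      refine le_trans ?_ (hC (WithLp.toLp 2 (x, ω)))
      gcongr
    · exact (integrable_one_add_norm (by push_cast; linarith)).const_mul C
    · filter_upwards with x
      exact Φ.continuous.comp (by fun_prop)
  have hFTi : Integrable (𝓕 F) := by
    rw [hFT]
    exact (SchwartzMap.compCLMOfAntilipschitz ℂ (inclSnd V).hasTemperateGrowth
      inclSnd_antilipschitz (𝓕 Φ)).integrable
  have := congrFun (hcont.fourierInv_fourier_eq hFint hFTi) ω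
  change _ = F ω
  rw [← this, hFT]
  change (𝓕⁻ (SchwartzMap.compCLMOfAntilipschitz ℂ (inclSnd V).hasTemperateGrowth
      inclSnd_antilipschitz (𝓕 Φ))) ω = _
  rw [SchwartzMap.fourierInv_coe]
  rfl
/-- The tensor product `1 ⊗ m`, `(1 ⊗ m)(Φ) = m (ω ↦ ∫ Φ(x, ω) dx)`. -/
def oneTensor (m : 𝓢'(V, ℂ)) : 𝓢'(Plane V, ℂ) :=
  PointwiseConvergenceCLM.precomp ℂ (partialInt V) m

/-- `A` is the STFT multiplier `A_a^{g₁,g₂} : 𝓢 → 𝓢'` with symbol `a ∈ 𝓢'` and windows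
`g₁, g₂ ∈ 𝓢`: for all `f, g ∈ 𝓢` the function `V_{g₁} f · conj (V_{g₂} g)` is a Schwartz function
and `⟨A f, g⟩ = ⟨a, conj (V_{g₁} f) · V_{g₂} g⟩ = a (V_{g₁} f · conj (V_{g₂} g))`. -/
def IsSTFTMultS (a : 𝓢'(Plane V, ℂ)) (g₁ g₂ : 𝓢(V, ℂ)) (A : 𝓢(V, ℂ) →L[ℂ] 𝓢'(V, ℂ)) : Prop :=
  ∀ f g : 𝓢(V, ℂ), ∃ Φ : 𝓢(Plane V, ℂ),
    (∀ x ω : V, Φ (WithLp.toLp 2 (x, ω)) = stft g₁ f x ω * conj (stft g₂ g x ω)) ∧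
    dualBr (A f) g = a Φ

/-- `A` is the STFT multiplier `𝓢 → 𝓢'` whose symbol is the function `a`, when the STFTs with
respect to the two windows are given on `𝓢` by `V₁` and `V₂`: for all `f, g ∈ 𝓢`,
`⟨A f, g⟩ = ∫∫ a(x, ω) V₁ f(x, ω) conj (V₂ g(x, ω)) dx dω`, an absolutely convergent integral. -/
def IsSTFTMultFunS (a : V × V → ℂ) (V₁ V₂ : 𝓢(V, ℂ) → V → V → ℂ)
    (A : 𝓢(V, ℂ) →L[ℂ] 𝓢'(V, ℂ)) : Prop :=
  ∀ f g : 𝓢(V, ℂ),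
    Integrable (fun z : V × V => a z * V₁ f z.1 z.2 * conj (V₂ g z.1 z.2)) ∧
    dualBr (A f) g = ∫ z : V × V, a z * V₁ f z.1 z.2 * conj (V₂ g z.1 z.2)

/-- `A` is the STFT multiplier `A_a^{g₁,g₂} : M¹ → M^∞` with symbol `a ∈ M^∞` and windows
`g₁, g₂ ∈ M¹`: for all `f, g ∈ M¹` the function `conj (V_{g₁} f) · V_{g₂} g` is in `M¹` and
`⟨A f, g⟩ = ⟨a, conj (V_{g₁} f) · V_{g₂} g⟩`. -/
def IsSTFTMultM (a : 𝓢'(Plane V, ℂ)) (g₁ g₂ : V → ℂ) (A : M1 V → MInf V) : Prop :=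
  ∀ f g : M1 V,
    MemM1 (fun w : Plane V => conj (stft g₁ f.1 w.fst w.snd) * stft g₂ g.1 w.fst w.snd) ∧
    pairing (A f).1 g.1 =
      pairing a (fun w : Plane V => conj (stft g₁ f.1 w.fst w.snd) * stft g₂ g.1 w.fst w.snd)

/-- The analogue of `IsSTFTMultFunS` for operators `M¹ → M^∞`. -/
def IsSTFTMultFunM (a : V × V → ℂ) (V₁ V₂ : (V → ℂ) → V → V → ℂ) (A : M1 V → MInf V) : Prop :=
  ∀ f g : M1 V,
    Integrable (fun z : V × V => a z * V₁ f.1 z.1 z.2 * conj (V₂ g.1 z.1 z.2)) ∧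
    pairing (A f).1 g.1 = ∫ z : V × V, a z * V₁ f.1 z.1 z.2 * conj (V₂ g.1 z.1 z.2)

end Basic

end TimeFreq

end

open TimeFreq

/-! Everything rests on one identity for the sesquilinear form of the multiplier. For Schwartz `f,
g, g₁, g₂` put Q(ω) = ∫ V_{g₁}f(x,ω) conj(V_{g₂}g(x,ω)) dx, so that ⟨Af, g⟩ = m(Q). Translating `g`
and `g₂` together by −η only multiplies V_{g₂}g by the character e^{2πi η·ω}. Hence 𝓕Q(η) is a Moyal
integral, equal to ⟨f, T_{−η}g⟩ · conj⟨g₁, T_{−η}g₂⟩. The first factor is the Fourier transform of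
𝓕f · conj(𝓕g) at η, the second is C_{g₁,g₂}(−η). So Q is the convolution of 𝓘𝓕⁻¹C with 𝓕f · conj(𝓕g)
(`partialInt_stftProd`), and m(Q) = D(𝓕f · conj(𝓕g)) = ⟨T_D f, g⟩ with D = m ∗ 𝓕⁻¹C. Thus T_D is the
operator sought. It is the only one because the bracket separates points, and T_{m₂} = T_D forces m₂
= D because products of Schwartz functions separate tempered distributions: the Gaussian window is
itself such a product, and a distribution with vanishing Gaussian STFT is zero
(`existsUnique_and_iff_of_form`, `eq_of_forall_fourierProd`).

If one window is a distribution, it is taken out of the double integral, which becomes that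
distribution evaluated at a superposition of time-frequency shifts of a Schwartz function
(`exists_superposition`). Interchanging the two uses that Schwartz-valued integrals commute with
tempered distributions (`apply_schwartzIntegral`). The remaining Schwartz function is computed by
Parseval and Fubini (`integral_symbol_stft_shift`). The other window is handled by complex
conjugation.

The modulation space versions follow by density. Truncating the STFT inversion formula shows that
Schwartz functions are dense in M¹ (`MemM1.exists_schwartz_approx`), so two functionals that are
Lipschitz for the M¹ norm agree as soon as they agree on Schwartz functions
(`LipschitzM1.eq_of_eq_on_schwartz`). This is applied to one M¹ variable at a time. The estimates
behind it are M¹ bounds for STFTs, convolutions and Fourier transforms, and, when the symbol lies in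
M^∞, the multilinear bound for conj(V_{g₁}f) · V_{g₂}g in M¹ of the plane
(`exists_bound_stftProdFun`). -/

noncomputable section

namespace TimeFreq

/-! ### Integrals of Schwartz-valued functions. -/

section SchwartzIntegral

variable {V : Type*} [NormedAddCommGroup V] [NormedSpace ℝ V]

theorem tendsto_seminorm_continuous (k n : ℕ) :
    Continuous (SchwartzMap.seminorm ℂ k n : 𝓢(V, ℂ) → ℝ) :=
  (schwartz_withSeminorms ℂ V ℂ).continuous_seminorm (k, n)

/-- A tempered distribution is bounded by finitely many Schwartz seminorms. -/
theorem exists_bound_seminorm (u : 𝓢'(V, ℂ)) : ∃ (s : Finset (ℕ × ℕ)) (C : ℝ), 0 ≤ C ∧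
    ∀ φ : 𝓢(V, ℂ), ‖u φ‖ ≤ C * ∑ i ∈ s, SchwartzMap.seminorm ℂ i.1 i.2 φ := by
  obtain ⟨s, C, -, h⟩ := Seminorm.bound_of_continuous (schwartz_withSeminorms ℂ V ℂ)
    ((normSeminorm ℂ ℂ).comp (u : 𝓢(V, ℂ) →ₗ[ℂ] ℂ)) (continuous_norm.comp u.continuous)
  refine ⟨s, C, C.2, fun φ => (h φ).trans ?_⟩
  refine mul_le_mul_of_nonneg_left ?_ C.2
  have := Seminorm.le_def.1 (Seminorm.finset_sup_le_sum (schwartzSeminormFamily ℂ V ℂ) s) φ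
  refine this.trans_eq ?_
  simp only [← FunLike.coeAddMonoidHom_apply, map_sum, Finset.sum_apply]
  rfl

variable (V) in
/-- The normed space of continuous `n`-linear maps `V^n → ℂ`. -/
def MultilinearSpace (n : ℕ) : Type _ := V [×n]→L[ℝ] ℂ

instance (n : ℕ) : NormedAddCommGroup (MultilinearSpace V n) :=
  inferInstanceAs (NormedAddCommGroup (V [×n]→L[ℝ] ℂ))

instance (n : ℕ) : NormedSpace ℝ (MultilinearSpace V n) :=
  inferInstanceAs (NormedSpace ℝ (V [×n]→L[ℝ] ℂ))

instance (n : ℕ) : NormedSpace ℂ (MultilinearSpace V n) :=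
  inferInstanceAs (NormedSpace ℂ (V [×n]→L[ℝ] ℂ))

instance (n : ℕ) : CompleteSpace (MultilinearSpace V n) :=
  inferInstanceAs (CompleteSpace (V [×n]→L[ℝ] ℂ))

/-- The iterated derivative of a Schwartz function. -/
def iterDeriv (n : ℕ) (φ : 𝓢(V, ℂ)) (t : V) : MultilinearSpace V n := iteratedFDeriv ℝ n φ t

theorem continuous_iterDeriv (n : ℕ) (φ : 𝓢(V, ℂ)) : Continuous (iterDeriv n φ) :=
  (φ.smooth n).continuous_iteratedFDeriv le_rfl

theorem iterDeriv_add (n : ℕ) (φ ψ : 𝓢(V, ℂ)) (t : V) :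
    iterDeriv n (φ + ψ) t = iterDeriv n φ t + iterDeriv n ψ t := by
  unfold iterDeriv
  rw [show (⇑(φ + ψ) : V → ℂ) = ⇑φ + ⇑ψ from rfl, iteratedFDeriv_add (φ.smooth n) (ψ.smooth n)]
  rfl

theorem iterDeriv_smul (n : ℕ) (c : ℂ) (φ : 𝓢(V, ℂ)) (t : V) :
    iterDeriv n (c • φ) t = c • iterDeriv n φ t := by
  unfold iterDeriv
  rw [show (⇑(c • φ) : V → ℂ) = c • ⇑φ from rfl,
    iteratedFDeriv_const_smul_apply (φ.smooth n).contDiffAt]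
  rfl

/-- Currying the first variable. -/
def curryLeftSpace (n : ℕ) :
    (V →L[ℝ] MultilinearSpace V n) ≃ₗᵢ[ℝ] MultilinearSpace V (n + 1) :=
  (continuousMultilinearCurryLeftEquiv ℝ (fun _ : Fin (n + 1) => V) ℂ).symm

theorem iterDeriv_succ (n : ℕ) (φ : 𝓢(V, ℂ)) (t : V) :
    iterDeriv (n + 1) φ t = curryLeftSpace n (fderiv ℝ (iterDeriv n φ) t) := by
  unfold iterDeriv
  rw [iteratedFDeriv_succ_eq_comp_left]
  rfl

variable (V) in
/-- Multilinear maps of zero variables. -/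
def curryZeroSpace : ℂ ≃ₗᵢ[ℝ] MultilinearSpace V 0 :=
  (continuousMultilinearCurryFin0 ℝ V ℂ).symm

theorem pow_mul_norm_iterDeriv_le (k n : ℕ) (φ : 𝓢(V, ℂ)) (t : V) :
    ‖‖t‖ ^ k • iterDeriv n φ t‖ ≤ SchwartzMap.seminorm ℂ k n φ := by
  rw [norm_smul, norm_pow, norm_norm]; exact SchwartzMap.le_seminorm ℂ k n φ t

/-- The weighted derivative `‖t‖^k • D^n φ(t)` as a bounded continuous function. -/
def weightedDeriv (k n : ℕ) : 𝓢(V, ℂ) →ₗ[ℂ] BoundedContinuousFunction V (MultilinearSpace V n) where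
  toFun φ := BoundedContinuousFunction.ofNormedAddCommGroup
    (fun t => ‖t‖ ^ k • iterDeriv n φ t)
    ((continuous_norm.pow k).smul (continuous_iterDeriv n φ))
    (SchwartzMap.seminorm ℂ k n φ) (pow_mul_norm_iterDeriv_le k n φ)
  map_add' φ ψ := by
    ext1 t
    simp only [BoundedContinuousFunction.coe_ofNormedAddCommGroup,
      BoundedContinuousFunction.add_apply]
    rw [← smul_add, iterDeriv_add]
  map_smul' c φ := by
    ext1 t
    simp only [BoundedContinuousFunction.coe_ofNormedAddCommGroup, RingHom.id_apply,
      BoundedContinuousFunction.smul_apply]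
    rw [smul_comm c, iterDeriv_smul]

theorem weightedDeriv_apply (k n : ℕ) (φ : 𝓢(V, ℂ)) (t : V) :
    weightedDeriv k n φ t = ‖t‖ ^ k • iterDeriv n φ t := rfl

/-- Each Schwartz seminorm is thereby the norm of a linear image in a Banach space, where Bochner
integration is available. -/
theorem norm_weightedDeriv (k n : ℕ) (φ : 𝓢(V, ℂ)) :
    ‖weightedDeriv k n φ‖ = SchwartzMap.seminorm ℂ k n φ := by
  apply le_antisymm
  · exact BoundedContinuousFunction.norm_ofNormedAddCommGroup_le _ (apply_nonneg _ _)
      (pow_mul_norm_iterDeriv_le k n φ)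
  · refine SchwartzMap.seminorm_le_bound ℂ k n φ (norm_nonneg (weightedDeriv k n φ)) fun t => ?_
    have := BoundedContinuousFunction.norm_coe_le_norm (weightedDeriv k n φ) t
    rwa [weightedDeriv_apply, norm_smul, norm_pow, norm_norm] at this

theorem continuous_weightedDeriv (k n : ℕ) : Continuous (weightedDeriv k n : 𝓢(V, ℂ) → _) := by
  refine WithSeminorms.continuous_normedSpace_rng
    (BoundedContinuousFunction V (MultilinearSpace V n)) (schwartz_withSeminorms ℂ V ℂ) _
    ⟨{(k, n)}, 1, fun φ => ?_⟩
  simp [norm_weightedDeriv]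

variable {Z : Type*} [TopologicalSpace Z] [MeasurableSpace Z] [OpensMeasurableSpace Z]
  [SecondCountableTopology Z] {μ : Measure Z} {G : Z → 𝓢(V, ℂ)}

theorem integrable_weightedDeriv (hG : Continuous G)
    (hp : ∀ k n, Integrable (fun z => SchwartzMap.seminorm ℂ k n (G z)) μ) (k n : ℕ) :
    Integrable (fun z => weightedDeriv k n (G z)) μ := by
  refine Integrable.mono' (hp k n) ((continuous_weightedDeriv k n).comp hG).aestronglyMeasurable ?_
  exact .of_forall fun z => (norm_weightedDeriv k n (G z)).le

theorem integrable_weightedDeriv_apply (hG : Continuous G)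
    (hp : ∀ k n, Integrable (fun z => SchwartzMap.seminorm ℂ k n (G z)) μ) (k n : ℕ) (t : V) :
    Integrable (fun z => weightedDeriv k n (G z) t) μ :=
  (BoundedContinuousFunction.evalCLM ℝ t).integrable_comp (integrable_weightedDeriv hG hp k n)

theorem integrable_iterDeriv_apply (hG : Continuous G)
    (hp : ∀ k n, Integrable (fun z => SchwartzMap.seminorm ℂ k n (G z)) μ) (n : ℕ) (t : V) :
    Integrable (fun z => iterDeriv n (G z) t) μ := by
  simpa [weightedDeriv_apply] using integrable_weightedDeriv_apply hG hp 0 n t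

/-- Differentiation under the integral sign: the seminorm with indices `(0, n + 1)` dominates the
derivative uniformly in `t`. -/
theorem hasFDerivAt_integral_iterDeriv (hG : Continuous G)
    (hp : ∀ k n, Integrable (fun z => SchwartzMap.seminorm ℂ k n (G z)) μ) (n : ℕ) (t : V) :
    HasFDerivAt (fun t => ∫ z, iterDeriv n (G z) t ∂μ)
      (∫ z, fderiv ℝ (iterDeriv n (G z)) t ∂μ) t := by
  have hm : AEStronglyMeasurable (fun z => fderiv ℝ (iterDeriv n (G z)) t) μ := by
    have h1 := (integrable_iterDeriv_apply hG hp (n + 1) t).aestronglyMeasurable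
    have h2 := (curryLeftSpace n).symm.continuous.comp_aestronglyMeasurable h1
    refine h2.congr (.of_forall fun z => ?_)
    simp only [iterDeriv_succ, LinearIsometryEquiv.symm_apply_apply]
  refine hasFDerivAt_integral_of_dominated_of_fderiv_le (s := Set.univ)
    (F' := fun t z => fderiv ℝ (iterDeriv n (G z)) t)
    (bound := fun z => SchwartzMap.seminorm ℂ 0 (n + 1) (G z)) Filter.univ_mem
    (.of_forall fun s => (integrable_iterDeriv_apply hG hp n s).aestronglyMeasurable)
    (integrable_iterDeriv_apply hG hp n t) hm (.of_forall fun z s _ => ?_) (hp 0 (n + 1))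
    (.of_forall fun z s _ => ?_)
  · rw [← LinearIsometryEquiv.norm_map (curryLeftSpace n), ← iterDeriv_succ]
    exact SchwartzMap.norm_iteratedFDeriv_le_seminorm ℂ (G z) (n + 1) s
  · exact (((G z).smooth (n + 1)).differentiable_iteratedFDeriv
      (by exact_mod_cast Nat.lt_succ_self n) s).hasFDerivAt

theorem iteratedFDeriv_integral (hG : Continuous G)
    (hp : ∀ k n, Integrable (fun z => SchwartzMap.seminorm ℂ k n (G z)) μ) (n : ℕ) (t : V) :
    (iteratedFDeriv ℝ n (fun t => ∫ z, G z t ∂μ) t : MultilinearSpace V n) =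
      ∫ z, iterDeriv n (G z) t ∂μ := by
  induction n generalizing t with
  | zero => exact ((curryZeroSpace V).toContinuousLinearEquiv.integral_comp_comm _).symm
  | succ n ih =>
    have h : iteratedFDeriv ℝ n (fun t => ∫ z, G z t ∂μ) = fun t => ∫ z, iterDeriv n (G z) t ∂μ :=
      funext ih
    have h2 := (hasFDerivAt_integral_iterDeriv hG hp n t).fderiv
    have h3 : (iteratedFDeriv ℝ (n + 1) (fun t => ∫ z, G z t ∂μ) t : MultilinearSpace V (n + 1)) =
        curryLeftSpace n (fderiv ℝ (fun t => ∫ z, iterDeriv n (G z) t ∂μ) t) := by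
      rw [iteratedFDeriv_succ_eq_comp_left, h]; rfl
    rw [h3, h2]
    refine ((curryLeftSpace n).toContinuousLinearEquiv.integral_comp_comm _).symm.trans ?_
    refine integral_congr_ae (.of_forall fun z => ?_)
    exact (iterDeriv_succ n (G z) t).symm

/-- The integral of a continuous family of Schwartz functions with integrable seminorms. -/
def schwartzIntegral (hG : Continuous G)
    (hp : ∀ k n, Integrable (fun z => SchwartzMap.seminorm ℂ k n (G z)) μ) : 𝓢(V, ℂ) where
  toFun t := ∫ z, G z t ∂μ
  smooth' := by
    refine contDiff_of_differentiable_iteratedFDeriv fun n _ => ?_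
    have : iteratedFDeriv ℝ n (fun t => ∫ z, G z t ∂μ) = fun t => ∫ z, iterDeriv n (G z) t ∂μ :=
      funext (iteratedFDeriv_integral hG hp n)
    rw [this]
    exact fun t => (hasFDerivAt_integral_iterDeriv hG hp n t).differentiableAt
  decay' k n := by
    refine ⟨∫ z, SchwartzMap.seminorm ℂ k n (G z) ∂μ, fun t => ?_⟩
    have h : ‖iteratedFDeriv ℝ n (fun t => ∫ z, G z t ∂μ) t‖ = ‖∫ z, iterDeriv n (G z) t ∂μ‖ :=
      congrArg norm (iteratedFDeriv_integral hG hp n t)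
    rw [h, ← norm_norm t, ← norm_pow, ← norm_smul, ← integral_smul]
    exact norm_integral_le_of_norm_le (hp k n)
      (.of_forall fun z => pow_mul_norm_iterDeriv_le k n (G z) t)

theorem schwartzIntegral_apply (hG : Continuous G)
    (hp : ∀ k n, Integrable (fun z => SchwartzMap.seminorm ℂ k n (G z)) μ) (t : V) :
    schwartzIntegral hG hp t = ∫ z, G z t ∂μ := rfl

theorem weightedDeriv_schwartzIntegral (hG : Continuous G)
    (hp : ∀ k n, Integrable (fun z => SchwartzMap.seminorm ℂ k n (G z)) μ) (k n : ℕ) :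
    weightedDeriv k n (schwartzIntegral hG hp) = ∫ z, weightedDeriv k n (G z) ∂μ := by
  ext1 t
  have h1 := (BoundedContinuousFunction.evalCLM (β := MultilinearSpace V n) ℝ t).integral_comp_comm
    (integrable_weightedDeriv hG hp k n)
  refine Eq.trans ?_ h1
  rw [weightedDeriv_apply]
  have h2 : iterDeriv n (schwartzIntegral hG hp) t = ∫ z, iterDeriv n (G z) t ∂μ :=
    iteratedFDeriv_integral hG hp n t
  rw [h2, ← integral_smul]
  rfl

theorem integrable_apply_of_seminorm (hG : Continuous G)
    (hp : ∀ k n, Integrable (fun z => SchwartzMap.seminorm ℂ k n (G z)) μ) (u : 𝓢'(V, ℂ)) :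
    Integrable (fun z => u (G z)) μ := by
  obtain ⟨s, C, hC, h⟩ := exists_bound_seminorm u
  exact ((integrable_finsetSum s fun i _ => hp i.1 i.2).const_mul C).mono'
    (u.continuous.comp hG).aestronglyMeasurable (.of_forall fun z => h _)

/-- Tempered distributions commute with integrals of Schwartz functions. -/
theorem apply_schwartzIntegral (hG : Continuous G)
    (hp : ∀ k n, Integrable (fun z => SchwartzMap.seminorm ℂ k n (G z)) μ) (u : 𝓢'(V, ℂ)) :
    u (schwartzIntegral hG hp) = ∫ z, u (G z) ∂μ := by
  obtain ⟨s, C, hC, h⟩ := exists_bound_seminorm u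
  -- Only the finitely many seminorms in `s` control `u`, so `u` factors through this map into a
  -- finite product of Banach spaces.
  let J : 𝓢(V, ℂ) →ₗ[ℂ] (∀ i : s, BoundedContinuousFunction V (MultilinearSpace V i.1.2)) :=
    LinearMap.pi fun i => weightedDeriv i.1.1 i.1.2
  have hJ : ∀ φ, ‖u φ‖ ≤ C * s.card * ‖J φ‖ := fun φ => by
    refine (h φ).trans ?_
    rw [mul_assoc]
    refine mul_le_mul_of_nonneg_left ?_ hC
    rw [← nsmul_eq_mul]
    refine Finset.sum_le_card_nsmul _ _ _ fun i hi => ?_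
    rw [← norm_weightedDeriv]
    exact norm_le_pi_norm (J φ) ⟨i, hi⟩
  have hker : J.ker ≤ LinearMap.ker (u : 𝓢(V, ℂ) →ₗ[ℂ] ℂ) := fun φ hφ => by
    have := hJ φ
    rw [show J φ = 0 from LinearMap.mem_ker.1 hφ, show ‖(0 : ∀ i : s,
      BoundedContinuousFunction V (MultilinearSpace V i.1.2))‖ = 0 from norm_zero, mul_zero] at this
    exact LinearMap.mem_ker.2 (norm_le_zero_iff.1 this)
  let U₀ : J.range →ₗ[ℂ] ℂ :=
    (J.ker.liftQ (u : 𝓢(V, ℂ) →ₗ[ℂ] ℂ) hker) ∘ₗ J.quotKerEquivRange.symm.toLinearMap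
  have hU₀ : ∀ φ, U₀ ⟨J φ, φ, rfl⟩ = u φ := fun φ => by
    have e : J.quotKerEquivRange.symm ⟨J φ, φ, rfl⟩ = Submodule.Quotient.mk φ := by
      rw [LinearEquiv.symm_apply_eq]; rfl
    simp only [U₀, LinearMap.comp_apply, LinearEquiv.coe_coe, e]
    rfl
  let U₁ : StrongDual ℂ J.range := U₀.mkContinuous (C * s.card) (by
    rintro ⟨-, φ, rfl⟩
    rw [hU₀]; exact hJ φ)
  -- Hahn–Banach: the factor of `u` lives only on the range of `J`, whereas the Bochner integral is
  -- taken in the whole product.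
  obtain ⟨U, hU, -⟩ := exists_extension_norm_eq _ U₁
  have hUJ : ∀ φ, U (J φ) = u φ := fun φ => by
    rw [← hU₀ φ]; exact hU ⟨J φ, φ, rfl⟩
  have hint : Integrable (fun z => J (G z)) μ :=
    Integrable.of_eval fun i => integrable_weightedDeriv hG hp _ _
  have : J (schwartzIntegral hG hp) = ∫ z, J (G z) ∂μ := by
    funext i
    refine (weightedDeriv_schwartzIntegral hG hp _ _).trans ?_
    exact (ContinuousLinearMap.proj (R := ℝ)
      (φ := fun i : s => BoundedContinuousFunction V (MultilinearSpace V i.1.2))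
      i).integral_comp_comm hint
  rw [← hUJ, this, ← U.integral_comp_comm hint]
  simp only [hUJ]

end SchwartzIntegral

/-! ### Seminorm estimates for translations and modulations. -/

section Shift

variable {V : Type*} [NormedAddCommGroup V] [InnerProductSpace ℝ V]

theorem charFn_zero_right : charFn (0 : V) = 1 := by
  funext t; simp [charFn]

theorem charFn_add_left (ω s t : V) : charFn ω (s + t) = charFn ω s * charFn ω t := by
  simp only [charFn, ← Complex.exp_add, inner_add_left]; push_cast; ring_nf

theorem charFn_add_right (ω η t : V) : charFn (ω + η) t = charFn ω t * charFn η t := by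
  simp only [charFn, ← Complex.exp_add, inner_add_right]; push_cast; ring_nf

theorem charFn_comm (ω t : V) : charFn ω t = charFn t ω := by
  simp only [charFn, real_inner_comm]

theorem charFn_neg_right (ω t : V) : charFn (-ω) t = conj (charFn ω t) := by
  simp only [charFn, ← Complex.exp_conj, inner_neg_right, map_mul, Complex.conj_ofReal,
    Complex.conj_I, Complex.conj_ofNat]
  congr 1; push_cast; ring

theorem charFn_neg_left (ω t : V) : charFn ω (-t) = conj (charFn ω t) := by
  rw [charFn_comm, charFn_neg_right, charFn_comm]

theorem norm_charFn (ω t : V) : ‖charFn ω t‖ = 1 := by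
  simp only [charFn]
  rw [show (2 * Real.pi * Complex.I * (inner ℝ t ω : ℝ) : ℂ)
    = ((2 * Real.pi * inner ℝ t ω : ℝ) : ℂ) * Complex.I by push_cast; ring]
  exact Complex.norm_exp_ofReal_mul_I _

theorem charFn_mul_conj (ω t : V) : charFn ω t * conj (charFn ω t) = 1 := by
  rw [Complex.mul_conj, Complex.normSq_eq_norm_sq, norm_charFn]; simp

theorem continuous_charFn {X : Type*} [TopologicalSpace X] {f g : X → V} (hf : Continuous f)
    (hg : Continuous g) : Continuous (fun x => charFn (f x) (g x)) := by
  unfold charFn; fun_prop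

theorem fourierChar_smul_eq (ω t : V) (c : ℂ) :
    Real.fourierChar (-inner ℝ t ω) • c = conj (charFn ω t) * c := by
  rw [← charFn_neg_right, Circle.smul_def, smul_eq_mul, Real.fourierChar_apply, charFn,
    inner_neg_right]
  congr 2; push_cast; ring

theorem fourierChar_smul_eq' (ω t : V) (c : ℂ) :
    Real.fourierChar (inner ℝ t ω) • c = charFn ω t * c := by
  rw [Circle.smul_def, smul_eq_mul, Real.fourierChar_apply, charFn]
  congr 2; push_cast; ring

theorem norm_iteratedFDeriv_charFn_le (ω t : V) (n : ℕ) :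
    ‖iteratedFDeriv ℝ n (charFn ω) t‖ ≤ (2 * Real.pi * ‖ω‖) ^ n := by
  have e : charFn ω = (fun s : ℝ => Complex.exp ((2 * Real.pi * Complex.I) * s)) ∘ innerSL ℝ ω := by
    funext t; simp [charFn, real_inner_comm]
  rw [e, ContinuousLinearMap.iteratedFDeriv_comp_right _
    (contDiff_cexp_ofReal _ (N := n)) _ le_rfl]
  refine (ContinuousMultilinearMap.norm_compContinuousLinearMap_le _ _).trans ?_
  rw [norm_iteratedFDeriv_eq_norm_iteratedDeriv, iteratedDeriv_cexp_ofReal, norm_mul, norm_pow]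
  have h1 : ‖(2 * Real.pi * Complex.I : ℂ)‖ = 2 * Real.pi := by
    simp [abs_of_pos Real.pi_pos]
  have h2 : ‖Complex.exp (2 * Real.pi * Complex.I * ((innerSL ℝ ω t : ℝ) : ℂ))‖ = 1 := by
    rw [show (2 * Real.pi * Complex.I * ((innerSL ℝ ω t : ℝ) : ℂ) : ℂ)
      = ((2 * Real.pi * innerSL ℝ ω t : ℝ) : ℂ) * Complex.I by push_cast; ring]
    exact Complex.norm_exp_ofReal_mul_I _
  rw [h1, h2, mul_one, Finset.prod_const, Finset.card_univ, Fintype.card_fin, innerSL_apply_norm,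
    ← mul_pow]

/-- The maximum of the Schwartz seminorms with indices at most `(k, n)`. -/
def supSeminorm (k n : ℕ) : Seminorm ℂ 𝓢(V, ℂ) :=
  (Finset.Iic (k, n)).sup fun m => SchwartzMap.seminorm ℂ m.1 m.2

theorem seminorm_le_supSeminorm {k n k' n' : ℕ} (hk : k' ≤ k) (hn : n' ≤ n) (φ : 𝓢(V, ℂ)) :
    SchwartzMap.seminorm ℂ k' n' φ ≤ supSeminorm k n φ :=
  Seminorm.le_def.1 (Finset.le_sup (f := fun m : ℕ × ℕ => SchwartzMap.seminorm ℂ m.1 m.2)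
    (Finset.mem_Iic.2 (Prod.mk_le_mk.2 ⟨hk, hn⟩) : (k', n') ∈ Finset.Iic (k, n))) φ

theorem supSeminorm_mono {k n k' n' : ℕ} (hk : k' ≤ k) (hn : n' ≤ n) (φ : 𝓢(V, ℂ)) :
    supSeminorm k' n' φ ≤ supSeminorm k n φ :=
  Seminorm.finset_sup_apply_le (apply_nonneg _ _) fun i hi => by
    obtain ⟨h1, h2⟩ := Prod.mk_le_mk.1 (Finset.mem_Iic.1 hi)
    exact seminorm_le_supSeminorm (h1.trans hk) (h2.trans hn) φ

theorem continuous_supSeminorm (k n : ℕ) : Continuous (supSeminorm k n : 𝓢(V, ℂ) → ℝ) :=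
  Seminorm.continuous_finsetSup fun i _ => tendsto_seminorm_continuous i.1 i.2

theorem iteratedFDeriv_translS (x : V) (φ : 𝓢(V, ℂ)) (n : ℕ) (t : V) :
    iteratedFDeriv ℝ n (translS x φ) t = iteratedFDeriv ℝ n φ (t - x) :=
  iteratedFDeriv_comp_sub n x t

theorem pow_mul_norm_iteratedFDeriv_sub_le (k n : ℕ) (φ : 𝓢(V, ℂ)) (x t : V) :
    ‖t‖ ^ k * ‖iteratedFDeriv ℝ n φ (t - x)‖ ≤ (1 + ‖x‖) ^ k * (2 ^ k * supSeminorm k n φ) := by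
  have h := SchwartzMap.one_add_le_sup_seminorm_apply (𝕜 := ℂ) (m := (k, n)) le_rfl le_rfl φ (t - x)
  -- Submultiplicativity of the weight: moving the origin by `x` costs at most a factor `1 + ‖x‖`
  -- per power.
  have h2 : ‖t‖ ≤ (1 + ‖x‖) * (1 + ‖t - x‖) := by
    have : ‖t‖ ≤ ‖t - x‖ + ‖x‖ := by simpa using norm_add_le (t - x) x
    nlinarith [mul_nonneg (norm_nonneg x) (norm_nonneg (t - x))]
  calc ‖t‖ ^ k * ‖iteratedFDeriv ℝ n φ (t - x)‖
      ≤ ((1 + ‖x‖) * (1 + ‖t - x‖)) ^ k * ‖iteratedFDeriv ℝ n φ (t - x)‖ := by gcongr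
    _ = (1 + ‖x‖) ^ k * ((1 + ‖t - x‖) ^ k * ‖iteratedFDeriv ℝ n φ (t - x)‖) := by
        rw [mul_pow]; ring
    _ ≤ _ := mul_le_mul_of_nonneg_left h (by positivity)

theorem seminorm_translS_le (k n : ℕ) (x : V) (φ : 𝓢(V, ℂ)) :
    SchwartzMap.seminorm ℂ k n (translS x φ) ≤ (1 + ‖x‖) ^ k * (2 ^ k * supSeminorm k n φ) := by
  refine SchwartzMap.seminorm_le_bound ℂ k n _ (by positivity) fun t => ?_
  rw [iteratedFDeriv_translS]
  exact pow_mul_norm_iteratedFDeriv_sub_le k n φ x t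

theorem supSeminorm_translS_le (k n : ℕ) (x : V) (φ : 𝓢(V, ℂ)) :
    supSeminorm k n (translS x φ) ≤ (1 + ‖x‖) ^ k * (2 ^ k * supSeminorm k n φ) := by
  refine Seminorm.finset_sup_apply_le (by positivity) fun i hi => ?_
  obtain ⟨h1, h2⟩ := Prod.mk_le_mk.1 (Finset.mem_Iic.1 hi)
  refine (seminorm_translS_le i.1 i.2 x φ).trans ?_
  have := supSeminorm_mono h1 h2 φ
  have h3 : 1 ≤ 1 + ‖x‖ := by linarith [norm_nonneg x]
  gcongr
  norm_num

theorem modS_apply (ω : V) (φ : 𝓢(V, ℂ)) (t : V) : modS ω φ t = charFn ω t * φ t := by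
  simp [modS, SchwartzMap.smulLeftCLM_apply_apply (charFn_hasTemperateGrowth ω)]

theorem translS_apply (x : V) (φ : 𝓢(V, ℂ)) (t : V) : translS x φ t = φ (t - x) := rfl

theorem seminorm_modS_le (k n : ℕ) (ω : V) (φ : 𝓢(V, ℂ)) :
    SchwartzMap.seminorm ℂ k n (modS ω φ) ≤ (1 + 2 * Real.pi * ‖ω‖) ^ n * supSeminorm k n φ := by
  have hpi := Real.pi_pos
  refine SchwartzMap.seminorm_le_bound ℂ k n _ (by positivity) fun t => ?_
  have e : (modS ω φ : V → ℂ) = fun t => charFn ω t * φ t := funext (modS_apply ω φ)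
  rw [e]
  have h := norm_iteratedFDeriv_mul_le (𝕜 := ℝ) (n := n) (N := n)
    ((charFn_hasTemperateGrowth ω).1.of_le (by exact_mod_cast le_top)) (φ.smooth n) t le_rfl
  calc _ ≤ ‖t‖ ^ k * ∑ i ∈ Finset.range (n + 1), (n.choose i : ℝ) *
        ‖iteratedFDeriv ℝ i (charFn ω) t‖ * ‖iteratedFDeriv ℝ (n - i) φ t‖ := by gcongr
    _ = ∑ i ∈ Finset.range (n + 1), (n.choose i : ℝ) *
        ‖iteratedFDeriv ℝ i (charFn ω) t‖ * (‖t‖ ^ k * ‖iteratedFDeriv ℝ (n - i) φ t‖) := by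
      rw [Finset.mul_sum]; exact Finset.sum_congr rfl fun i _ => by ring
    _ ≤ ∑ i ∈ Finset.range (n + 1), (n.choose i : ℝ) *
        (2 * Real.pi * ‖ω‖) ^ i * supSeminorm k n φ := by
      refine Finset.sum_le_sum fun i _ => ?_
      gcongr
      · exact norm_iteratedFDeriv_charFn_le ω t i
      · exact (SchwartzMap.le_seminorm ℂ k (n - i) φ t).trans
          (seminorm_le_supSeminorm le_rfl (Nat.sub_le _ _) φ)
    _ = _ := by
      rw [← Finset.sum_mul, add_comm 1, add_pow]
      congr 1
      exact Finset.sum_congr rfl fun i _ => by simp; ring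

theorem seminorm_tfShift_le (k n : ℕ) (x ω : V) (φ : 𝓢(V, ℂ)) :
    SchwartzMap.seminorm ℂ k n (modS ω (translS x φ)) ≤
      (1 + 2 * Real.pi * ‖ω‖) ^ n * ((1 + ‖x‖) ^ k * (2 ^ k * supSeminorm k n φ)) := by
  have hpi := Real.pi_pos
  refine (seminorm_modS_le k n ω _).trans ?_
  gcongr
  exact supSeminorm_translS_le k n x φ

theorem continuous_schwartz_of_seminorm {Z : Type*} [TopologicalSpace Z] {G : Z → 𝓢(V, ℂ)}
    (h : ∀ z₀ k n, Filter.Tendsto (fun z => SchwartzMap.seminorm ℂ k n (G z - G z₀)) (nhds z₀)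
      (nhds 0)) : Continuous G := by
  refine continuous_iff_continuousAt.2 fun z₀ => ?_
  refine ((schwartz_withSeminorms ℂ V ℂ).tendsto_nhds G (G z₀)).2 fun i ε hε => ?_
  exact (h z₀ i.1 i.2).eventually_lt_const hε

/-- The mean value inequality on a ball, applied to `s ↦ ‖t‖ ^ k • iterDeriv n φ (t - s)`; one more
derivative of `φ` enters the bound. -/
theorem seminorm_translS_sub_le (k n : ℕ) {R : ℝ} {x y : V} (hx : ‖x‖ ≤ R) (hy : ‖y‖ ≤ R)
    (φ : 𝓢(V, ℂ)) : SchwartzMap.seminorm ℂ k n (translS x φ - translS y φ) ≤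
      ((1 + R) ^ k * (2 ^ k * supSeminorm k (n + 1) φ)) * ‖x - y‖ := by
  have hR : 0 ≤ R := (norm_nonneg x).trans hx
  refine SchwartzMap.seminorm_le_bound ℂ k n _ (by positivity) fun t => ?_
  have e : iteratedFDeriv ℝ n (translS x φ - translS y φ) t
      = iteratedFDeriv ℝ n φ (t - x) - iteratedFDeriv ℝ n φ (t - y) := by
    rw [← iteratedFDeriv_translS, ← iteratedFDeriv_translS]
    exact iteratedFDeriv_sub_apply ((translS x φ).smooth n).contDiffAt
      ((translS y φ).smooth n).contDiffAt
  have hd : ∀ s, HasFDerivAt (iterDeriv n φ) (fderiv ℝ (iterDeriv n φ) s) s := fun s =>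
    ((φ.smooth (n + 1)).differentiable_iteratedFDeriv (by exact_mod_cast Nat.lt_succ_self n) s
      ).hasFDerivAt
  have hdx : ∀ s, HasFDerivAt (fun s => ‖t‖ ^ k • iterDeriv n φ (t - s))
      (‖t‖ ^ k • (fderiv ℝ (iterDeriv n φ) (t - s)).comp (-ContinuousLinearMap.id ℝ V)) s :=
    fun s => ((hd (t - s)).comp s ((hasFDerivAt_id s).const_sub t)).fun_const_smul (‖t‖ ^ k)
  have := (convex_closedBall (0 : V) R).norm_image_sub_le_of_norm_hasFDerivWithin_le
    (f := fun s => ‖t‖ ^ k • iterDeriv n φ (t - s))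
    (C := (1 + R) ^ k * (2 ^ k * supSeminorm k (n + 1) φ))
    (fun s _ => (hdx s).hasFDerivWithinAt) (fun s hs => ?_)
    (mem_closedBall_zero_iff.2 hy) (mem_closedBall_zero_iff.2 hx)
  · rw [← smul_sub, norm_smul, norm_pow, norm_norm] at this
    rw [e]
    exact this
  · rw [norm_smul, norm_pow, norm_norm]
    have h1 : ‖(fderiv ℝ (iterDeriv n φ) (t - s)).comp (-ContinuousLinearMap.id ℝ V)‖
        ≤ ‖iteratedFDeriv ℝ (n + 1) φ (t - s)‖ := by
      rw [ContinuousLinearMap.comp_neg, ContinuousLinearMap.comp_id, norm_neg]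
      rw [← LinearIsometryEquiv.norm_map (curryLeftSpace n), ← iterDeriv_succ]
      rfl
    have hs' : ‖s‖ ≤ R := mem_closedBall_zero_iff.1 hs
    calc _ ≤ ‖t‖ ^ k * ‖iteratedFDeriv ℝ (n + 1) φ (t - s)‖ := by gcongr
      _ ≤ (1 + ‖s‖) ^ k * (2 ^ k * supSeminorm k (n + 1) φ) :=
        pow_mul_norm_iteratedFDeriv_sub_le k (n + 1) φ s t
      _ ≤ _ := by gcongr

theorem continuous_translS (φ : 𝓢(V, ℂ)) : Continuous (fun x : V => translS x φ) := by
  refine continuous_schwartz_of_seminorm fun y k n => ?_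
  have h1 : Filter.Tendsto (fun x : V => ((1 + (‖y‖ + 1)) ^ k *
      (2 ^ k * supSeminorm k (n + 1) φ)) * ‖x - y‖) (nhds y) (nhds 0) := by
    have : Continuous (fun x : V => ((1 + (‖y‖ + 1)) ^ k *
      (2 ^ k * supSeminorm k (n + 1) φ)) * ‖x - y‖) := by fun_prop
    simpa using this.tendsto y
  refine squeeze_zero' (.of_forall fun x => apply_nonneg _ _) ?_ h1
  filter_upwards [Metric.ball_mem_nhds y one_pos] with x hx
  refine seminorm_translS_sub_le k n ?_ (by linarith) φ
  have := norm_sub_norm_le x y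
  rw [Metric.mem_ball, dist_eq_norm] at hx
  linarith

end Shift

/-! ### Continuity and superpositions of time-frequency shifts. -/

section ShiftFourier

variable {V : Type*} [NormedAddCommGroup V] [InnerProductSpace ℝ V] [FiniteDimensional ℝ V]
  [MeasurableSpace V] [BorelSpace V]

theorem fourier_eq_charFn (f : V → ℂ) (ω : V) : 𝓕 f ω = ∫ t, conj (charFn ω t) * f t := by
  rw [Real.fourier_eq]; simp only [fourierChar_smul_eq]

theorem fourierInv_eq_charFn (f : V → ℂ) (ω : V) : 𝓕⁻ f ω = ∫ t, charFn ω t * f t := by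
  rw [Real.fourierInv_eq]; simp only [fourierChar_smul_eq']

theorem fourier_modS (ω : V) (φ : 𝓢(V, ℂ)) : 𝓕 (modS ω φ) = translS ω (𝓕 φ) := by
  ext η
  rw [translS_apply, SchwartzMap.fourier_coe, SchwartzMap.fourier_coe, fourier_eq_charFn,
    fourier_eq_charFn]
  congr 1; funext t
  rw [modS_apply, sub_eq_add_neg, charFn_add_right, charFn_neg_right, map_mul, Complex.conj_conj]
  ring

/-- Reduces continuity of `ω ↦ modS ω φ` to continuity of translations. -/
theorem modS_eq (ω : V) (φ : 𝓢(V, ℂ)) : modS ω φ = 𝓕⁻ (translS ω (𝓕 φ)) := by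
  rw [← fourier_modS, FourierTransform.fourierInv_fourier_eq]

theorem continuous_modS (φ : 𝓢(V, ℂ)) : Continuous (fun ω : V => modS ω φ) := by
  simp only [modS_eq]
  exact (fourierInvCLM ℂ 𝓢(V, ℂ)).continuous.comp (continuous_translS _)

theorem continuous_tfShift (φ : 𝓢(V, ℂ)) :
    Continuous (fun z : V × V => modS z.2 (translS z.1 φ)) := by
  refine continuous_schwartz_of_seminorm fun z₀ k n => ?_
  have h1 : Continuous fun z : V × V => (1 + 2 * Real.pi * ‖z.2‖) ^ n *
      supSeminorm k n (translS z.1 φ - translS z₀.1 φ) +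
      SchwartzMap.seminorm ℂ k n (modS z.2 (translS z₀.1 φ) - modS z₀.2 (translS z₀.1 φ)) := by
    have := continuous_supSeminorm (V := V) k n
    have h2 := (continuous_translS φ).comp (continuous_fst (X := V) (Y := V))
    have h3 := (continuous_modS (translS z₀.1 φ)).comp (continuous_snd (X := V) (Y := V))
    refine Continuous.add (Continuous.mul (by fun_prop) (this.comp (h2.sub continuous_const)))
      ((tendsto_seminorm_continuous k n).comp (h3.sub continuous_const))
  refine squeeze_zero (fun z => apply_nonneg _ _) (fun z => ?_)
    (by simpa using h1.tendsto z₀)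
  -- Separate continuity upgrades to joint continuity because the bound for `modS z.2` grows only
  -- polynomially in `z.2`, hence is locally uniform.
  rw [show modS z.2 (translS z.1 φ) - modS z₀.2 (translS z₀.1 φ) =
    modS z.2 (translS z.1 φ - translS z₀.1 φ) +
      (modS z.2 (translS z₀.1 φ) - modS z₀.2 (translS z₀.1 φ)) by rw [map_sub]; abel]
  refine (map_add_le_add _ _ _).trans ?_
  gcongr
  exact seminorm_modS_le k n z.2 _

variable {Z : Type*} [TopologicalSpace Z] [MeasurableSpace Z] [OpensMeasurableSpace Z]
  [SecondCountableTopology Z] {μ : Measure Z} {a b : Z → V} {c : Z → ℂ}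

theorem integrable_seminorm_superposition (ha : Continuous a) (hb : Continuous b)
    (hc : Continuous c)
    (hi : ∀ k n : ℕ, Integrable (fun z => (1 + ‖a z‖) ^ k * (1 + ‖b z‖) ^ n * ‖c z‖) μ)
    (φ : 𝓢(V, ℂ)) (k n : ℕ) :
    Integrable (fun z => SchwartzMap.seminorm ℂ k n (c z • modS (b z) (translS (a z) φ))) μ := by
  have hcont : Continuous fun z => c z • modS (b z) (translS (a z) φ) :=
    hc.smul ((continuous_tfShift φ).comp (ha.prodMk hb))
  refine ((hi k n).const_mul ((2 * Real.pi) ^ n * (2 ^ k * supSeminorm k n φ))).mono'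
    ((tendsto_seminorm_continuous k n).comp hcont).aestronglyMeasurable (.of_forall fun z => ?_)
  rw [Real.norm_of_nonneg (apply_nonneg _ _), map_smul_eq_mul]
  have h := seminorm_tfShift_le k n (a z) (b z) φ
  have h2 : 1 + 2 * Real.pi * ‖b z‖ ≤ 2 * Real.pi * (1 + ‖b z‖) := by
    nlinarith [Real.pi_gt_three]
  have hpi := Real.pi_pos
  calc _ ≤ ‖c z‖ * ((2 * Real.pi * (1 + ‖b z‖)) ^ n *
        ((1 + ‖a z‖) ^ k * (2 ^ k * supSeminorm k n φ))) := by
        gcongr; refine h.trans ?_; gcongr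
    _ = _ := by rw [mul_pow]; ring

/-- Superpositions of time-frequency shifts of a Schwartz function, with rapidly decaying
coefficients, are Schwartz functions, and commute with tempered distributions. -/
theorem exists_superposition (ha : Continuous a) (hb : Continuous b) (hc : Continuous c)
    (hi : ∀ k n : ℕ, Integrable (fun z => (1 + ‖a z‖) ^ k * (1 + ‖b z‖) ^ n * ‖c z‖) μ)
    (φ : 𝓢(V, ℂ)) : ∃ f : 𝓢(V, ℂ),
      (∀ t, f t = ∫ z, c z * (charFn (b z) t * φ (t - a z)) ∂μ) ∧
      ∀ u : 𝓢'(V, ℂ), Integrable (fun z => c z * u (modS (b z) (translS (a z) φ))) μ ∧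
        u f = ∫ z, c z * u (modS (b z) (translS (a z) φ)) ∂μ := by
  have hcont : Continuous fun z => c z • modS (b z) (translS (a z) φ) :=
    hc.smul ((continuous_tfShift φ).comp (ha.prodMk hb))
  have hp := integrable_seminorm_superposition ha hb hc hi φ
  refine ⟨schwartzIntegral hcont hp, fun t => ?_, fun u => ⟨?_, ?_⟩⟩
  · rw [schwartzIntegral_apply]
    simp only [_root_.smul_apply, modS_translS_apply, smul_eq_mul]
  · simpa using integrable_apply_of_seminorm hcont hp u
  · rw [apply_schwartzIntegral hcont hp u]
    simp

end ShiftFourier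

/-! ### Tensor products and characters on the time-frequency plane. -/

section Tensor

variable {V : Type*} [NormedAddCommGroup V] [InnerProductSpace ℝ V]

variable (V) in
/-- The first projection of the time-frequency plane. -/
def fstPlane : Plane V →L[ℝ] V :=
  ContinuousLinearMap.fst ℝ V V ∘L (WithLp.prodContinuousLinearEquiv 2 ℝ V V : Plane V →L[ℝ] V × V)

variable (V) in
/-- The second projection of the time-frequency plane. -/
def sndPlane : Plane V →L[ℝ] V :=
  ContinuousLinearMap.snd ℝ V V ∘L (WithLp.prodContinuousLinearEquiv 2 ℝ V V : Plane V →L[ℝ] V × V)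

theorem norm_fstPlane_le : ‖fstPlane V‖ ≤ 1 :=
  ContinuousLinearMap.opNorm_le_bound _ zero_le_one fun w => by
    rw [one_mul]; exact WithLp.norm_fst_le V w

theorem norm_sndPlane_le : ‖sndPlane V‖ ≤ 1 :=
  ContinuousLinearMap.opNorm_le_bound _ zero_le_one fun w => by
    rw [one_mul]; exact WithLp.norm_snd_le V w

theorem norm_iteratedFDeriv_comp_clm_le (f : 𝓢(V, ℂ)) {L : Plane V →L[ℝ] V} (hL : ‖L‖ ≤ 1)
    (n : ℕ) (w : Plane V) :
    ‖iteratedFDeriv ℝ n (fun w => f (L w)) w‖ ≤ ‖iteratedFDeriv ℝ n f (L w)‖ := by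
  have := L.iteratedFDeriv_comp_right (f.smooth n) w (i := n) le_rfl
  rw [show (fun w => f (L w)) = f ∘ L from rfl, this]
  refine (ContinuousMultilinearMap.norm_compContinuousLinearMap_le _ _).trans ?_
  refine mul_le_of_le_one_right (norm_nonneg _) ?_
  exact Finset.prod_le_one (fun _ _ => norm_nonneg _) fun _ _ => hL

theorem norm_plane_le (w : Plane V) : ‖w‖ ≤ ‖w.fst‖ + ‖w.snd‖ := by
  have h : w = WithLp.toLp 2 (w.fst, 0) + WithLp.toLp 2 (0, w.snd) := by
    rw [← WithLp.toLp_add]; simp; rfl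
  calc ‖w‖ = ‖(WithLp.toLp 2 (w.fst, 0) + WithLp.toLp 2 (0, w.snd) : Plane V)‖ := by rw [← h]
    _ ≤ _ := (norm_add_le _ _).trans (by simp)

/-- The tensor product of two Schwartz functions. -/
def tensorS (f g : 𝓢(V, ℂ)) : 𝓢(Plane V, ℂ) where
  toFun w := f w.fst * g w.snd
  smooth' := ((f.smooth ⊤).comp (fstPlane V).contDiff).mul ((g.smooth ⊤).comp (sndPlane V).contDiff)
  decay' k n := by
    refine ⟨∑ i ∈ Finset.range (n + 1), (n.choose i : ℝ) *
      ((2 ^ k * supSeminorm k n f) * (2 ^ k * supSeminorm k n g)), fun w => ?_⟩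
    have h := norm_iteratedFDeriv_mul_le (𝕜 := ℝ) (n := n) (N := n)
      ((f.smooth n).comp (fstPlane V).contDiff) ((g.smooth n).comp (sndPlane V).contDiff) w le_rfl
    have hw : ‖w‖ ^ k ≤ (1 + ‖w.fst‖) ^ k * (1 + ‖w.snd‖) ^ k := by
      rw [← mul_pow]
      gcongr
      nlinarith [norm_plane_le w, norm_nonneg w.fst, norm_nonneg w.snd]
    have hf : ∀ i ≤ n, (1 + ‖w.fst‖) ^ k * ‖iteratedFDeriv ℝ i (⇑f ∘ fstPlane V) w‖ ≤
        2 ^ k * supSeminorm k n f := fun i hi => by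
      refine (mul_le_mul_of_nonneg_left (norm_iteratedFDeriv_comp_clm_le f norm_fstPlane_le i w)
        (by positivity)).trans ?_
      exact SchwartzMap.one_add_le_sup_seminorm_apply (𝕜 := ℂ) (m := (k, n)) le_rfl hi f w.fst
    have hg : ∀ i ≤ n, (1 + ‖w.snd‖) ^ k * ‖iteratedFDeriv ℝ i (⇑g ∘ sndPlane V) w‖ ≤
        2 ^ k * supSeminorm k n g := fun i hi => by
      refine (mul_le_mul_of_nonneg_left (norm_iteratedFDeriv_comp_clm_le g norm_sndPlane_le i w)
        (by positivity)).trans ?_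
      exact SchwartzMap.one_add_le_sup_seminorm_apply (𝕜 := ℂ) (m := (k, n)) le_rfl hi g w.snd
    calc _ ≤ ((1 + ‖w.fst‖) ^ k * (1 + ‖w.snd‖) ^ k) * ∑ i ∈ Finset.range (n + 1),
          (n.choose i : ℝ) * ‖iteratedFDeriv ℝ i (⇑f ∘ fstPlane V) w‖ *
            ‖iteratedFDeriv ℝ (n - i) (⇑g ∘ sndPlane V) w‖ := by
          gcongr; exact h
      _ = ∑ i ∈ Finset.range (n + 1), (n.choose i : ℝ) *
          (((1 + ‖w.fst‖) ^ k * ‖iteratedFDeriv ℝ i (⇑f ∘ fstPlane V) w‖) *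
            ((1 + ‖w.snd‖) ^ k * ‖iteratedFDeriv ℝ (n - i) (⇑g ∘ sndPlane V) w‖)) := by
          rw [Finset.mul_sum]; exact Finset.sum_congr rfl fun i _ => by ring
      _ ≤ _ := by
          refine Finset.sum_le_sum fun i hi => ?_
          have hi' : i ≤ n := Nat.lt_succ_iff.1 (Finset.mem_range.1 hi)
          exact mul_le_mul_of_nonneg_left (mul_le_mul (hf i hi') (hg (n - i) (Nat.sub_le _ _))
            (by positivity) (by positivity)) (by positivity)

variable (V) in
theorem chirp_hasTemperateGrowth :
    (fun w : Plane V => charFn w.snd w.fst).HasTemperateGrowth := by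
  have h1 : (fun s : ℝ => Complex.exp (2 * Real.pi * Complex.I * s)).HasTemperateGrowth := by
    refine ⟨contDiff_cexp_ofReal _, fun n => ⟨0, ‖(2 * Real.pi * Complex.I : ℂ)‖ ^ n, fun s => ?_⟩⟩
    rw [norm_iteratedFDeriv_eq_norm_iteratedDeriv, iteratedDeriv_cexp_ofReal]
    simp [Complex.norm_exp]
  exact h1.comp ((innerSL ℝ (E := V)).bilinear_hasTemperateGrowth
    (fstPlane V).hasTemperateGrowth (sndPlane V).hasTemperateGrowth)

theorem charFn_plane (x ω : V) (w : Plane V) :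
    charFn (WithLp.toLp 2 (x, ω) : Plane V) w = charFn x w.fst * charFn ω w.snd := by
  simp only [charFn, WithLp.prod_inner_apply, ← Complex.exp_add]
  congr 1; push_cast; exact mul_add _ _ _

end Tensor

/-! ### STFTs of functions, Parseval and Moyal. -/

section STFT

variable {V : Type*} [NormedAddCommGroup V] [InnerProductSpace ℝ V] [FiniteDimensional ℝ V]
  [MeasurableSpace V] [BorelSpace V]

theorem integrable_conj {X : Type*} [MeasurableSpace X] {μ : Measure X} {f : X → ℂ}
    (hf : Integrable f μ) : Integrable (fun x => conj (f x)) μ :=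
  (Complex.conjCLE : ℂ →L[ℝ] ℂ).integrable_comp hf

theorem stft_eq (g f : V → ℂ) (x ω : V) :
    stft g f x ω = ∫ y, conj (charFn ω y) * (f y * conj (g (y - x))) :=
  fourier_eq_charFn _ _

theorem integral_plane {E : Type*} [NormedAddCommGroup E] [NormedSpace ℝ E] (F : Plane V → E) :
    ∫ w : Plane V, F w = ∫ z : V × V, F (WithLp.toLp 2 z) :=
  ((WithLp.volume_preserving_toLp V V).integral_comp
    (MeasurableEquiv.toLp 2 (V × V)).measurableEmbedding F).symm

theorem integrable_plane {E : Type*} [NormedAddCommGroup E] {F : Plane V → E} :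
    Integrable F ↔ Integrable (fun z : V × V => F (WithLp.toLp 2 z)) :=
  ((WithLp.volume_preserving_toLp V V).integrable_comp_emb
    (MeasurableEquiv.toLp 2 (V × V)).measurableEmbedding).symm

theorem fourier_fourier_apply (g : 𝓢(V, ℂ)) (s : V) :
    (𝓕 (𝓕 g) : 𝓢(V, ℂ)) s = g (-s) := by
  have h : (𝓕⁻ (𝓕 g) : 𝓢(V, ℂ)) (-s) = g (-s) := by rw [FourierTransform.fourierInv_fourier_eq]
  rw [← h, SchwartzMap.fourierInv_coe, SchwartzMap.fourier_coe, Real.fourierInv_eq_fourier_neg,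
    neg_neg]

/-- The short-time Fourier transform of Schwartz functions as a Schwartz function on the
time-frequency plane. -/
def stftS (g f : 𝓢(V, ℂ)) : 𝓢(Plane V, ℂ) :=
  𝓕⁻ (SchwartzMap.smulLeftCLM ℂ (fun w : Plane V => charFn w.snd w.fst)
    (tensorS (conjS (𝓕 g)) (reflS f)))

/-- Writing `g (b - x)` as a Fourier integral of `𝓕 g` turns the STFT into an inverse Fourier
integral over the plane, in the variables dual to `(x, ω)`. The chirp records the coupling between
the frequency variable of `g` and the time variable of `f`. This exhibits the STFT as a Schwartz
function without estimating its derivatives. -/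
theorem stftS_apply (g f : 𝓢(V, ℂ)) (x ω : V) :
    stftS g f (WithLp.toLp 2 (x, ω)) = stft g f x ω := by
  set Ψ := SchwartzMap.smulLeftCLM ℂ (fun w : Plane V => charFn w.snd w.fst)
    (tensorS (conjS (𝓕 g)) (reflS f)) with hΨ
  have hΨa : ∀ w, Ψ w = charFn w.snd w.fst * (conj ((𝓕 g : 𝓢(V, ℂ)) w.fst) * f (-w.snd)) :=
    fun w => by
    rw [hΨ, SchwartzMap.smulLeftCLM_apply_apply (chirp_hasTemperateGrowth V)]; rfl
  have hint : Integrable (fun z : V × V => charFn (WithLp.toLp 2 (x, ω) : Plane V)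
      (WithLp.toLp 2 z) * Ψ (WithLp.toLp 2 z)) := by
    refine (integrable_plane.1 Ψ.integrable).bdd_mul (c := 1)
      (continuous_charFn (by fun_prop) (by fun_prop)).aestronglyMeasurable
      (.of_forall fun z => (norm_charFn _ _).le)
  change (𝓕⁻ Ψ : 𝓢(Plane V, ℂ)) _ = _
  rw [SchwartzMap.fourierInv_coe, fourierInv_eq_charFn, integral_plane, Measure.volume_eq_prod,
    integral_prod_symm _ hint, stft_eq, ← integral_neg_eq_self]
  congr 1; funext b
  simp only [hΨa, charFn_plane]
  have h2 : ∫ a, conj (charFn (x + -b) a) * (𝓕 g : 𝓢(V, ℂ)) a = g (b - x) := by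
    rw [← fourier_eq_charFn, ← SchwartzMap.fourier_coe, fourier_fourier_apply]
    congr 1; abel
  rw [← h2, ← integral_conj, ← integral_const_mul, ← integral_const_mul]
  congr 1; funext a
  change charFn x a * charFn ω (-b) * (charFn (-b) a * (conj ((𝓕 g : 𝓢(V, ℂ)) a) * f (- -b))) = _
  rw [charFn_neg_left, charFn_add_right, neg_neg]
  simp only [map_mul, Complex.conj_conj]
  ring

theorem integrable_weight_plane (Φ : 𝓢(Plane V, ℂ)) (k n : ℕ) :
    Integrable (fun z : V × V => (1 + ‖z.1‖) ^ k * (1 + ‖z.2‖) ^ n * ‖Φ (WithLp.toLp 2 z)‖) := by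
  have h1 : Integrable (fun w : Plane V => 2 ^ (k + n - 1) * (‖w‖ ^ 0 * ‖Φ w‖
      + ‖w‖ ^ (k + n) * ‖Φ w‖)) :=
    ((Φ.integrable_pow_mul volume 0).add (Φ.integrable_pow_mul volume (k + n))).const_mul _
  refine (integrable_plane.1 h1).mono' ?_ (.of_forall fun z => ?_)
  · have : Continuous fun z : V × V => Φ (WithLp.toLp 2 z) := Φ.continuous.comp (by fun_prop)
    exact Continuous.aestronglyMeasurable (by fun_prop)
  · rw [Real.norm_of_nonneg (by positivity)]
    have hx : ‖z.1‖ ≤ ‖(WithLp.toLp 2 z : Plane V)‖ := WithLp.norm_fst_le V (WithLp.toLp 2 z)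
    have hy : ‖z.2‖ ≤ ‖(WithLp.toLp 2 z : Plane V)‖ := WithLp.norm_snd_le V (WithLp.toLp 2 z)
    have := add_pow_le zero_le_one (norm_nonneg (WithLp.toLp 2 z : Plane V)) (k + n)
    calc _ ≤ (1 + ‖(WithLp.toLp 2 z : Plane V)‖) ^ k * (1 + ‖(WithLp.toLp 2 z : Plane V)‖) ^ n
          * ‖Φ (WithLp.toLp 2 z)‖ := by gcongr
      _ ≤ (2 ^ (k + n - 1) * (1 ^ (k + n) + ‖(WithLp.toLp 2 z : Plane V)‖ ^ (k + n))) *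
          ‖Φ (WithLp.toLp 2 z)‖ := by rw [← pow_add]; gcongr
      _ = _ := by rw [one_pow]; ring

theorem continuous_stft {g f : V → ℂ} (hf : Integrable f) (hg : Continuous g) {C : ℝ}
    (hgC : ∀ t, ‖g t‖ ≤ C) : Continuous (fun z : V × V => stft g f z.1 z.2) := by
  simp only [stft_eq]
  refine continuous_of_dominated (bound := fun y => ‖f y‖ * C) (fun z => ?_)
    (fun z => .of_forall fun y => ?_) (hf.norm.mul_const C) (.of_forall fun y => ?_)
  · exact (Complex.continuous_conj.comp (continuous_charFn continuous_const continuous_id)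
      ).aestronglyMeasurable.mul (hf.aestronglyMeasurable.mul
      (Complex.continuous_conj.comp (hg.comp (by fun_prop))).aestronglyMeasurable)
  · rw [norm_mul, norm_mul, RCLike.norm_conj, RCLike.norm_conj, norm_charFn, one_mul]
    gcongr
    exact hgC _
  · exact (Complex.continuous_conj.comp (continuous_charFn continuous_snd continuous_const)).mul
      (continuous_const.mul (Complex.continuous_conj.comp (hg.comp (by fun_prop))))

theorem norm_stft_le {g f : V → ℂ} (hf : Integrable f) {C : ℝ}
    (hgC : ∀ t, ‖g t‖ ≤ C) (x ω : V) : ‖stft g f x ω‖ ≤ (∫ y, ‖f y‖) * C := by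
  rw [stft_eq, ← integral_mul_const]
  refine norm_integral_le_of_norm_le (hf.norm.mul_const C) (.of_forall fun y => ?_)
  rw [norm_mul, norm_mul, RCLike.norm_conj, RCLike.norm_conj, norm_charFn, one_mul]
  gcongr
  exact hgC _

theorem norm_stft_le' {g f : V → ℂ} (hg : Integrable g) {C : ℝ}
    (hfC : ∀ t, ‖f t‖ ≤ C) (x ω : V) : ‖stft g f x ω‖ ≤ C * ∫ y, ‖g y‖ := by
  rw [stft_eq, ← integral_sub_right_eq_self (fun y => ‖g y‖) x, ← integral_const_mul]
  refine norm_integral_le_of_norm_le ((hg.comp_sub_right x).norm.const_mul C)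
    (.of_forall fun y => ?_)
  rw [norm_mul, norm_mul, RCLike.norm_conj, RCLike.norm_conj, norm_charFn, one_mul]
  gcongr
  exact hfC _

theorem aestronglyMeasurable_stft {g f : V → ℂ} (hf : AEStronglyMeasurable f)
    (hg : Continuous g) :
    AEStronglyMeasurable (fun z : V × V => stft g f z.1 z.2) := by
  simp only [stft_eq]
  refine AEStronglyMeasurable.integral_prod_right'
    (f := fun p : (V × V) × V => conj (charFn p.1.2 p.2) * (f p.2 * conj (g (p.2 - p.1.1)))) ?_
  exact (Complex.continuous_conj.comp (continuous_charFn (by fun_prop) (by fun_prop))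
    ).aestronglyMeasurable.mul (hf.comp_snd.mul
    (Complex.continuous_conj.comp (hg.comp (by fun_prop))).aestronglyMeasurable)

/-- Parseval's identity, for an integrable function and a continuous integrable function with
integrable Fourier transform. -/
theorem integral_fourier_mul_conj_fourier {a b : V → ℂ} (ha : Integrable a) (hb : Integrable b)
    (hbc : Continuous b) (hFb : Integrable (𝓕 b)) :
    ∫ ω, 𝓕 a ω * conj (𝓕 b ω) = ∫ y, a y * conj (b y) := by
  have hc : Integrable (fun ω => conj (𝓕 b ω)) := integrable_conj hFb
  have h := VectorFourier.integral_fourierIntegral_smul_eq_flip (μ := volume) (ν := volume)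
    (L := innerₗ V) Real.continuous_fourierChar continuous_inner ha hc
  refine h.trans ?_
  congr 1; funext y
  rw [smul_eq_mul, flip_innerₗ]
  congr 1
  change 𝓕 (fun ω => conj (𝓕 b ω)) y = _
  rw [fourier_eq_charFn, ← congrFun (hbc.fourierInv_fourier_eq hb hFb) y, fourierInv_eq_charFn,
    ← integral_conj]
  simp

theorem integrable_mul_conj_comp_sub {g f : V → ℂ} (hf : AEStronglyMeasurable f) {C : ℝ}
    (hfC : ∀ t, ‖f t‖ ≤ C) (hg : Integrable g) (x : V) :
    Integrable (fun y => f y * conj (g (y - x))) :=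
  Integrable.bdd_mul (integrable_conj (hg.comp_sub_right x))
    hf (.of_forall hfC)

theorem integrable_mul_conj_comp_sub' {g f : V → ℂ} (hf : Integrable f) {C : ℝ}
    (hgC : ∀ t, ‖g t‖ ≤ C) (hg : Continuous g) (x : V) :
    Integrable (fun y => f y * conj (g (y - x))) :=
  hf.mul_bdd (c := C) (Complex.continuous_conj.comp (hg.comp (by fun_prop))).aestronglyMeasurable
    (.of_forall fun y => by rw [RCLike.norm_conj]; exact hgC _)

theorem integrable_mul_comp_sub {a b : V → ℂ} (ha : Integrable a) (hb : Integrable b) :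
    Integrable (fun z : V × V => a z.2 * b (z.2 - z.1)) := by
  have mp : MeasurePreserving (fun z : V × V => (z.2, z.2 - z.1)) (volume.prod volume)
      (volume.prod volume) := by
    convert ((MeasurePreserving.id (volume : Measure V)).prod
      (Measure.measurePreserving_neg (volume : Measure V))).comp
      (measurePreserving_prod_sub_swap (volume : Measure V) (volume : Measure V)) using 2 with z
    simp
  exact mp.integrable_comp_of_integrable (ha.mul_prod hb)

/-- Moyal's formula. -/
theorem moyal {f g h k : V → ℂ} (hf : AEStronglyMeasurable f) {C : ℝ} (hfC : ∀ t, ‖f t‖ ≤ C)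
    (hg : Integrable g) (hgc : Continuous g) (hk : Integrable k) (hkc : Continuous k)
    (hhc : Continuous h) {D : ℝ} (hhD : ∀ t, ‖h t‖ ≤ D)
    (hV : Integrable (fun z : V × V => stft h k z.1 z.2)) :
    Integrable (fun z : V × V => stft g f z.1 z.2 * conj (stft h k z.1 z.2)) ∧
    ∫ z : V × V, stft g f z.1 z.2 * conj (stft h k z.1 z.2) =
      (∫ t, f t * conj (k t)) * conj (∫ t, g t * conj (h t)) := by
  have hi : Integrable (fun z : V × V => stft g f z.1 z.2 * conj (stft h k z.1 z.2)) :=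
    Integrable.bdd_mul (integrable_conj hV)
      (aestronglyMeasurable_stft hf hgc) (.of_forall fun z => norm_stft_le' hg hfC z.1 z.2)
  refine ⟨hi, ?_⟩
  have hfk : Integrable (fun t => f t * conj (k t)) :=
    Integrable.bdd_mul (integrable_conj hk) hf
      (.of_forall hfC)
  have hgh : Integrable (fun t => conj (g t) * h t) :=
    (integrable_conj hg).mul_bdd (c := D)
      hhc.aestronglyMeasurable (.of_forall hhD)
  rw [Measure.volume_eq_prod, integral_prod _ hi]
  -- For almost every `x`, Parseval in `ω` applies to the slices. Integrability of the slice of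
  -- `stft h k` is all the Fourier-side information needed. Fubini then separates the `x` integral,
  -- which no longer depends on `y` after translation.
  have e : ∀ᵐ x : V, ∫ ω, stft g f x ω * conj (stft h k x ω) =
      ∫ y, (f y * conj (k y)) * (conj (g (y - x)) * h (y - x)) := by
    filter_upwards [hV.prod_right_ae] with x hx
    refine (integral_fourier_mul_conj_fourier (integrable_mul_conj_comp_sub hf hfC hg x)
      (integrable_mul_conj_comp_sub' hk hhD hhc x)
      (hkc.mul (Complex.continuous_conj.comp (hhc.comp (by fun_prop)))) hx).trans ?_
    congr 1; funext y
    simp only [map_mul, Complex.conj_conj]; ring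
  rw [integral_congr_ae e, integral_integral_swap (integrable_mul_comp_sub hfk hgh),
    ← integral_conj, ← integral_mul_const]
  congr 1; funext y
  rw [integral_const_mul, integral_sub_left_eq_self (fun t => conj (g t) * h t)]
  congr 2; funext t
  simp

end STFT

theorem integrable_prod_mul_comp_sub {G : Type*} [MeasurableSpace G] [AddGroup G]
    [MeasurableAdd₂ G] [MeasurableNeg G] {μ ν : Measure G} [SFinite μ] [SFinite ν]
    [μ.IsAddRightInvariant] {L : Type*} [NormedRing L] {a b : G → L} (ha : Integrable a ν)
    (hb : Integrable b μ) : Integrable (fun z : G × G => a z.1 * b (z.2 - z.1)) (ν.prod μ) :=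
  (measurePreserving_prod_sub ν μ).integrable_comp_of_integrable (ha.mul_prod hb)

theorem integrable_mul_fst_comp_sub {G : Type*} [MeasurableSpace G] [AddGroup G]
    [MeasurableAdd₂ G] [MeasurableNeg G] {ν : Measure G} [SFinite ν]
    [ν.IsAddRightInvariant] {μ : Measure (G × G)} [SFinite μ] {L : Type*} [NormedRing L]
    {a : G × G → L} {b : G → L} (ha : Integrable a μ) (hb : Integrable b ν) :
    Integrable (fun p : (G × G) × G => a p.1 * b (p.2 - p.1.1)) (μ.prod ν) := by
  have mp : MeasurePreserving (fun p : (G × G) × G => (p.1, p.2 - p.1.1)) (μ.prod ν)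
      (μ.prod ν) := by
    refine MeasurePreserving.skew_product (g := fun (z : G × G) t => t - z.1)
      (MeasurePreserving.id _) (by fun_prop) (.of_forall fun z => ?_)
    exact (measurePreserving_sub_right ν z.1).map_eq
  exact mp.integrable_comp_of_integrable (ha.mul_prod hb)

instance {V : Type*} [NormedAddCommGroup V] [InnerProductSpace ℝ V] [FiniteDimensional ℝ V]
    [MeasurableSpace V] [BorelSpace V] : (volume : Measure (V × V)).IsAddHaarMeasure :=
  inferInstanceAs ((volume : Measure V).prod (volume : Measure V)).IsAddHaarMeasure

/-! ### The Gaussian window: normalization, Fourier invariance, square root. -/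

section Gaussian

variable {V : Type*} [NormedAddCommGroup V] [InnerProductSpace ℝ V] [FiniteDimensional ℝ V]
  [MeasurableSpace V] [BorelSpace V]

theorem gaussWin_eq_ofReal (t : V) : gaussWin V t =
    (((2 : ℝ) ^ ((Module.finrank ℝ V : ℝ) / 4) * Real.exp (-Real.pi * ‖t‖ ^ 2) : ℝ) : ℂ) := by
  rw [gaussWin_apply]; push_cast; rfl

theorem conj_gaussWin (t : V) : conj (gaussWin V t) = gaussWin V t := by
  rw [gaussWin_eq_ofReal, Complex.conj_ofReal]

theorem gaussWin_neg (t : V) : gaussWin V (-t) = gaussWin V t := by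
  rw [gaussWin_eq_ofReal, gaussWin_eq_ofReal, norm_neg]

theorem integral_gaussWin_mul_self : ∫ t, gaussWin V t * conj (gaussWin V t) = 1 := by
  have h : ∀ t : V, gaussWin V t * conj (gaussWin V t) =
      (((2 : ℝ) ^ ((Module.finrank ℝ V : ℝ) / 2) * Real.exp (-(2 * Real.pi) * ‖t‖ ^ 2) : ℝ) : ℂ) := by
    intro t
    rw [conj_gaussWin, gaussWin_eq_ofReal, ← Complex.ofReal_mul]
    congr 1
    rw [mul_mul_mul_comm, ← Real.exp_add, ← Real.rpow_add two_pos]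
    congr 2 <;> ring
  simp only [h]
  rw [integral_complex_ofReal, integral_const_mul,
    GaussianFourier.integral_rexp_neg_mul_sq_norm (by positivity)]
  rw [show Real.pi / (2 * Real.pi) = 2⁻¹ by field_simp, Real.inv_rpow two_pos.le,
    mul_inv_cancel₀ (by positivity)]
  rfl

theorem fourier_gaussWin : 𝓕 (gaussWin V) = gaussWin V := by
  ext w
  rw [SchwartzMap.fourier_coe]
  have h : ⇑(gaussWin V) = fun t : V => (((2 : ℝ) ^ ((Module.finrank ℝ V : ℝ) / 4) : ℝ) : ℂ) *
      Complex.exp (-(Real.pi : ℂ) * ‖t‖ ^ 2) := by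
    funext t; rw [gaussWin_apply]; push_cast; rfl
  have h2 := fourier_gaussian_innerProductSpace (V := V) (b := (Real.pi : ℂ))
    (by simpa using Real.pi_pos) w
  have h3 : ∀ c : ℂ, ∀ f : V → ℂ, 𝓕 (fun t => c * f t) w = c * 𝓕 f w := by
    intro c f
    rw [fourier_eq_charFn, fourier_eq_charFn, ← integral_const_mul]
    congr 1; funext t; ring
  have hpi : (Real.pi : ℂ) ≠ 0 := by exact_mod_cast Real.pi_ne_zero
  rw [h, h3, h2]
  simp only []
  rw [div_self hpi, Complex.one_cpow, one_mul]
  congr 2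
  field_simp

/-- The Gaussian of half the exponent. -/
def gaussHalf (V : Type*) [NormedAddCommGroup V] [InnerProductSpace ℝ V] : 𝓢(V, ℂ) :=
  SchwartzMap.compCLMOfContinuousLinearEquiv ℂ
    (ContinuousLinearEquiv.smulLeft (Units.mk0 (Real.sqrt 2)⁻¹ (by positivity))) (gauss0 V)

/-- The factorization of the Gaussian into two Schwartz functions is what makes products of Schwartz
functions separate distributions, see `eq_zero_of_mul_eq_zero`. -/
theorem gaussHalf_mul_self (t : V) : gaussHalf V t * gaussHalf V t = gauss0 V t := by
  change Complex.exp (-(Real.pi : ℂ) * ((‖(Real.sqrt 2)⁻¹ • t‖ ^ 2 : ℝ) : ℂ)) *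
    Complex.exp (-(Real.pi : ℂ) * ((‖(Real.sqrt 2)⁻¹ • t‖ ^ 2 : ℝ) : ℂ)) =
    Complex.exp (-(Real.pi : ℂ) * ((‖t‖ ^ 2 : ℝ) : ℂ))
  rw [← Complex.exp_add]
  congr 1
  rw [norm_smul, norm_inv, Real.norm_of_nonneg (Real.sqrt_nonneg 2), mul_pow, inv_pow,
    Real.sq_sqrt zero_le_two]
  push_cast; ring

end Gaussian

/-! ### The space M¹: inversion, density of Schwartz functions, the duality pairing. -/

section M1

variable {V : Type*} [NormedAddCommGroup V] [InnerProductSpace ℝ V] [FiniteDimensional ℝ V]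
  [MeasurableSpace V] [BorelSpace V]

/-- The norm of the modulation space `M¹`. -/
def m1Norm (f : V → ℂ) : ℝ := ∫ z : V × V, ‖stft (gaussWin V) f z.1 z.2‖

theorem m1Norm_nonneg (f : V → ℂ) : 0 ≤ m1Norm f := integral_nonneg fun _ => norm_nonneg _

variable (V) in
/-- A bound for the Gaussian window. -/
def gaussSup : ℝ := SchwartzMap.seminorm ℂ 0 0 (gaussWin V)

variable (V) in
theorem gaussSup_nonneg : 0 ≤ gaussSup V := apply_nonneg _ _

theorem norm_gaussWin_le (t : V) : ‖gaussWin V t‖ ≤ gaussSup V :=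
  SchwartzMap.norm_le_seminorm ℂ _ t

theorem integrable_stft_schwartz (g f : 𝓢(V, ℂ)) :
    Integrable (fun z : V × V => stft g f z.1 z.2) := by
  have := integrable_plane.1 (stftS g f).integrable
  exact this.congr (.of_forall fun z => stftS_apply g f z.1 z.2)

theorem memM1_schwartz (φ : 𝓢(V, ℂ)) : MemM1 (φ : V → ℂ) :=
  ⟨φ.continuous, φ.integrable, integrable_stft_schwartz _ _⟩

theorem MemM1.continuous_stft {f : V → ℂ} (hf : MemM1 f) :
    Continuous (fun z : V × V => stft (gaussWin V) f z.1 z.2) :=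
  TimeFreq.continuous_stft hf.2.1 (gaussWin V).continuous norm_gaussWin_le

theorem norm_stft_integrand (c : ℂ) (ω t x : V) :
    ‖c * (charFn ω t * gaussWin V (t - x))‖ = ‖c‖ * ‖gaussWin V (t - x)‖ := by
  rw [norm_mul, norm_mul, norm_charFn, one_mul]

/-- Inversion formula for the short-time Fourier transform on `M¹`. -/
theorem MemM1.inversion {f : V → ℂ} (hf : MemM1 f) (t : V) :
    f t = ∫ z : V × V, stft (gaussWin V) f z.1 z.2 * (charFn z.2 t * gaussWin V (t - z.1)) := by
  have hi : Integrable (fun z : V × V =>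
      stft (gaussWin V) f z.1 z.2 * (charFn z.2 t * gaussWin V (t - z.1))) := by
    refine hf.2.2.mul_bdd (c := gaussSup V) (Continuous.aestronglyMeasurable
      ((continuous_charFn continuous_snd continuous_const).mul
        ((gaussWin V).continuous.comp (by fun_prop)))) (.of_forall fun z => ?_)
    rw [norm_mul, norm_charFn, one_mul]; exact norm_gaussWin_le _
  rw [Measure.volume_eq_prod, integral_prod _ hi]
  -- Fourier inversion of the slice at `x` recovers `f t` times the conjugated window. The remaining
  -- `x` integral is the squared L² norm of the Gaussian, which is 1.
  have e : ∀ᵐ x : V, ∫ ω, stft (gaussWin V) f x ω * (charFn ω t * gaussWin V (t - x)) =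
      f t * (gaussWin V (t - x) * conj (gaussWin V (t - x))) := by
    filter_upwards [hf.2.2.prod_right_ae] with x hx
    have hc : Continuous fun y => f y * conj (gaussWin V (y - x)) :=
      hf.1.mul (Complex.continuous_conj.comp ((gaussWin V).continuous.comp (by fun_prop)))
    have := congrFun (hc.fourierInv_fourier_eq
      (integrable_mul_conj_comp_sub' hf.2.1 norm_gaussWin_le (gaussWin V).continuous x) hx) t
    rw [mul_left_comm, ← this, fourierInv_eq_charFn, ← integral_const_mul]
    congr 1; funext ω
    rw [stft, charFn_comm t ω]; ring
  rw [integral_congr_ae e, integral_const_mul,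
    integral_sub_left_eq_self (fun s => gaussWin V s * conj (gaussWin V s)),
    integral_gaussWin_mul_self, mul_one]

/-- By inversion, `f` is a superposition of time-frequency shifts of the Gaussian with total mass
`m1Norm f`, so a shift-invariant norm of `f` is at most `m1Norm f` times that of the Gaussian. Here
the norm is the supremum; in `MemM1.integral_norm_le` it is the L¹ norm. -/
theorem MemM1.norm_le {f : V → ℂ} (hf : MemM1 f) (t : V) : ‖f t‖ ≤ m1Norm f * gaussSup V := by
  rw [hf.inversion t, m1Norm, ← integral_mul_const]
  refine norm_integral_le_of_norm_le (hf.2.2.norm.mul_const _) (.of_forall fun z => ?_)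
  rw [norm_stft_integrand]
  gcongr
  exact norm_gaussWin_le _

variable (V) in
/-- The `L¹` norm of the Gaussian window. -/
def gaussInt : ℝ := ∫ t, ‖gaussWin V t‖

variable (V) in
theorem gaussInt_nonneg : 0 ≤ gaussInt V := integral_nonneg fun _ => norm_nonneg _

theorem MemM1.integral_norm_le {f : V → ℂ} (hf : MemM1 f) :
    ∫ t, ‖f t‖ ≤ m1Norm f * gaussInt V := by
  have hi : Integrable (fun p : (V × V) × V => ‖stft (gaussWin V) f p.1.1 p.1.2‖ *
      ‖gaussWin V (p.2 - p.1.1)‖) :=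
    integrable_mul_fst_comp_sub hf.2.2.norm (gaussWin V).integrable.norm
  calc ∫ t, ‖f t‖ ≤ ∫ t, ∫ z : V × V, ‖stft (gaussWin V) f z.1 z.2‖ * ‖gaussWin V (t - z.1)‖ := by
        refine integral_mono_of_nonneg (.of_forall fun _ => norm_nonneg _) hi.integral_prod_right
          (.of_forall fun t => ?_)
        simp only []
        rw [hf.inversion t]
        refine (norm_integral_le_integral_norm _).trans_eq ?_
        simp only [norm_stft_integrand]
    _ = ∫ z : V × V, ∫ t, ‖stft (gaussWin V) f z.1 z.2‖ * ‖gaussWin V (t - z.1)‖ :=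
        (integral_integral_swap hi).symm
    _ = _ := by
        rw [m1Norm, gaussInt, ← integral_mul_const]
        congr 1; funext z
        rw [integral_const_mul, integral_sub_right_eq_self (fun t => ‖gaussWin V t‖)]

theorem stft_shift (g f : V → ℂ) (x₀ ω₀ x ω : V) :
    stft g (fun y => charFn ω₀ y * f (y - x₀)) x ω =
      conj (charFn (ω - ω₀) x₀) * stft g f (x - x₀) (ω - ω₀) := by
  rw [stft_eq, stft_eq, ← integral_const_mul, ← integral_add_right_eq_self _ x₀]
  congr 1; funext y
  rw [sub_eq_add_neg ω, charFn_add_right, charFn_add_right, charFn_neg_right, charFn_neg_right,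
    charFn_add_left, charFn_add_left, add_sub_cancel_right, sub_sub_eq_add_sub]
  simp only [map_mul, Complex.conj_conj]
  have := charFn_mul_conj ω₀ y
  ring

theorem norm_stft_shift (g f : V → ℂ) (x₀ ω₀ x ω : V) :
    ‖stft g (fun y => charFn ω₀ y * f (y - x₀)) x ω‖ = ‖stft g f (x - x₀) (ω - ω₀)‖ := by
  rw [stft_shift, norm_mul, RCLike.norm_conj, norm_charFn, one_mul]

/-- Superpositions of time-frequency shifts of the Gaussian are in `M¹`. -/
theorem m1Norm_superposition_le {μ : Measure (V × V)} [SFinite μ] {c : V × V → ℂ}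
    (hc : Integrable c μ) : m1Norm (fun t => ∫ z, c z * (charFn z.2 t * gaussWin V (t - z.1)) ∂μ) ≤
      (∫ z, ‖c z‖ ∂μ) * m1Norm (gaussWin V) := by
  have hγ := integrable_stft_schwartz (gaussWin V) (gaussWin V)
  have hi : Integrable (fun p : (V × V) × (V × V) => ‖c p.1‖ *
      ‖stft (gaussWin V) (gaussWin V) (p.2 - p.1).1 (p.2 - p.1).2‖) (μ.prod volume) :=
    integrable_prod_mul_comp_sub hc.norm hγ.norm
  have hF : ∀ x ω, stft (gaussWin V) (fun t => ∫ z, c z *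
      (charFn z.2 t * gaussWin V (t - z.1)) ∂μ) x ω = ∫ z, c z *
        stft (gaussWin V) (fun t => charFn z.2 t * gaussWin V (t - z.1)) x ω ∂μ := by
    intro x ω
    simp only [stft_eq]
    have h2 : Integrable (Function.uncurry fun (z : V × V) (y : V) => conj (charFn ω y) * ((c z *
        (charFn z.2 y * gaussWin V (y - z.1))) * conj (gaussWin V (y - x))))
        (μ.prod (volume : Measure V)) := by
      have h3 := integrable_mul_fst_comp_sub hc ((gaussWin V).integrable (μ := volume))
      have h4 := h3.bdd_mul (f := fun p : (V × V) × V => charFn p.1.2 p.2 * (conj (charFn ω p.2) *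
        conj (gaussWin V (p.2 - x)))) (c := gaussSup V) (Continuous.aestronglyMeasurable ?_)
        (.of_forall fun p => ?_)
      · refine h4.congr (.of_forall fun p => ?_)
        simp only [Function.uncurry]; ring
      · exact (continuous_charFn (by fun_prop) (by fun_prop)).mul
          ((Complex.continuous_conj.comp (continuous_charFn (by fun_prop) (by fun_prop))).mul
          (Complex.continuous_conj.comp ((gaussWin V).continuous.comp (by fun_prop))))
      · rw [norm_mul, norm_mul, RCLike.norm_conj, RCLike.norm_conj, norm_charFn, norm_charFn,
          one_mul, one_mul]
        exact norm_gaussWin_le _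
    calc _ = ∫ y, ∫ z, conj (charFn ω y) * ((c z *
        (charFn z.2 y * gaussWin V (y - z.1))) * conj (gaussWin V (y - x))) ∂μ := by
          congr 1; funext y
          rw [integral_const_mul, integral_mul_const]
      _ = _ := by
          rw [← integral_integral_swap h2]
          congr 1; funext z
          rw [← integral_const_mul]
          congr 1; funext y; ring
  calc _ ≤ ∫ w : V × V, ∫ z, ‖c z‖ *
        ‖stft (gaussWin V) (gaussWin V) (w - z).1 (w - z).2‖ ∂μ := by
        refine integral_mono_of_nonneg (.of_forall fun _ => norm_nonneg _) hi.integral_prod_right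
          (.of_forall fun w => ?_)
        simp only []
        rw [hF]
        refine (norm_integral_le_integral_norm _).trans_eq ?_
        congr 1; funext z
        rw [norm_mul, norm_stft_shift]; rfl
    _ = ∫ z, (∫ w : V × V, ‖c z‖ *
        ‖stft (gaussWin V) (gaussWin V) (w - z).1 (w - z).2‖) ∂μ :=
        (integral_integral_swap hi).symm
    _ = _ := by
        rw [m1Norm, ← integral_mul_const]
        congr 1; funext z
        rw [integral_const_mul, integral_sub_right_eq_self
          (fun w : V × V => ‖stft (gaussWin V) (gaussWin V) w.1 w.2‖)]

/-- Schwartz functions are dense in `M¹`. -/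
theorem MemM1.exists_schwartz_approx {f : V → ℂ} (hf : MemM1 f) {ε : ℝ} (hε : 0 < ε) :
    ∃ φ : 𝓢(V, ℂ), m1Norm (fun t => f t - φ t) < ε := by
  have hlim : Filter.Tendsto (fun n : ℕ => ∫ z in (Metric.closedBall (0 : V × V) n)ᶜ,
      ‖stft (gaussWin V) f z.1 z.2‖) Filter.atTop (nhds 0) := by
    have h := tendsto_setIntegral_of_antitone (μ := volume)
      (s := fun n : ℕ => (Metric.closedBall (0 : V × V) n)ᶜ)
      (f := fun z : V × V => ‖stft (gaussWin V) f z.1 z.2‖)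
      (fun n => Metric.isClosed_closedBall.measurableSet.compl)
      (fun m n h => Set.compl_subset_compl.2 (Metric.closedBall_subset_closedBall
        (by exact_mod_cast h)))
      ⟨0, hf.2.2.norm.integrableOn⟩
    have e : ⋂ n : ℕ, (Metric.closedBall (0 : V × V) n)ᶜ = ∅ := by
      rw [← Set.compl_iUnion, Metric.iUnion_closedBall_nat, Set.compl_univ]
    simpa [e] using h
  have hlim2 := hlim.mul_const (m1Norm (gaussWin V))
  rw [zero_mul] at hlim2
  obtain ⟨n, hn⟩ := (hlim2.eventually_lt_const hε).exists
  set B := Metric.closedBall (0 : V × V) n with hB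
  -- The approximant is the inversion integral restricted to a large ball. On a compact set the
  -- continuous coefficients satisfy all decay conditions, so the result is Schwartz; the error is a
  -- superposition over the complement.
  obtain ⟨φ, hφ, -⟩ := exists_superposition (μ := volume.restrict B) (Z := V × V)
    continuous_fst continuous_snd hf.continuous_stft (fun k n => by
      have hc := hf.continuous_stft
      refine ContinuousOn.integrableOn_compact (isCompact_closedBall _ _) ?_
      fun_prop) (gaussWin V)
  refine ⟨φ, lt_of_le_of_lt ?_ hn⟩
  have e : (fun t => f t - φ t) = fun t => ∫ z in Bᶜ, stft (gaussWin V) f z.1 z.2 *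
      (charFn z.2 t * gaussWin V (t - z.1)) := by
    funext t
    rw [hφ t, hf.inversion t, sub_eq_iff_eq_add', integral_add_compl
      Metric.isClosed_closedBall.measurableSet]
    refine hf.2.2.mul_bdd (c := gaussSup V) (Continuous.aestronglyMeasurable
      ((continuous_charFn continuous_snd continuous_const).mul
        ((gaussWin V).continuous.comp (by fun_prop)))) (.of_forall fun z => ?_)
    rw [norm_mul, norm_charFn, one_mul]; exact norm_gaussWin_le _
  rw [e]
  exact m1Norm_superposition_le (hf.2.2.integrableOn)

/-! ### The duality pairing on Schwartz functions -/

theorem conjD_apply (u : 𝓢'(V, ℂ)) (φ : 𝓢(V, ℂ)) : conjD u φ = conj (u (conjS φ)) := rfl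

theorem conjS_conjS (φ : 𝓢(V, ℂ)) : conjS (conjS φ) = φ := by
  ext t; simp [conjS_apply]

theorem continuous_stftD (g : 𝓢(V, ℂ)) (u : 𝓢'(V, ℂ)) :
    Continuous (fun z : V × V => stftD g u z.1 z.2) :=
  u.continuous.comp (conjS.continuous.comp (continuous_tfShift g))

/-- The inversion formula writes `φ` as a superposition of shifted Gaussians, and a distribution may
be applied under this integral. -/
theorem pairing_integrable_and_eq (u : 𝓢'(V, ℂ)) (φ : 𝓢(V, ℂ)) :
    Integrable (fun z : V × V => stftD (gaussWin V) u z.1 z.2 *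
      conj (stft (gaussWin V) φ z.1 z.2)) ∧ pairing u φ = dualBr u φ := by
  have hφ := memM1_schwartz φ
  obtain ⟨f, hf, hu⟩ := exists_superposition (μ := (volume : Measure (V × V))) (Z := V × V)
    continuous_fst continuous_snd hφ.continuous_stft (fun k n => by
      refine (integrable_weight_plane (stftS (gaussWin V) φ) k n).congr (.of_forall fun z => ?_)
      simp only []
      rw [← stftS_apply]) (gaussWin V)
  have hfφ : f = φ := by
    ext t; rw [hf t]; exact (hφ.inversion t).symm
  -- The bracket is conjugate-linear in `φ`; applying the conjugate distribution to `φ` itself and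
  -- conjugating the result gives it.
  obtain ⟨h1, h2⟩ := hu (conjD u)
  constructor
  · refine (integrable_conj h1).congr (.of_forall fun z => ?_)
    simp only [conjD_apply, map_mul, Complex.conj_conj, stftD, dualBr]
    exact mul_comm _ _
  · rw [hfφ, conjD_apply] at h2
    rw [dualBr, ← Complex.conj_conj (u (conjS φ)), h2, ← integral_conj, pairing]
    congr 1; funext z
    simp only [conjD_apply, map_mul, Complex.conj_conj, stftD, dualBr]
    exact mul_comm _ _

/-- On Schwartz functions, the pairing between `M^∞` and `M¹` is the distributional bracket. -/
theorem pairing_schwartz (u : 𝓢'(V, ℂ)) (φ : 𝓢(V, ℂ)) : pairing u φ = dualBr u φ :=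
  (pairing_integrable_and_eq u φ).2

theorem eq_zero_of_stftD_eq_zero {u : 𝓢'(V, ℂ)} (h : ∀ x ω, stftD (gaussWin V) u x ω = 0) :
    u = 0 := by
  ext φ
  have := pairing_schwartz u (conjS φ)
  rw [dualBr, conjS_conjS] at this
  rw [← this, pairing]
  simp [h]

theorem smulLeftCLM_apply (g f : 𝓢(V, ℂ)) (t : V) :
    SchwartzMap.smulLeftCLM ℂ g f t = g t * f t :=
  SchwartzMap.smulLeftCLM_apply_apply g.hasTemperateGrowth f t

/-- A tempered distribution which vanishes on products of Schwartz functions is zero. -/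
theorem eq_zero_of_mul_eq_zero {u : 𝓢'(V, ℂ)}
    (h : ∀ φ ψ : 𝓢(V, ℂ), u (SchwartzMap.smulLeftCLM ℂ φ ψ) = 0) : u = 0 := by
  refine eq_zero_of_stftD_eq_zero fun x ω => ?_
  set c : ℂ := (((2 : ℝ) ^ ((Module.finrank ℝ V : ℝ) / 4) : ℝ) : ℂ)
  -- One Gaussian factor carries the modulation and the normalizing constant; both carry the
  -- translation.
  rw [stftD, dualBr, ← h (conjS (modS ω (translS x (c • gaussHalf V)))) (conjS (translS x (gaussHalf V)))]
  congr 1; ext t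
  rw [smulLeftCLM_apply, conjS_apply, conjS_apply, conjS_apply, modS_translS_apply,
    modS_translS_apply, translS_apply, ← map_mul]
  congr 1
  change _ * (c * gauss0 V (t - x)) = charFn ω t * (c * gaussHalf V (t - x)) * gaussHalf V (t - x)
  rw [← gaussHalf_mul_self]; ring

theorem eq_of_mul_eq {u v : 𝓢'(V, ℂ)} (h : ∀ φ ψ : 𝓢(V, ℂ),
    u (SchwartzMap.smulLeftCLM ℂ φ ψ) = v (SchwartzMap.smulLeftCLM ℂ φ ψ)) : u = v := by
  refine sub_eq_zero.1 (eq_zero_of_mul_eq_zero fun φ ψ => ?_)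
  exact sub_eq_zero.2 (h φ ψ)

theorem eq_of_dualBr_eq {u v : 𝓢'(V, ℂ)} (h : ∀ φ : 𝓢(V, ℂ), dualBr u φ = dualBr v φ) :
    u = v := by
  ext φ
  have := h (conjS φ)
  rwa [dualBr, dualBr, conjS_conjS] at this

end M1

/-! ### The multiplier identity on Schwartz functions. -/

section SchwartzFormulas

variable {V : Type*} [NormedAddCommGroup V] [InnerProductSpace ℝ V] [FiniteDimensional ℝ V]
  [MeasurableSpace V] [BorelSpace V]

theorem convolution_mul_apply (a b : 𝓢(V, ℂ)) (t : V) :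
    SchwartzMap.convolution (ContinuousLinearMap.mul ℂ ℂ) a b t = ∫ y, a y * b (t - y) := by
  rw [SchwartzMap.convolution_apply]; rfl

theorem fourier_convolution_mul_apply (a b : 𝓢(V, ℂ)) (t : V) :
    (𝓕 (SchwartzMap.convolution (ContinuousLinearMap.mul ℂ ℂ) a b) : 𝓢(V, ℂ)) t =
      (𝓕 a : 𝓢(V, ℂ)) t * (𝓕 b : 𝓢(V, ℂ)) t := by
  rw [SchwartzMap.fourier_convolution, SchwartzMap.pairing_apply_apply]; rfl

theorem fourierInv_apply_eq_fourier_neg (f : 𝓢(V, ℂ)) (t : V) :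
    (𝓕⁻ f : 𝓢(V, ℂ)) t = (𝓕 f : 𝓢(V, ℂ)) (-t) := by
  rw [SchwartzMap.fourierInv_coe, SchwartzMap.fourier_coe, Real.fourierInv_eq_fourier_neg]

theorem fourier_reflS_apply (f : 𝓢(V, ℂ)) (t : V) :
    (𝓕 (reflS f) : 𝓢(V, ℂ)) t = (𝓕 f : 𝓢(V, ℂ)) (-t) := by
  rw [SchwartzMap.fourier_coe, SchwartzMap.fourier_coe, fourier_eq_charFn, fourier_eq_charFn,
    ← integral_neg_eq_self]
  congr 1; funext s
  rw [reflS_apply, neg_neg, charFn_neg_left, charFn_neg_right]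

theorem conj_fourier_conjS (f : 𝓢(V, ℂ)) (t : V) :
    conj ((𝓕 (conjS f) : 𝓢(V, ℂ)) t) = (𝓕 f : 𝓢(V, ℂ)) (-t) := by
  rw [SchwartzMap.fourier_coe, SchwartzMap.fourier_coe, fourier_eq_charFn, fourier_eq_charFn,
    ← integral_conj]
  congr 1; funext s
  rw [conjS_apply, map_mul, Complex.conj_conj, Complex.conj_conj, charFn_neg_right,
    Complex.conj_conj]

/-- The product `𝓕 f · conj (𝓕 g)`. -/
def fourierProd (f g : 𝓢(V, ℂ)) : 𝓢(V, ℂ) := SchwartzMap.smulLeftCLM ℂ (𝓕 f : 𝓢(V, ℂ)) (𝓕⁻ (conjS g))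

/-- A Fourier multiplier sees its symbol only through these test functions; the identity holds
because 𝓕⁻¹ of `conj g` is the conjugate of `𝓕 g`. -/
theorem dualBr_fourierMultS (D : 𝓢'(V, ℂ)) (f g : 𝓢(V, ℂ)) :
    dualBr (fourierMultS D f) g = D (fourierProd f g) := rfl

theorem fourier_fourierProd (f g : 𝓢(V, ℂ)) (η : V) :
    (𝓕 (fourierProd f g) : 𝓢(V, ℂ)) η = ∫ t, f t * conj (g (t + η)) := by
  have h := SchwartzMap.integral_fourier_mul_eq f (modS (-η) (𝓕⁻ (conjS g)))
  rw [fourier_modS, FourierTransform.fourier_fourierInv_eq] at h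
  simp only [translS_apply, sub_neg_eq_add, conjS_apply] at h
  rw [← h, SchwartzMap.fourier_coe, fourier_eq_charFn]
  congr 1; funext t
  rw [fourierProd, smulLeftCLM_apply, modS_apply, charFn_neg_right]; ring

/-- Since 𝓕 is bijective on Schwartz space, every product of two Schwartz functions has the form
`fourierProd f g`. Hence the multiplier determines its symbol. -/
theorem eq_of_forall_fourierProd {u v : 𝓢'(V, ℂ)}
    (h : ∀ f g, u (fourierProd f g) = v (fourierProd f g)) : u = v := by
  refine eq_of_mul_eq fun φ ψ => ?_
  have e : fourierProd (𝓕⁻ φ) (conjS (𝓕 ψ)) = SchwartzMap.smulLeftCLM ℂ φ ψ := by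
    rw [fourierProd, conjS_conjS, FourierTransform.fourier_fourierInv_eq,
      FourierTransform.fourierInv_fourier_eq]
  rw [← e]; exact h _ _

/-- The Fourier multiplier as a continuous linear operator `𝓢 → 𝓢'`. -/
def fourierMultCLM (D : 𝓢'(V, ℂ)) : 𝓢(V, ℂ) →L[ℂ] 𝓢'(V, ℂ) where
  toFun f := fourierMultS D f
  map_add' f g := by
    ext φ
    have e : SchwartzMap.smulLeftCLM ℂ (𝓕 (f + g) : 𝓢(V, ℂ)) (𝓕⁻ φ : 𝓢(V, ℂ)) =
        SchwartzMap.smulLeftCLM ℂ (𝓕 f : 𝓢(V, ℂ)) (𝓕⁻ φ) +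
          SchwartzMap.smulLeftCLM ℂ (𝓕 g : 𝓢(V, ℂ)) (𝓕⁻ φ) := by
      ext t
      simp only [_root_.add_apply, smulLeftCLM_apply, FourierTransform.fourier_add]; ring
    exact (congrArg D e).trans (map_add D _ _)
  map_smul' c f := by
    ext φ
    have e : SchwartzMap.smulLeftCLM ℂ (𝓕 (c • f) : 𝓢(V, ℂ)) (𝓕⁻ φ : 𝓢(V, ℂ)) =
        c • SchwartzMap.smulLeftCLM ℂ (𝓕 f : 𝓢(V, ℂ)) (𝓕⁻ φ) := by
      ext t
      simp only [_root_.smul_apply, smulLeftCLM_apply, FourierTransform.fourier_smul, smul_eq_mul]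
      ring
    exact (congrArg D e).trans (map_smul D _ _)
  cont := by
    refine PointwiseConvergenceCLM.continuous_of_continuous_eval fun φ => ?_
    -- Commuting the factors fixes the multiplier function, so that the dependence on `f` goes
    -- through a continuous linear map.
    have e : ∀ f : 𝓢(V, ℂ), SchwartzMap.smulLeftCLM ℂ (𝓕 f : 𝓢(V, ℂ)) (𝓕⁻ φ : 𝓢(V, ℂ)) =
        SchwartzMap.smulLeftCLM ℂ (𝓕⁻ φ : 𝓢(V, ℂ)) (𝓕 f) := fun f => by
      ext t
      rw [smulLeftCLM_apply, smulLeftCLM_apply, mul_comm]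
    have h : ∀ f : 𝓢(V, ℂ), fourierMultS D f φ =
        D (SchwartzMap.smulLeftCLM ℂ (𝓕⁻ φ : 𝓢(V, ℂ)) (𝓕 f)) := fun f => congrArg D (e f)
    simp only [h]
    exact D.continuous.comp ((SchwartzMap.smulLeftCLM ℂ _).continuous.comp
      (fourierCLM ℂ 𝓢(V, ℂ)).continuous)

/-- Common end of the three Schwartz cases: once the form equals `D (fourierProd f g)`, the
multiplier with symbol `D` gives existence, brackets give uniqueness, and injectivity of symbol to
operator gives the equivalence. -/
theorem existsUnique_and_iff_of_form {P : (𝓢(V, ℂ) →L[ℂ] 𝓢'(V, ℂ)) → Prop}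
    {F : 𝓢(V, ℂ) → 𝓢(V, ℂ) → ℂ} (hP : ∀ A, P A ↔ ∀ f g, dualBr (A f) g = F f g)
    {D : 𝓢'(V, ℂ)} (hF : ∀ f g, F f g = D (fourierProd f g)) (m : 𝓢'(V, ℂ)) :
    (∃! A, P A) ∧ ∀ A, P A → ((∀ f, A f = fourierMultS m f) ↔ m = D) := by
  have hD : P (fourierMultCLM D) := (hP _).2 fun f g => (hF f g).symm
  have huniq : ∀ A, P A → A = fourierMultCLM D := fun A hA => by
    ext1 f
    refine eq_of_dualBr_eq fun g => ?_
    rw [(hP _).1 hA, (hP _).1 hD]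
  refine ⟨⟨_, hD, huniq⟩, fun A hA => ?_⟩
  rw [huniq A hA]
  constructor
  · intro h
    refine eq_of_forall_fourierProd fun f g => ?_
    rw [← dualBr_fourierMultS, ← h f]; rfl
  · rintro rfl f; rfl

/-- Moving function and window together leaves only a character in `ω`. This is how the exponential
of the Fourier transform over the plane is absorbed into Moyal's formula. -/
theorem stft_translate (g f : V → ℂ) (η x ω : V) :
    stft (fun t => g (t + η)) (fun t => f (t + η)) x ω = charFn ω η * stft g f x ω := by
  rw [stft_eq, stft_eq, ← integral_const_mul, ← integral_sub_right_eq_self _ η]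
  congr 1; funext y
  rw [sub_eq_add_neg y η, charFn_add_left, charFn_neg_left]
  simp only [map_mul, Complex.conj_conj, neg_add_cancel_right]
  rw [show y + -η - x + η = y - x by abel]
  ring

/-- The product `V_{g₁} f · conj (V_{g₂} g)` as a Schwartz function. -/
def stftProd (g₁ g₂ f g : 𝓢(V, ℂ)) : 𝓢(Plane V, ℂ) :=
  SchwartzMap.smulLeftCLM ℂ (stftS g₁ f) (conjS (stftS g₂ g))

theorem stftProd_apply (g₁ g₂ f g : 𝓢(V, ℂ)) (x ω : V) :
    stftProd g₁ g₂ f g (WithLp.toLp 2 (x, ω)) = stft g₁ f x ω * conj (stft g₂ g x ω) := by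
  rw [stftProd, smulLeftCLM_apply, conjS_apply, stftS_apply, stftS_apply]

theorem norm_schwartz_le (φ : 𝓢(V, ℂ)) (t : V) : ‖φ t‖ ≤ SchwartzMap.seminorm ℂ 0 0 φ :=
  SchwartzMap.norm_le_seminorm ℂ φ t

/-- The heart of the matter. On the Fourier side both sides are products of two correlations: by
Moyal, the left one is the correlation of `f` with `g` times the conjugate correlation of `g₁` with
`g₂`; the right one is this by the convolution theorem. -/
theorem partialInt_stftProd (g₁ g₂ f g : 𝓢(V, ℂ)) :
    partialInt V (stftProd g₁ g₂ f g) = SchwartzMap.convolution (ContinuousLinearMap.mul ℂ ℂ)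
      (reflS (𝓕⁻ (corrSS g₁ g₂))) (fourierProd f g) := by
  set P := SchwartzMap.convolution (ContinuousLinearMap.mul ℂ ℂ)
      (reflS (𝓕⁻ (corrSS g₁ g₂))) (fourierProd f g) with hP
  refine Eq.trans (congrArg (fun φ : 𝓢(V, ℂ) => (𝓕⁻ φ : 𝓢(V, ℂ))) (?_ : _ = (𝓕 P : 𝓢(V, ℂ))))
    (FourierTransform.fourierInv_fourier_eq (F := 𝓢(V, ℂ)) P)
  ext η
  change (𝓕 (stftProd g₁ g₂ f g) : 𝓢(Plane V, ℂ)) (WithLp.toLp 2 (0, η)) = _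
  rw [hP]
  rw [fourier_convolution_mul_apply, fourier_fourierProd, fourier_reflS_apply,
    FourierTransform.fourier_fourierInv_eq, SchwartzMap.fourier_coe, fourier_eq_charFn,
    integral_plane]
  have hcorr : corrSS g₁ g₂ (-η) = conj (∫ t, g₁ t * conj (g₂ (t + η))) := by
    rw [corrSS, convS, convolution_mul_apply, ← integral_conj, ← integral_neg_eq_self,
      ← integral_sub_right_eq_self _ (-η)]
    congr 1; funext t
    rw [reflS_apply, conjS_apply, map_mul, Complex.conj_conj, mul_comm]
    congr 3 <;> abel_nf
  rw [hcorr, mul_comm]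
  -- Synthesis window and test function are both translated by `-η`, which by `stft_translate`
  -- produces the factor e^{-2πi ω·η} after conjugation.
  have hm := (moyal (f := f) (g := g₁) (h := translS (-η) g₂) (k := translS (-η) g)
    f.continuous.aestronglyMeasurable (norm_schwartz_le f) g₁.integrable g₁.continuous
    (translS (-η) g).integrable (translS (-η) g).continuous (translS (-η) g₂).continuous
    (norm_schwartz_le _) (integrable_stft_schwartz _ _)).2
  simp only [translS_apply, sub_neg_eq_add] at hm
  rw [← hm]
  congr 1; funext z
  have h1 := stft_translate (g₂ : V → ℂ) g η z.1 z.2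
  have h2 : stft (translS (-η) g₂) (translS (-η) g) z.1 z.2 = charFn z.2 η * stft g₂ g z.1 z.2 := by
    rw [← h1]; simp only [← sub_neg_eq_add]; rfl
  rw [h2, charFn_plane, stftProd_apply, charFn_zero_right, charFn_comm z.2, Pi.one_apply, one_mul, map_mul]
  change conj (charFn η z.2) * _ = _
  ring

/-- The existential function is pinned down by its values, so it must be `stftProd g₁ g₂ f g`. -/
theorem isSTFTMultS_iff (m : 𝓢'(V, ℂ)) (g₁ g₂ : 𝓢(V, ℂ)) (A : 𝓢(V, ℂ) →L[ℂ] 𝓢'(V, ℂ)) :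
    IsSTFTMultS (oneTensor m) g₁ g₂ A ↔ ∀ f g, dualBr (A f) g =
      m (partialInt V (stftProd g₁ g₂ f g)) := by
  refine forall₂_congr fun f g => ⟨?_, fun h => ⟨_, stftProd_apply g₁ g₂ f g, h⟩⟩
  rintro ⟨Φ, hΦ, h⟩
  have e : Φ = stftProd g₁ g₂ f g := by
    ext w
    have := (hΦ w.fst w.snd).trans (stftProd_apply g₁ g₂ f g w.fst w.snd).symm
    exact this
  rw [h, e]; rfl

theorem schwartz_case (m m₂ : 𝓢'(V, ℂ)) (g₁ g₂ : 𝓢(V, ℂ)) :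
    (∃! A, IsSTFTMultS (oneTensor m) g₁ g₂ A) ∧
      ∀ A, IsSTFTMultS (oneTensor m) g₁ g₂ A →
        ((∀ f, A f = fourierMultS m₂ f) ↔ m₂ = convD m (𝓕⁻ (corrSS g₁ g₂))) :=
  existsUnique_and_iff_of_form (isSTFTMultS_iff m g₁ g₂)
    (fun f g => by rw [partialInt_stftProd]; rfl) m₂

/-! ### Distributional windows -/

theorem translS_modS (x ω : V) (φ : 𝓢(V, ℂ)) :
    translS (-x) (modS ω φ) = charFn ω x • modS ω (translS (-x) φ) := by
  ext t
  simp only [_root_.smul_apply, smul_eq_mul, translS_apply, modS_apply,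
    sub_neg_eq_add, charFn_add_left]
  ring

/-- Moves the shift from the distributional window to `conj f`, with a phase from the order of
translation and modulation, so that `exists_superposition` becomes applicable. -/
theorem stftWinD_eq (u : 𝓢'(V, ℂ)) (f : 𝓢(V, ℂ)) (x ω : V) :
    stftWinD u f x ω = conj (charFn ω x * u (modS ω (translS (-x) (conjS f)))) := by
  rw [stftWinD, dualBr]
  change conj (u (translS (-x) (modS ω (conjS f)))) = _
  rw [translS_modS, map_smul, smul_eq_mul]

/-- Parseval in `ω`: for fixed `x` the STFT is the Fourier transform of `g` times the conjugated,
translated window, and the character turns `𝓕 m` into a translate. -/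
theorem integral_symbol_stft (m g₂ g : 𝓢(V, ℂ)) (x s : V) :
    ∫ ω, m ω * conj (stft g₂ g x ω) * conj (charFn ω s) =
      ∫ y, (𝓕 m : 𝓢(V, ℂ)) (s - y) * (conj (g y) * g₂ (y - x)) := by
  set k := SchwartzMap.smulLeftCLM ℂ (conjS (translS x g₂)) g with hk
  have hka : ∀ y, k y = g y * conj (g₂ (y - x)) := fun y => by
    rw [hk, smulLeftCLM_apply, conjS_apply, translS_apply, mul_comm]
  have hkf : (fun y => g y * conj (g₂ (y - x))) = k := funext fun y => (hka y).symm
  have h := integral_fourier_mul_conj_fourier (a := (𝓕⁻ (modS (-s) m) : 𝓢(V, ℂ))) (b := k)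
    (𝓕⁻ (modS (-s) m) : 𝓢(V, ℂ)).integrable k.integrable k.continuous
    (by rw [← SchwartzMap.fourier_coe]; exact (𝓕 k).integrable)
  rw [← SchwartzMap.fourier_coe, FourierTransform.fourier_fourierInv_eq] at h
  convert h using 2
  · funext ω
    rw [modS_apply, stft, hkf, charFn_neg_right, charFn_comm s ω]; ring
  · funext y
    rw [fourierInv_apply_eq_fourier_neg, fourier_modS, translS_apply, hka, map_mul,
      Complex.conj_conj, sub_neg_eq_add, neg_add_eq_sub]

theorem fourierInv_convolution_fourierProd (m f g : 𝓢(V, ℂ)) (s : V) :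
    (𝓕⁻ (SchwartzMap.convolution (ContinuousLinearMap.mul ℂ ℂ) (reflS m) (fourierProd f g)) :
      𝓢(V, ℂ)) s = (𝓕 m : 𝓢(V, ℂ)) s * ∫ t, f t * conj (g (t - s)) := by
  rw [fourierInv_apply_eq_fourier_neg, fourier_convolution_mul_apply, fourier_reflS_apply,
    fourier_fourierProd, neg_neg]
  simp only [← sub_eq_add_neg]

/-- Up to conjugation, this is the Schwartz function at which the distributional analysis window
gets evaluated. The `ω` integral is `integral_symbol_stft`, and the `x` integral, taken after
Fubini, is a correlation of `f` with `g`. -/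
theorem integral_symbol_stft_shift (m g₂ f g : 𝓢(V, ℂ)) (t : V) :
    ∫ z : V × V, m z.2 * conj (stft g₂ g z.1 z.2) * conj (charFn z.2 (z.1 + t)) * f (t + z.1) =
      SchwartzMap.convolution (ContinuousLinearMap.mul ℂ ℂ) g₂
        (𝓕⁻ (SchwartzMap.convolution (ContinuousLinearMap.mul ℂ ℂ) (reflS m) (fourierProd f g))) t := by
  have hi : Integrable (fun z : V × V =>
      m z.2 * conj (stft g₂ g z.1 z.2) * conj (charFn z.2 (z.1 + t)) * f (t + z.1)) := by
    refine ((integrable_conj (integrable_stft_schwartz g₂ g)).bdd_mul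
      (f := fun z : V × V => m z.2 * conj (charFn z.2 (z.1 + t)) * f (t + z.1))
      (c := SchwartzMap.seminorm ℂ 0 0 m * 1 * SchwartzMap.seminorm ℂ 0 0 f)
      (Continuous.aestronglyMeasurable ?_) (.of_forall fun z => ?_)).congr
      (.of_forall fun z => ?_)
    · exact ((m.continuous.comp continuous_snd).mul (Complex.continuous_conj.comp
        (continuous_charFn (by fun_prop) (by fun_prop)))).mul (f.continuous.comp (by fun_prop))
    · rw [norm_mul, norm_mul, RCLike.norm_conj, norm_charFn]
      gcongr
      · exact norm_schwartz_le m _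
      · exact norm_schwartz_le f _
    · simp only []; ring
  rw [Measure.volume_eq_prod, integral_prod _ hi, convolution_mul_apply]
  have h2 : Integrable (Function.uncurry fun (x y : V) => f (t + x) * ((𝓕 m : 𝓢(V, ℂ)) (t - y) *
      (conj (g (y + x)) * g₂ y))) (volume.prod volume) := by
    refine (((f.integrable (μ := volume)).comp_add_left t).mul_prod
      (g₂.integrable (μ := volume))).bdd_mul
      (f := fun p : V × V => (𝓕 m : 𝓢(V, ℂ)) (t - p.2) * conj (g (p.2 + p.1)))
      (c := SchwartzMap.seminorm ℂ 0 0 (𝓕 m) * SchwartzMap.seminorm ℂ 0 0 g)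
      (Continuous.aestronglyMeasurable ?_) (.of_forall fun z => ?_) |>.congr
      (.of_forall fun z => ?_)
    · exact ((𝓕 m : 𝓢(V, ℂ)).continuous.comp (by fun_prop)).mul
        (Complex.continuous_conj.comp (g.continuous.comp (by fun_prop)))
    · rw [norm_mul, RCLike.norm_conj]
      gcongr
      · exact norm_schwartz_le _ _
      · exact norm_schwartz_le g _
    · simp only [Function.uncurry]; ring
  calc _ = ∫ x, ∫ y, f (t + x) * ((𝓕 m : 𝓢(V, ℂ)) (t - y) * (conj (g (y + x)) * g₂ y)) := by
        congr 1; funext x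
        simp only []
        rw [integral_mul_const, integral_symbol_stft, mul_comm, ← integral_const_mul,
          ← integral_add_right_eq_self _ x]
        congr 1; funext y
        rw [add_sub_cancel_right, show x + t - (y + x) = t - y by abel]
    _ = ∫ y, ∫ x, f (t + x) * ((𝓕 m : 𝓢(V, ℂ)) (t - y) * (conj (g (y + x)) * g₂ y)) :=
        integral_integral_swap h2
    _ = _ := by
        congr 1; funext y
        rw [fourierInv_convolution_fourierProd, ← integral_const_mul, ← integral_const_mul,
          ← integral_add_left_eq_self (fun x => g₂ y * ((𝓕 m : 𝓢(V, ℂ)) (t - y) *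
            (f x * conj (g (x - (t - y)))))) t]
        congr 1; funext x
        rw [show t + x - (t - y) = y + x by abel]
        ring

theorem convD_corrDS_apply (m g₂ : 𝓢(V, ℂ)) (g₁ : 𝓢'(V, ℂ)) (φ : 𝓢(V, ℂ)) :
    convD (𝓕⁻ (corrDS g₁ g₂)) m φ = conj (g₁ (conjS (SchwartzMap.convolution
      (ContinuousLinearMap.mul ℂ ℂ) g₂ (𝓕⁻ (SchwartzMap.convolution
        (ContinuousLinearMap.mul ℂ ℂ) (reflS m) φ))))) := by
  have h : reflS (reflS g₂) = g₂ := by ext t; simp [reflS_apply]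
  change conj (g₁ (conjS (SchwartzMap.convolution (ContinuousLinearMap.mul ℂ ℂ)
    (reflS (reflS g₂)) _))) = _
  rw [h]; rfl

theorem convD_corrSD_apply (m g₁ : 𝓢(V, ℂ)) (g₂ : 𝓢'(V, ℂ)) (φ : 𝓢(V, ℂ)) :
    convD (𝓕⁻ (corrSD g₁ g₂)) m φ = g₂ (reflS (SchwartzMap.convolution
      (ContinuousLinearMap.mul ℂ ℂ) (reflS (conjS g₁)) (𝓕⁻ (SchwartzMap.convolution
        (ContinuousLinearMap.mul ℂ ℂ) (reflS m) φ)))) := rfl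

/-- The integrand is the conjugate of `g₁` applied to shifts of `conj f`, with rapidly decaying
coefficients supplied by the STFT of `g`. So `g₁` can be taken out of the integral. -/
theorem integral_stftWinD_left (m g₂ f g : 𝓢(V, ℂ)) (g₁ : 𝓢'(V, ℂ)) :
    Integrable (fun z : V × V => m z.2 * stftWinD g₁ f z.1 z.2 * conj (stft g₂ g z.1 z.2)) ∧
    ∫ z : V × V, m z.2 * stftWinD g₁ f z.1 z.2 * conj (stft g₂ g z.1 z.2) =
      convD (𝓕⁻ (corrDS g₁ g₂)) m (fourierProd f g) := by
  have hc : Continuous fun z : V × V => stft g₂ g z.1 z.2 :=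
    continuous_stft g.integrable g₂.continuous (norm_schwartz_le g₂)
  have hcc : Continuous fun z : V × V =>
      conj (m z.2) * stft g₂ g z.1 z.2 * charFn z.2 z.1 :=
    ((Complex.continuous_conj.comp (m.continuous.comp continuous_snd)).mul hc).mul
      (continuous_charFn continuous_snd continuous_fst)
  obtain ⟨F, hF, hu⟩ := exists_superposition (μ := (volume : Measure (V × V))) (Z := V × V)
    (a := fun z => -z.1) (b := fun z => z.2) (by fun_prop) (by fun_prop) hcc (fun k n => by
      refine ((integrable_weight_plane (stftS g₂ g) k n).const_mul
        (SchwartzMap.seminorm ℂ 0 0 m)).mono' (Continuous.aestronglyMeasurable (by fun_prop))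
        (.of_forall fun z => ?_)
      rw [Real.norm_of_nonneg (by positivity), norm_neg, norm_mul, norm_mul, RCLike.norm_conj,
        norm_charFn, mul_one, ← stftS_apply, mul_left_comm]
      gcongr
      exact norm_schwartz_le m _) (conjS f)
  have hFeq : F = conjS (SchwartzMap.convolution (ContinuousLinearMap.mul ℂ ℂ) g₂
      (𝓕⁻ (SchwartzMap.convolution (ContinuousLinearMap.mul ℂ ℂ) (reflS m) (fourierProd f g)))) := by
    ext t
    rw [hF t, conjS_apply, ← integral_symbol_stft_shift, ← integral_conj]
    congr 1; funext z
    rw [conjS_apply, sub_neg_eq_add, charFn_add_left]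
    simp only [map_mul, Complex.conj_conj]
    ring
  obtain ⟨h1, h2⟩ := hu g₁
  have e : ∀ z : V × V, m z.2 * stftWinD g₁ f z.1 z.2 * conj (stft g₂ g z.1 z.2) =
      conj (conj (m z.2) * stft g₂ g z.1 z.2 * charFn z.2 z.1 *
        g₁ (modS z.2 (translS (-z.1) (conjS f)))) := fun z => by
    rw [stftWinD_eq]
    simp only [map_mul, Complex.conj_conj]
    ring
  simp only [e]
  refine ⟨integrable_conj h1, ?_⟩
  rw [integral_conj, ← h2, hFeq, convD_corrDS_apply]

/-- Conjugating the form exchanges `f` with `g` and analysis with synthesis window. This is the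
matching symmetry of the candidate symbols, and it reduces a distributional synthesis window to a
distributional analysis window. -/
theorem conj_convD_corrDS (m g₁ f g : 𝓢(V, ℂ)) (g₂ : 𝓢'(V, ℂ)) :
    conj (convD (𝓕⁻ (corrDS g₂ g₁)) (conjS m) (fourierProd g f)) =
      convD (𝓕⁻ (corrSD g₁ g₂)) m (fourierProd f g) := by
  rw [convD_corrDS_apply, convD_corrSD_apply, Complex.conj_conj]
  congr 1; ext t
  have key : ∀ s : V, conj ((𝓕⁻ (SchwartzMap.convolution (ContinuousLinearMap.mul ℂ ℂ)
      (reflS (conjS m)) (fourierProd g f)) : 𝓢(V, ℂ)) s) =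
      (𝓕⁻ (SchwartzMap.convolution (ContinuousLinearMap.mul ℂ ℂ)
        (reflS m) (fourierProd f g)) : 𝓢(V, ℂ)) (-s) := fun s => by
    rw [fourierInv_convolution_fourierProd, fourierInv_convolution_fourierProd, map_mul,
      conj_fourier_conjS, ← integral_conj,
      ← integral_add_right_eq_self (fun r => conj (g r * conj (f (r - s)))) s]
    congr 2; funext r
    rw [add_sub_cancel_right, map_mul, Complex.conj_conj, sub_neg_eq_add, mul_comm]
  rw [conjS_apply, reflS_apply, convolution_mul_apply, convolution_mul_apply, ← integral_conj,
    ← integral_neg_eq_self (fun y => reflS (conjS g₁) y * _)]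
  congr 1; funext y
  rw [map_mul, key, reflS_apply, conjS_apply, neg_neg, neg_sub, sub_neg_eq_add, neg_add_eq_sub]

theorem integral_stftWinD_right (m g₁ f g : 𝓢(V, ℂ)) (g₂ : 𝓢'(V, ℂ)) :
    Integrable (fun z : V × V => m z.2 * stft g₁ f z.1 z.2 * conj (stftWinD g₂ g z.1 z.2)) ∧
    ∫ z : V × V, m z.2 * stft g₁ f z.1 z.2 * conj (stftWinD g₂ g z.1 z.2) =
      convD (𝓕⁻ (corrSD g₁ g₂)) m (fourierProd f g) := by
  obtain ⟨h1, h2⟩ := integral_stftWinD_left (conjS m) g₁ g f g₂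
  have e : ∀ z : V × V, m z.2 * stft g₁ f z.1 z.2 * conj (stftWinD g₂ g z.1 z.2) =
      conj (conjS m z.2 * stftWinD g₂ g z.1 z.2 * conj (stft g₁ f z.1 z.2)) := fun z => by
    simp only [map_mul, Complex.conj_conj, conjS_apply]; ring
  simp only [e]
  refine ⟨integrable_conj h1, ?_⟩
  rw [integral_conj, h2, conj_convD_corrDS]

theorem isSTFTMultFunS_iff {a : V × V → ℂ} {V₁ V₂ : 𝓢(V, ℂ) → V → V → ℂ}
    (h : ∀ f g, Integrable (fun z : V × V => a z * V₁ f z.1 z.2 * conj (V₂ g z.1 z.2)))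
    (A : 𝓢(V, ℂ) →L[ℂ] 𝓢'(V, ℂ)) : IsSTFTMultFunS a V₁ V₂ A ↔
      ∀ f g, dualBr (A f) g = ∫ z : V × V, a z * V₁ f z.1 z.2 * conj (V₂ g z.1 z.2) :=
  forall₂_congr fun f g => and_iff_right (h f g)

theorem schwartz_case_left (m m₂ : 𝓢(V, ℂ)) (g₁ : 𝓢'(V, ℂ)) (g₂ : 𝓢(V, ℂ)) :
    (∃! A, IsSTFTMultFunS (fun z => m z.2) (stftWinD g₁) (fun f => stft g₂ f) A) ∧
      ∀ A, IsSTFTMultFunS (fun z => m z.2) (stftWinD g₁) (fun f => stft g₂ f) A →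
        ((∀ f, A f = fourierMultS (m₂ : 𝓢'(V, ℂ)) f) ↔
          (m₂ : 𝓢'(V, ℂ)) = convD (𝓕⁻ (corrDS g₁ g₂)) m) :=
  existsUnique_and_iff_of_form
    (isSTFTMultFunS_iff fun f g => (integral_stftWinD_left m g₂ f g g₁).1)
    (fun f g => (integral_stftWinD_left m g₂ f g g₁).2) _

theorem schwartz_case_right (m m₂ : 𝓢(V, ℂ)) (g₁ : 𝓢(V, ℂ)) (g₂ : 𝓢'(V, ℂ)) :
    (∃! A, IsSTFTMultFunS (fun z => m z.2) (fun f => stft g₁ f) (stftWinD g₂) A) ∧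
      ∀ A, IsSTFTMultFunS (fun z => m z.2) (fun f => stft g₁ f) (stftWinD g₂) A →
        ((∀ f, A f = fourierMultS (m₂ : 𝓢'(V, ℂ)) f) ↔
          (m₂ : 𝓢'(V, ℂ)) = convD (𝓕⁻ (corrSD g₁ g₂)) m) :=
  existsUnique_and_iff_of_form
    (isSTFTMultFunS_iff fun f g => (integral_stftWinD_right m g₁ f g g₂).1)
    (fun f g => (integral_stftWinD_right m g₁ f g g₂).2) _

end SchwartzFormulas

/-! ### Functions in M¹: Lipschitz functionals, STFT bounds, Fourier invariance. -/

section M1Functions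

variable {V : Type*} [NormedAddCommGroup V] [InnerProductSpace ℝ V] [FiniteDimensional ℝ V]
  [MeasurableSpace V] [BorelSpace V]

theorem MemM1.aestronglyMeasurable {f : V → ℂ} (hf : MemM1 f) : AEStronglyMeasurable f :=
  hf.1.aestronglyMeasurable

theorem integrable_stft_integrand {f g : V → ℂ} (hf : Integrable f) (hg : Continuous g) {C : ℝ}
    (hgC : ∀ t, ‖g t‖ ≤ C) (x ω : V) :
    Integrable (fun y => conj (charFn ω y) * (f y * conj (g (y - x)))) :=
  (integrable_mul_conj_comp_sub' hf hgC hg x).bdd_mul (c := 1)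
    (Complex.continuous_conj.comp
      (continuous_charFn continuous_const continuous_id)).aestronglyMeasurable
    (.of_forall fun y => by rw [RCLike.norm_conj, norm_charFn])

theorem stft_sub {f f' g : V → ℂ} (hf : Integrable f) (hf' : Integrable f') (hg : Continuous g)
    {C : ℝ} (hgC : ∀ t, ‖g t‖ ≤ C) (x ω : V) :
    stft g (fun t => f t - f' t) x ω = stft g f x ω - stft g f' x ω := by
  rw [stft_eq, stft_eq, stft_eq, ← integral_sub (integrable_stft_integrand hf hg hgC x ω)
    (integrable_stft_integrand hf' hg hgC x ω)]
  congr 1; funext y; ring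

theorem stft_sub_window {f g g' : V → ℂ} (hf : Integrable f) (hg : Continuous g)
    (hg' : Continuous g') {C C' : ℝ} (hgC : ∀ t, ‖g t‖ ≤ C) (hgC' : ∀ t, ‖g' t‖ ≤ C') (x ω : V) :
    stft (fun t => g t - g' t) f x ω = stft g f x ω - stft g' f x ω := by
  rw [stft_eq, stft_eq, stft_eq, ← integral_sub (integrable_stft_integrand hf hg hgC x ω)
    (integrable_stft_integrand hf hg' hgC' x ω)]
  congr 1; funext y; rw [map_sub]; ring

theorem MemM1.stft_gaussWin_sub {f g : V → ℂ} (hf : MemM1 f) (hg : MemM1 g) (x ω : V) :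
    stft (gaussWin V) (fun t => f t - g t) x ω =
      stft (gaussWin V) f x ω - stft (gaussWin V) g x ω :=
  stft_sub hf.2.1 hg.2.1 (gaussWin V).continuous norm_gaussWin_le x ω

theorem MemM1.sub {f g : V → ℂ} (hf : MemM1 f) (hg : MemM1 g) : MemM1 (fun t => f t - g t) := by
  refine ⟨hf.1.sub hg.1, hf.2.1.sub hg.2.1, ?_⟩
  simp only [hf.stft_gaussWin_sub hg]
  exact hf.2.2.sub hg.2.2

/-- Lipschitz continuity of a functional on `M¹`. -/
def LipschitzM1 (L : (V → ℂ) → ℂ) : Prop :=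
  ∃ C : ℝ, ∀ f g : V → ℂ, MemM1 f → MemM1 g → ‖L f - L g‖ ≤ C * m1Norm (fun t => f t - g t)

theorem LipschitzM1.of_bound {L : (V → ℂ) → ℂ}
    (hsub : ∀ f g : V → ℂ, MemM1 f → MemM1 g → L (fun t => f t - g t) = L f - L g) {C : ℝ}
    (hb : ∀ f, MemM1 f → ‖L f‖ ≤ C * m1Norm f) : LipschitzM1 L :=
  ⟨C, fun f g hf hg => by rw [← hsub f g hf hg]; exact hb _ (hf.sub hg)⟩

theorem LipschitzM1.eq_of_eq_on_schwartz {L L' : (V → ℂ) → ℂ} (hL : LipschitzM1 L)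
    (hL' : LipschitzM1 L') (h : ∀ φ : 𝓢(V, ℂ), L φ = L' φ) {f : V → ℂ} (hf : MemM1 f) :
    L f = L' f := by
  obtain ⟨C, hC⟩ := hL
  obtain ⟨C', hC'⟩ := hL'
  have key : ∀ ε : ℝ, 0 < ε → ‖L f - L' f‖ ≤ (|C| + |C'|) * ε := by
    intro ε hε
    obtain ⟨φ, hφ⟩ := hf.exists_schwartz_approx hε
    have h1 := hC f φ hf (memM1_schwartz φ)
    have h2 := hC' f φ hf (memM1_schwartz φ)
    have h0 := m1Norm_nonneg (fun t => f t - φ t)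
    calc ‖L f - L' f‖ = ‖(L f - L φ) - (L' f - L' φ)‖ := by rw [h]; congr 1; ring
      _ ≤ ‖L f - L φ‖ + ‖L' f - L' φ‖ := norm_sub_le _ _
      _ ≤ |C| * m1Norm (fun t => f t - φ t) + |C'| * m1Norm (fun t => f t - φ t) := by
          gcongr
          · exact h1.trans (by gcongr; exact le_abs_self _)
          · exact h2.trans (by gcongr; exact le_abs_self _)
      _ = (|C| + |C'|) * m1Norm (fun t => f t - φ t) := by ring
      _ ≤ _ := by gcongr
  rw [← sub_eq_zero, ← norm_le_zero_iff]
  refine le_of_forall_pos_le_add fun ε hε => ?_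
  -- The added 1 keeps the denominator positive when both constants vanish.
  have := key (ε / (|C| + |C'| + 1)) (by positivity)
  refine this.trans ?_
  rw [zero_add, mul_div_assoc', div_le_iff₀ (by positivity)]
  nlinarith [abs_nonneg C, abs_nonneg C']

/-- `M¹` is invariant under time-frequency shifts. -/
theorem MemM1.tfShift {f : V → ℂ} (hf : MemM1 f) (x ω : V) :
    MemM1 (fun t => charFn ω t * f (t - x)) := by
  refine ⟨(continuous_charFn continuous_const continuous_id).mul (hf.1.comp (by fun_prop)),
    (hf.2.1.comp_sub_right x).bdd_mul (c := 1)
      (continuous_charFn continuous_const continuous_id).aestronglyMeasurable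
      (.of_forall fun y => (norm_charFn _ _).le), ?_⟩
  simp only [stft_shift]
  refine (Integrable.comp_sub_right hf.2.2 ((x, ω) : V × V)).bdd_mul (c := 1)
    (Complex.continuous_conj.comp (continuous_charFn
      (by fun_prop) continuous_const)).aestronglyMeasurable
    (.of_forall fun z => by rw [RCLike.norm_conj, norm_charFn])

theorem stft_eq_integral_tfShift (g f : V → ℂ) (x ω : V) :
    stft g f x ω = ∫ y, f y * conj (charFn ω y * g (y - x)) := by
  rw [stft_eq]; congr 1; funext y; rw [map_mul]; ring

/-- Moyal with the normalized Gaussian rewrites the bracket of `f` with a shifted `g` as a bracket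
of their Gaussian STFTs, and shifting `g` only translates the modulus of its STFT. Integrating over
`w` gives `MemM1.integrable_stft`. -/
theorem MemM1.norm_stft_le_convolution {f g : V → ℂ} (hf : MemM1 f) (hg : MemM1 g) (w : V × V) :
    ‖stft g f w.1 w.2‖ ≤
      ∫ z : V × V, ‖stft (gaussWin V) f z.1 z.2‖ * ‖stft (gaussWin V) g (z - w).1 (z - w).2‖ := by
  have hs := hg.tfShift w.1 w.2
  have hm := (moyal hf.aestronglyMeasurable hf.norm_le (gaussWin V).integrable
    (gaussWin V).continuous hs.2.1 hs.1 (gaussWin V).continuous norm_gaussWin_le hs.2.2).2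
  rw [integral_gaussWin_mul_self, map_one, mul_one, ← stft_eq_integral_tfShift] at hm
  rw [← hm]
  refine (norm_integral_le_integral_norm _).trans_eq ?_
  congr 1; funext z
  rw [norm_mul, RCLike.norm_conj, norm_stft_shift]; rfl

theorem integral_mul_comp_sub {G : Type*} [AddCommGroup G] [MeasurableSpace G] [MeasurableAdd₂ G]
    [MeasurableNeg G] {μ : Measure G} [SFinite μ] [μ.IsAddLeftInvariant] [μ.IsNegInvariant]
    {a b : G → ℝ} (ha : Integrable a μ) (hb : Integrable b μ) :
    Integrable (fun w => ∫ z, a z * b (z - w) ∂μ) μ ∧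
      ∫ w, ∫ z, a z * b (z - w) ∂μ ∂μ = (∫ z, a z ∂μ) * ∫ z, b z ∂μ := by
  have mp : MeasurePreserving (fun p : G × G => (p.1, p.1 - p.2)) (μ.prod μ) (μ.prod μ) := by
    convert ((MeasurePreserving.id μ).prod (Measure.measurePreserving_neg μ)).comp
      (measurePreserving_prod_sub μ μ) using 2 with z
    simp
  have h : Integrable (fun p : G × G => a p.1 * b (p.1 - p.2)) (μ.prod μ) :=
    mp.integrable_comp_of_integrable (ha.mul_prod hb)
  refine ⟨h.integral_prod_right, ?_⟩
  rw [← integral_integral_swap (f := fun z w => a z * b (z - w)) h]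
  simp only [integral_const_mul, integral_sub_left_eq_self b]
  rw [integral_mul_const]

theorem MemM1.integrable_stft {f g : V → ℂ} (hf : MemM1 f) (hg : MemM1 g) :
    Integrable (fun z : V × V => stft g f z.1 z.2) ∧
      ∫ z : V × V, ‖stft g f z.1 z.2‖ ≤ m1Norm f * m1Norm g := by
  obtain ⟨h1, h2⟩ := integral_mul_comp_sub hf.2.2.norm hg.2.2.norm
  have hi : Integrable (fun z : V × V => stft g f z.1 z.2) :=
    h1.mono' (TimeFreq.continuous_stft hf.2.1 hg.1 hg.norm_le).aestronglyMeasurable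
      (.of_forall fun w => hf.norm_stft_le_convolution hg w)
  refine ⟨hi, ?_⟩
  rw [m1Norm, m1Norm, ← h2]
  exact integral_mono hi.norm h1 fun w => hf.norm_stft_le_convolution hg w

/-- A bounded continuous function with integrable Gaussian STFT is in `M¹`. -/
theorem memM1_of_integrable_stft {f : V → ℂ} (hf : Continuous f) {C : ℝ} (hC : ∀ t, ‖f t‖ ≤ C)
    (h : Integrable (fun z : V × V => stft (gaussWin V) f z.1 z.2)) : MemM1 f := by
  refine ⟨hf, ?_, h⟩
  have h0 : gaussWin V 0 ≠ 0 := by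
    rw [gaussWin_eq_ofReal]; exact_mod_cast (by positivity)
  have hg : Integrable (fun x : V => ‖gaussWin V 0‖⁻¹ * ∫ ω, ‖stft (gaussWin V) f x ω‖) :=
    (h.norm.integral_prod_left).const_mul _
  refine hg.mono' hf.aestronglyMeasurable ?_
  filter_upwards [h.prod_right_ae] with x hx
  have hc : Continuous fun y => f y * conj (gaussWin V (y - x)) :=
    hf.mul (Complex.continuous_conj.comp ((gaussWin V).continuous.comp (by fun_prop)))
  have hi : Integrable fun y => f y * conj (gaussWin V (y - x)) :=
    integrable_mul_conj_comp_sub hf.aestronglyMeasurable hC (gaussWin V).integrable x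
  -- Inverting the slice at the point `x` itself gives `f x` times the constant `gaussWin V 0`, so
  -- the integral of the slice dominates `‖f x‖`.
  have := congrFun (hc.fourierInv_fourier_eq hi hx) x
  simp only [sub_self, conj_gaussWin] at this
  have h2 : ‖f x‖ * ‖gaussWin V 0‖ ≤ ∫ ω, ‖stft (gaussWin V) f x ω‖ := by
    rw [← norm_mul, ← this, fourierInv_eq_charFn]
    refine (norm_integral_le_integral_norm _).trans_eq ?_
    congr 1; funext ω
    rw [norm_mul, norm_charFn, one_mul]; simp only [stft, conj_gaussWin]
  rw [← div_eq_inv_mul, le_div_iff₀ (norm_pos_iff.2 h0)]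
  exact h2

theorem fourier_translS (x : V) (φ : 𝓢(V, ℂ)) : 𝓕 (translS x φ) = modS (-x) (𝓕 φ) := by
  ext ω
  rw [modS_apply, SchwartzMap.fourier_coe, SchwartzMap.fourier_coe, fourier_eq_charFn,
    fourier_eq_charFn, ← integral_const_mul, ← integral_add_right_eq_self _ x]
  congr 1; funext y
  rw [translS_apply, add_sub_cancel_right, charFn_add_left, charFn_neg_right, charFn_comm x, map_mul]
  ring

theorem measurePreserving_rotate :
    MeasurePreserving (fun z : V × V => (z.2, -z.1)) volume volume := by
  have h := ((MeasurePreserving.id (volume : Measure V)).prod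
    (Measure.measurePreserving_neg (volume : Measure V))).comp
    (Measure.measurePreserving_swap (μ := (volume : Measure V)) (ν := (volume : Measure V)))
  exact h

theorem measurableEmbedding_rotate : MeasurableEmbedding (fun z : V × V => (z.2, -z.1)) :=
  ((Homeomorph.prodComm V V).trans
    ((Homeomorph.refl V).prodCongr (Homeomorph.neg V))).measurableEmbedding

/-- Because the Gaussian is its own Fourier transform, 𝓕⁻¹ acts on the STFT as a rotation of the
plane by a quarter turn, up to a phase. Hence M¹ and its norm are preserved. -/
theorem stft_fourierInv {f : V → ℂ} (hf : Integrable f) (x ω : V) :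
    stft (gaussWin V) (𝓕⁻ f) x ω = conj (charFn ω x) * stft (gaussWin V) f ω (-x) := by
  have h := VectorFourier.integral_fourierIntegral_smul_eq_flip (μ := volume) (ν := volume)
    (L := innerₗ V) Real.continuous_fourierChar continuous_inner hf
    ((modS ω (translS (-x) (gaussWin V))).integrable (μ := volume))
  rw [flip_innerₗ] at h
  change ∫ y, 𝓕 f y • _ = ∫ y, f y • 𝓕 (⇑(modS ω (translS (-x) (gaussWin V)))) y at h
  rw [← SchwartzMap.fourier_coe, fourier_modS, fourier_translS, fourier_gaussWin, neg_neg] at h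
  rw [stft_eq, stft_eq, ← integral_neg_eq_self, ← integral_const_mul]
  refine Eq.trans ?_ (h.trans ?_)
  · congr 1; funext y
    rw [Real.fourierInv_eq_fourier_neg, neg_neg, charFn_neg_left, Complex.conj_conj, conj_gaussWin,
      ← gaussWin_neg, modS_translS_apply, smul_eq_mul, neg_sub, sub_neg_eq_add, sub_neg_eq_add,
      add_comm x]
    ring
  · congr 1; funext y
    rw [translS_apply, modS_apply, smul_eq_mul, charFn_neg_right, Complex.conj_conj, conj_gaussWin,
      sub_eq_add_neg y ω, charFn_add_left, charFn_neg_left, charFn_comm x ω]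
    ring

theorem MemM1.fourierInv {f : V → ℂ} (hf : MemM1 f) : MemM1 (𝓕⁻ f) := by
  have hc : Continuous (𝓕⁻ f) := by
    have : 𝓕⁻ f = fun y => 𝓕 f (-y) := funext fun y => Real.fourierInv_eq_fourier_neg f y
    rw [this]
    exact (VectorFourier.fourierIntegral_continuous Real.continuous_fourierChar
      continuous_inner hf.2.1).comp continuous_neg
  refine memM1_of_integrable_stft hc (C := ∫ t, ‖f t‖) (fun y => ?_) ?_
  · rw [fourierInv_eq_charFn]
    refine (norm_integral_le_integral_norm _).trans_eq ?_
    congr 1; funext ω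
    rw [norm_mul, norm_charFn, one_mul]
  · simp only [stft_fourierInv hf.2.1]
    refine Integrable.bdd_mul (c := 1) ?_ (Complex.continuous_conj.comp (continuous_charFn
      continuous_snd continuous_fst)).aestronglyMeasurable
      (.of_forall fun z => by rw [RCLike.norm_conj, norm_charFn])
    exact (measurePreserving_rotate (V := V)).integrable_comp_of_integrable hf.2.2

theorem m1Norm_fourierInv {f : V → ℂ} (hf : Integrable f) : m1Norm (𝓕⁻ f) = m1Norm f := by
  have h := (measurePreserving_rotate (V := V)).integral_comp measurableEmbedding_rotate
    (fun z : V × V => ‖stft (gaussWin V) f z.1 z.2‖)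
  rw [m1Norm, m1Norm, ← h]
  congr 1; funext z
  rw [stft_fourierInv hf, norm_mul, RCLike.norm_conj, norm_charFn, one_mul]

end M1Functions

/-! ### Conjugation, reflection, convolution and correlation on M¹. -/

section Operations

variable {V : Type*} [NormedAddCommGroup V] [InnerProductSpace ℝ V] [FiniteDimensional ℝ V]
  [MeasurableSpace V] [BorelSpace V]

theorem integrable_comp_neg {E : Type*} [NormedAddCommGroup E] {f : V × V → E}
    (hf : Integrable f) : Integrable (fun z => f (-z)) :=
  (Measure.measurePreserving_neg (volume : Measure (V × V))).integrable_comp_of_integrable hf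

theorem stft_conjFun (f : V → ℂ) (x ω : V) :
    stft (gaussWin V) (conjFun f) x ω = conj (stft (gaussWin V) f x (-ω)) := by
  rw [stft_eq, stft_eq, ← integral_conj]
  congr 1; funext y
  rw [map_mul, map_mul, Complex.conj_conj, Complex.conj_conj, charFn_neg_right, conj_gaussWin,
    conjFun]

theorem stft_reflFun (f : V → ℂ) (x ω : V) :
    stft (gaussWin V) (reflFun f) x ω = stft (gaussWin V) f (-x) (-ω) := by
  rw [stft_eq, stft_eq, ← integral_neg_eq_self]
  congr 1; funext y
  rw [charFn_neg_right, charFn_neg_left, reflFun, neg_neg, ← gaussWin_neg, neg_sub,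
    sub_neg_eq_add, sub_neg_eq_add, add_comm x]

theorem measurePreserving_neg_snd :
    MeasurePreserving (fun z : V × V => (z.1, -z.2)) volume volume :=
  (MeasurePreserving.id (volume : Measure V)).prod
    (Measure.measurePreserving_neg (volume : Measure V))

theorem measurableEmbedding_neg_snd : MeasurableEmbedding (fun z : V × V => (z.1, -z.2)) :=
  ((Homeomorph.refl V).prodCongr (Homeomorph.neg V)).measurableEmbedding

theorem MemM1.conjFun {f : V → ℂ} (hf : MemM1 f) : MemM1 (conjFun f) := by
  refine ⟨Complex.continuous_conj.comp hf.1, integrable_conj hf.2.1, ?_⟩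
  simp only [stft_conjFun]
  exact integrable_conj (measurePreserving_neg_snd.integrable_comp_of_integrable hf.2.2)

theorem m1Norm_conjFun (f : V → ℂ) : m1Norm (conjFun f) = m1Norm f := by
  rw [m1Norm, m1Norm, ← measurePreserving_neg_snd.integral_comp measurableEmbedding_neg_snd]
  simp only [stft_conjFun, RCLike.norm_conj, neg_neg]

theorem MemM1.reflFun {f : V → ℂ} (hf : MemM1 f) : MemM1 (reflFun f) := by
  refine ⟨hf.1.comp continuous_neg, hf.2.1.comp_neg, ?_⟩
  simp only [stft_reflFun]
  exact integrable_comp_neg hf.2.2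

theorem m1Norm_reflFun (f : V → ℂ) : m1Norm (reflFun f) = m1Norm f := by
  rw [m1Norm, m1Norm, ← integral_neg_eq_self]
  simp only [stft_reflFun, Prod.fst_neg, Prod.snd_neg, neg_neg]

/-- The convolution of functions. -/
def convFun (a b : V → ℂ) : V → ℂ :=
  MeasureTheory.convolution a b (ContinuousLinearMap.mul ℂ ℂ) volume

/-- The STFT of a convolution is a superposition of time translates of the STFT of `b`, with
coefficients of modulus `‖a s‖`. So only the L¹ norm of `a` enters the bound in `MemM1.convolution`.
-/
theorem stft_convolution {a b : V → ℂ} (ha : Integrable a) (hb : MemM1 b) (x ω : V) :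
    stft (gaussWin V) (convFun a b) x ω =
      ∫ s, a s * (conj (charFn ω s) * stft (gaussWin V) b (x - s) ω) := by
  have e : ∀ s, conj (charFn ω s) * stft (gaussWin V) b (x - s) ω =
      ∫ y, conj (charFn ω y) * (b (y - s) * conj (gaussWin V (y - x))) := fun s => by
    rw [stft_eq, ← integral_const_mul, ← integral_sub_right_eq_self _ s]
    congr 1; funext y
    rw [sub_eq_add_neg y s, charFn_add_left, charFn_neg_left, map_mul, Complex.conj_conj,
      show y + -s - (x - s) = y - x by abel]
    linear_combination (conj (charFn ω y) * (b (y + -s) * conj (gaussWin V (y - x)))) *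
      charFn_mul_conj ω s
  have hi : Integrable (Function.uncurry fun (y s : V) => a s *
      (conj (charFn ω y) * (b (y - s) * conj (gaussWin V (y - x))))) (volume.prod volume) := by
    have h1 := (ha.mul_prod ((gaussWin V).integrable (μ := volume))).bdd_mul
      (f := fun z : V × V => conj (charFn ω (z.2 + x)) * b (z.2 + x - z.1)) (c := 1 * (m1Norm b * gaussSup V))
      (Continuous.aestronglyMeasurable ((Complex.continuous_conj.comp
        (continuous_charFn (by fun_prop) (by fun_prop))).mul (hb.1.comp (by fun_prop))))
      (.of_forall fun z => by
        rw [norm_mul, RCLike.norm_conj, norm_charFn]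
        gcongr
        exact hb.norm_le _)
    have mp : MeasurePreserving (fun p : V × V => (p.2, p.1 - x)) (volume.prod volume)
        (volume.prod volume) :=
      ((MeasurePreserving.id (volume : Measure V)).prod
        (measurePreserving_sub_right (volume : Measure V) x)).comp
        Measure.measurePreserving_swap
    refine (mp.integrable_comp_of_integrable h1).congr (.of_forall fun p => ?_)
    simp only [Function.uncurry, Function.comp, sub_add_cancel, conj_gaussWin]
    ring
  simp only [e, ← integral_const_mul]
  rw [← integral_integral_swap hi, stft_eq]
  congr 1; funext y
  rw [convFun, MeasureTheory.convolution, mul_left_comm, ← integral_mul_const]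
  congr 1; funext s
  rw [ContinuousLinearMap.mul_apply']
  ring

theorem MemM1.convolution {a b : V → ℂ} (ha : MemM1 a) (hb : MemM1 b) :
    MemM1 (convFun a b) ∧ m1Norm (convFun a b) ≤ (∫ t, ‖a t‖) * m1Norm b := by
  have hint : Integrable (convFun a b) :=
    ha.2.1.integrable_convolution (ContinuousLinearMap.mul ℂ ℂ) hb.2.1
  have hc : Continuous (convFun a b) :=
    BddAbove.continuous_convolution_right_of_integrable _
      ⟨m1Norm b * gaussSup V, by rintro _ ⟨t, rfl⟩; exact hb.norm_le t⟩ ha.2.1 hb.1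
  have hi : Integrable (fun p : V × (V × V) =>
      ‖a p.1‖ * ‖stft (gaussWin V) b (p.2.1 - p.1) p.2.2‖) (volume.prod volume) := by
    have mp : MeasurePreserving (fun p : V × (V × V) => (p.1, p.2 - (p.1, 0)))
        ((volume : Measure V).prod (volume : Measure (V × V))) (volume.prod volume) := by
      refine MeasurePreserving.skew_product (g := fun s z => z - (s, 0))
        (MeasurePreserving.id _) (by fun_prop) (.of_forall fun s => ?_)
      exact (measurePreserving_sub_right _ _).map_eq
    refine (mp.integrable_comp_of_integrable (ha.2.1.norm.mul_prod hb.2.2.norm)).congr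
      (.of_forall fun p => ?_)
    simp
  have hle : ∀ z : V × V, ‖stft (gaussWin V) (convFun a b) z.1 z.2‖ ≤
      ∫ s, ‖a s‖ * ‖stft (gaussWin V) b (z.1 - s) z.2‖ := fun z => by
    rw [stft_convolution ha.2.1 hb]
    refine (norm_integral_le_integral_norm _).trans_eq ?_
    congr 1; funext s
    rw [norm_mul, norm_mul, RCLike.norm_conj, norm_charFn, one_mul]
  have hm : Integrable (fun z : V × V => stft (gaussWin V) (convFun a b) z.1 z.2) :=
    hi.integral_prod_right.mono' (TimeFreq.continuous_stft hint (gaussWin V).continuous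
      norm_gaussWin_le).aestronglyMeasurable (.of_forall hle)
  refine ⟨⟨hc, hint, hm⟩, ?_⟩
  refine (integral_mono hm.norm hi.integral_prod_right hle).trans_eq ?_
  rw [← integral_integral_swap (f := fun s (z : V × V) =>
    ‖a s‖ * ‖stft (gaussWin V) b (z.1 - s) z.2‖) hi, m1Norm, ← integral_mul_const]
  congr 1; funext s
  rw [integral_const_mul,
    ← integral_sub_right_eq_self (fun z : V × V => ‖stft (gaussWin V) b z.1 z.2‖) ((s, 0) : V × V)]
  simp

theorem MemM1.corrM11 {g₁ g₂ : V → ℂ} (h₁ : MemM1 g₁) (h₂ : MemM1 g₂) :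
    MemM1 (corrM11 g₁ g₂) ∧
      m1Norm (TimeFreq.corrM11 g₁ g₂) ≤ gaussInt V * m1Norm g₁ * m1Norm g₂ := by
  obtain ⟨h, h'⟩ := h₂.reflFun.convolution h₁.conjFun
  refine ⟨h, h'.trans ?_⟩
  rw [m1Norm_conjFun, ← m1Norm_reflFun g₂]
  have := h₂.reflFun.integral_norm_le
  nlinarith [m1Norm_nonneg g₁]

theorem corrM11_apply (g₁ g₂ : V → ℂ) (t : V) :
    TimeFreq.corrM11 g₁ g₂ t = ∫ s, g₂ (-s) * conj (g₁ (t - s)) := rfl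

theorem integrable_corrM11 {g₁ g₂ : V → ℂ} (h₁ : MemM1 g₁) (h₂ : MemM1 g₂) (t : V) :
    Integrable (fun s => g₂ (-s) * conj (g₁ (t - s))) :=
  h₂.2.1.comp_neg.mul_bdd (c := m1Norm g₁ * gaussSup V)
    (Complex.continuous_conj.comp (h₁.1.comp (by fun_prop))).aestronglyMeasurable
    (.of_forall fun s => by rw [RCLike.norm_conj]; exact h₁.norm_le _)

theorem fourierInv_sub_apply {f g : V → ℂ} (hf : Integrable f) (hg : Integrable g) :
    (𝓕⁻ fun t => f t - g t) = fun t => 𝓕⁻ f t - 𝓕⁻ g t := by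
  funext t
  have h : ∀ {f : V → ℂ}, Integrable f → Integrable fun s => charFn t s * f s := fun hf =>
    hf.bdd_mul (c := 1) (continuous_charFn continuous_const continuous_id).aestronglyMeasurable
      (.of_forall fun s => (norm_charFn _ _).le)
  rw [fourierInv_eq_charFn, fourierInv_eq_charFn, fourierInv_eq_charFn, ← integral_sub (h hf) (h hg)]
  congr 1; funext s; ring

theorem corrM11_sub_left {f g g₂ : V → ℂ} (hf : MemM1 f) (hg : MemM1 g) (h₂ : MemM1 g₂) :
    TimeFreq.corrM11 (fun t => f t - g t) g₂ =
      fun t => TimeFreq.corrM11 f g₂ t - TimeFreq.corrM11 g g₂ t := by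
  funext t
  rw [corrM11_apply, corrM11_apply, corrM11_apply, ← integral_sub (integrable_corrM11 hf h₂ t)
    (integrable_corrM11 hg h₂ t)]
  congr 1; funext s; rw [map_sub, mul_sub]

theorem corrM11_sub_right {f g g₁ : V → ℂ} (h₁ : MemM1 g₁) (hf : MemM1 f) (hg : MemM1 g) :
    TimeFreq.corrM11 g₁ (fun t => f t - g t) =
      fun t => TimeFreq.corrM11 g₁ f t - TimeFreq.corrM11 g₁ g t := by
  funext t
  rw [corrM11_apply, corrM11_apply, corrM11_apply, ← integral_sub (integrable_corrM11 h₁ hf t)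
    (integrable_corrM11 h₁ hg t)]
  congr 1; funext s; rw [sub_mul]

end Operations

/-! ### The space M^∞ and the reduction of modulation space statements to Schwartz functions. -/

section MInf

variable {V : Type*} [NormedAddCommGroup V] [InnerProductSpace ℝ V] [FiniteDimensional ℝ V]
  [MeasurableSpace V] [BorelSpace V]

theorem MemMInf.exists_nonneg_bound {u : 𝓢'(V, ℂ)} (h : MemMInf u) :
    ∃ C : ℝ, 0 ≤ C ∧ ∀ x ω, ‖stftD (gaussWin V) u x ω‖ ≤ C := by
  obtain ⟨C, hC⟩ := h
  exact ⟨C, (norm_nonneg _).trans (hC 0 0), hC⟩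

theorem pairing_integrable {u : 𝓢'(V, ℂ)} (hu : MemMInf u) {f : V → ℂ} (hf : MemM1 f) :
    Integrable (fun z : V × V => stftD (gaussWin V) u z.1 z.2 *
      conj (stft (gaussWin V) f z.1 z.2)) := by
  obtain ⟨C, hC⟩ := hu
  exact (integrable_conj hf.2.2).bdd_mul (continuous_stftD _ u).aestronglyMeasurable
    (.of_forall fun z => hC z.1 z.2)

theorem norm_pairing_le {u : 𝓢'(V, ℂ)} {C : ℝ} (hC : ∀ x ω, ‖stftD (gaussWin V) u x ω‖ ≤ C)
    {f : V → ℂ} (hf : MemM1 f) : ‖pairing u f‖ ≤ C * m1Norm f := by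
  rw [pairing, m1Norm, ← integral_const_mul]
  refine norm_integral_le_of_norm_le (hf.2.2.norm.const_mul C) (.of_forall fun z => ?_)
  rw [norm_mul, RCLike.norm_conj]
  gcongr
  exact hC _ _

theorem pairing_sub {u : 𝓢'(V, ℂ)} (hu : MemMInf u) {f g : V → ℂ} (hf : MemM1 f) (hg : MemM1 g) :
    pairing u (fun t => f t - g t) = pairing u f - pairing u g := by
  rw [pairing, pairing, pairing, ← integral_sub (pairing_integrable hu hf)
    (pairing_integrable hu hg)]
  congr 1; funext z
  rw [hf.stft_gaussWin_sub hg, map_sub, mul_sub]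

theorem distOf_apply {f : V → ℂ} (hf : AEStronglyMeasurable f) {C : ℝ} (hC : ∀ t, ‖f t‖ ≤ C)
    (φ : 𝓢(V, ℂ)) : distOf f φ = ∫ t, f t * φ t := by
  have h : MemLp f ⊤ (volume : Measure V) := memLp_top_of_bound hf C (.of_forall hC)
  rw [distOf, dif_pos h, Lp.toTemperedDistribution_apply]
  refine integral_congr_ae ?_
  filter_upwards [h.coeFn_toLp] with t ht
  rw [ht, smul_eq_mul, mul_comm]

theorem dualBr_distOf {f : V → ℂ} (hf : AEStronglyMeasurable f) {C : ℝ} (hC : ∀ t, ‖f t‖ ≤ C)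
    (φ : 𝓢(V, ℂ)) : dualBr (distOf f) φ = ∫ t, f t * conj (φ t) :=
  distOf_apply hf hC _

theorem stftD_distOf {f : V → ℂ} (hf : AEStronglyMeasurable f) {C : ℝ} (hC : ∀ t, ‖f t‖ ≤ C)
    (g : 𝓢(V, ℂ)) (x ω : V) : stftD g (distOf f) x ω = stft g f x ω := by
  rw [stftD, dualBr_distOf hf hC, stft_eq_integral_tfShift]
  simp only [modS_translS_apply]

theorem norm_stftD_distOf_le {f : V → ℂ} (hf : AEStronglyMeasurable f) {C : ℝ}
    (hC : ∀ t, ‖f t‖ ≤ C) (x ω : V) : ‖stftD (gaussWin V) (distOf f) x ω‖ ≤ C * gaussInt V := by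
  rw [stftD_distOf hf hC]
  exact norm_stft_le' (gaussWin V).integrable hC x ω

theorem memMInf_distOf {f : V → ℂ} (hf : AEStronglyMeasurable f) {C : ℝ} (hC : ∀ t, ‖f t‖ ≤ C) :
    MemMInf (distOf f) :=
  ⟨_, norm_stftD_distOf_le hf hC⟩

/-- Moyal with the normalized Gaussian: for bounded functions the pairing is the ordinary L²
bracket. -/
theorem pairing_distOf {f : V → ℂ} (hf : AEStronglyMeasurable f) {C : ℝ} (hC : ∀ t, ‖f t‖ ≤ C)
    {g : V → ℂ} (hg : MemM1 g) : pairing (distOf f) g = ∫ t, f t * conj (g t) := by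
  have h := (moyal hf hC (gaussWin V).integrable (gaussWin V).continuous hg.2.1 hg.1
    (gaussWin V).continuous norm_gaussWin_le hg.2.2).2
  rw [integral_gaussWin_mul_self, map_one, mul_one] at h
  rw [← h, pairing]
  simp only [stftD_distOf hf hC]

/-! ### Stability of `M^∞` -/

theorem stftD_conjD (u : 𝓢'(V, ℂ)) (x ω : V) :
    stftD (gaussWin V) (conjD u) x ω = conj (stftD (gaussWin V) u x (-ω)) := by
  rw [stftD, dualBr, conjD_apply, conjS_conjS, stftD, dualBr]
  congr 2; ext t
  rw [conjS_apply, modS_translS_apply, modS_translS_apply, map_mul, charFn_neg_right,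
    Complex.conj_conj, conj_gaussWin]

theorem stftD_reflD (u : 𝓢'(V, ℂ)) (x ω : V) :
    stftD (gaussWin V) (reflD u) x ω = stftD (gaussWin V) u (-x) (-ω) := by
  rw [stftD, dualBr, stftD, dualBr]
  change u (reflS (conjS _)) = _
  congr 1; ext t
  rw [reflS_apply, conjS_apply, conjS_apply, modS_translS_apply, modS_translS_apply,
    charFn_neg_right, charFn_neg_left, ← gaussWin_neg, neg_sub, sub_neg_eq_add, sub_neg_eq_add,
    add_comm x]

theorem stftD_tfShiftD (u : 𝓢'(V, ℂ)) (x ω y η : V) :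
    stftD (gaussWin V) (tfShiftD x ω u) y η =
      charFn (ω - η) x * stftD (gaussWin V) u (y - x) (η - ω) := by
  rw [stftD, dualBr, stftD, dualBr, ← smul_eq_mul, ← map_smul]
  change u (translS (-x) (modS ω (conjS _))) = _
  congr 1; ext t
  rw [translS_apply, modS_apply, _root_.smul_apply, conjS_apply, conjS_apply, modS_translS_apply,
    modS_translS_apply, smul_eq_mul, map_mul, map_mul, ← charFn_neg_right, ← charFn_neg_right,
    sub_neg_eq_add, show t + x - y = t - (y - x) by abel, neg_sub, charFn_add_left,
    sub_eq_add_neg ω, charFn_add_right, charFn_add_right, charFn_add_left (-η)]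
  ring

theorem stftD_fourierInv (u : 𝓢'(V, ℂ)) (x ω : V) :
    stftD (gaussWin V) (𝓕⁻ u) x ω = conj (charFn ω x) * stftD (gaussWin V) u ω (-x) := by
  rw [stftD, dualBr, stftD, dualBr, ← smul_eq_mul, ← map_smul]
  change u (𝓕⁻ (conjS (modS ω (translS x (gaussWin V)))) : 𝓢(V, ℂ)) = _
  congr 1; ext t
  rw [fourierInv_apply_eq_fourier_neg, ← Complex.conj_conj ((𝓕 _ : 𝓢(V, ℂ)) _),
    conj_fourier_conjS, neg_neg, fourier_modS, fourier_translS, fourier_gaussWin, translS_apply,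
    modS_apply, _root_.smul_apply, conjS_apply, modS_translS_apply, smul_eq_mul, map_mul, map_mul,
    sub_eq_add_neg, charFn_add_left, charFn_neg_left, charFn_neg_right (x), charFn_neg_right,
    map_mul, Complex.conj_conj, Complex.conj_conj, charFn_comm x ω]
  ring

theorem MemMInf.conjD {u : 𝓢'(V, ℂ)} (hu : MemMInf u) : MemMInf (conjD u) := by
  obtain ⟨C, hC⟩ := hu
  exact ⟨C, fun x ω => by rw [stftD_conjD, RCLike.norm_conj]; exact hC _ _⟩

theorem MemMInf.reflD {u : 𝓢'(V, ℂ)} (hu : MemMInf u) : MemMInf (reflD u) := by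
  obtain ⟨C, hC⟩ := hu
  exact ⟨C, fun x ω => by rw [stftD_reflD]; exact hC _ _⟩

theorem norm_stftD_tfShiftD_le {u : 𝓢'(V, ℂ)} {C : ℝ}
    (hC : ∀ x ω, ‖stftD (gaussWin V) u x ω‖ ≤ C) (x ω y η : V) :
    ‖stftD (gaussWin V) (tfShiftD x ω u) y η‖ ≤ C := by
  rw [stftD_tfShiftD, norm_mul, norm_charFn, one_mul]; exact hC _ _

theorem MemMInf.tfShiftD {u : 𝓢'(V, ℂ)} (hu : MemMInf u) (x ω : V) : MemMInf (tfShiftD x ω u) := by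
  obtain ⟨C, hC⟩ := hu
  exact ⟨C, norm_stftD_tfShiftD_le hC x ω⟩

theorem MemMInf.fourierInv {u : 𝓢'(V, ℂ)} (hu : MemMInf u) : MemMInf (𝓕⁻ u) := by
  obtain ⟨C, hC⟩ := hu
  exact ⟨C, fun x ω => by
    rw [stftD_fourierInv, norm_mul, RCLike.norm_conj, norm_charFn, one_mul]; exact hC _ _⟩

/-! ### Convolution of `M^∞` and `M¹` -/

theorem stft_conj_comp_sub (h : V → ℂ) (x y ω : V) :
    stft (gaussWin V) (fun t => conj (h (x - t))) y ω =
      conj (charFn ω x * stft (gaussWin V) h (x - y) ω) := by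
  rw [stft_eq, stft_eq, ← integral_const_mul, ← integral_conj, ← integral_sub_left_eq_self _ _ x]
  congr 1; funext r
  rw [sub_sub_cancel, sub_eq_add_neg x r, charFn_add_left, charFn_neg_left, map_mul, map_mul,
    map_mul, map_mul, Complex.conj_conj, Complex.conj_conj, conj_gaussWin,
    ← gaussWin_neg (r - (x - y)), show -(r - (x - y)) = x + -r - y by abel]
  ring

theorem measurePreserving_sub_left_fst (x : V) :
    MeasurePreserving (fun z : V × V => (x - z.1, z.2)) volume volume :=
  (Measure.measurePreserving_sub_left (volume : Measure V) x).prod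
    (MeasurePreserving.id (volume : Measure V))

theorem measurableEmbedding_sub_left_fst (x : V) :
    MeasurableEmbedding (fun z : V × V => (x - z.1, z.2)) :=
  ((Homeomorph.subLeft x).prodCongr (Homeomorph.refl V)).measurableEmbedding

theorem MemM1.conj_comp_sub {h : V → ℂ} (hh : MemM1 h) (x : V) :
    MemM1 (fun t => conj (h (x - t))) := by
  refine ⟨Complex.continuous_conj.comp (hh.1.comp (by fun_prop)),
    integrable_conj (hh.2.1.comp_sub_left x), ?_⟩
  simp only [stft_conj_comp_sub]
  refine integrable_conj (Integrable.bdd_mul (c := 1)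
    ((measurePreserving_sub_left_fst x).integrable_comp_of_integrable hh.2.2)
    (continuous_charFn continuous_snd continuous_const).aestronglyMeasurable
    (.of_forall fun z => (norm_charFn _ _).le))

theorem m1Norm_conj_comp_sub (h : V → ℂ) (x : V) :
    m1Norm (fun t => conj (h (x - t))) = m1Norm h := by
  rw [m1Norm, m1Norm, ← (measurePreserving_sub_left_fst x).integral_comp
    (measurableEmbedding_sub_left_fst x)]
  simp only [stft_conj_comp_sub, RCLike.norm_conj, norm_mul, norm_charFn, one_mul,
    sub_sub_cancel]

theorem norm_convM_le {u : 𝓢'(V, ℂ)} {C : ℝ} (hC : ∀ x ω, ‖stftD (gaussWin V) u x ω‖ ≤ C)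
    {h : V → ℂ} (hh : MemM1 h) (x : V) : ‖convM u h x‖ ≤ C * m1Norm h := by
  rw [← m1Norm_conj_comp_sub h x]
  exact norm_pairing_le hC (hh.conj_comp_sub x)

theorem convM_sub {u : 𝓢'(V, ℂ)} (hu : MemMInf u) {f g : V → ℂ} (hf : MemM1 f) (hg : MemM1 g)
    (x : V) : convM u (fun t => f t - g t) x = convM u f x - convM u g x := by
  rw [convM, convM, convM, ← pairing_sub hu (hf.conj_comp_sub x) (hg.conj_comp_sub x)]
  simp only [map_sub]

theorem aestronglyMeasurable_convM (u : 𝓢'(V, ℂ)) {h : V → ℂ} (hh : MemM1 h) :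
    AEStronglyMeasurable (convM u h) := by
  have e : convM u h = fun x => ∫ z : V × V, stftD (gaussWin V) u z.1 z.2 *
      (charFn z.2 x * stft (gaussWin V) h (x - z.1) z.2) := by
    funext x
    rw [convM, pairing]
    simp only [stft_conj_comp_sub, Complex.conj_conj]
  rw [e]
  refine AEStronglyMeasurable.integral_prod_right' (f := fun p : V × (V × V) =>
    stftD (gaussWin V) u p.2.1 p.2.2 * (charFn p.2.2 p.1 *
      stft (gaussWin V) h (p.1 - p.2.1) p.2.2)) (Continuous.aestronglyMeasurable ?_)
  have h1 : Continuous fun p : V × (V × V) => stftD (gaussWin V) u p.2.1 p.2.2 :=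
    (continuous_stftD (gaussWin V) u).comp continuous_snd
  have h2 : Continuous fun p : V × (V × V) => stft (gaussWin V) h (p.1 - p.2.1) p.2.2 :=
    hh.continuous_stft.comp (f := fun p : V × (V × V) => (p.1 - p.2.1, p.2.2)) (by fun_prop)
  exact h1.mul ((continuous_charFn (by fun_prop) (by fun_prop)).mul h2)

theorem convM_schwartz (u : 𝓢'(V, ℂ)) (φ : 𝓢(V, ℂ)) (x : V) :
    convM u φ x = u (translS x (reflS φ)) := by
  have e : (fun t => conj (φ (x - t))) = conjS (translS x (reflS φ)) := by
    funext t; rw [conjS_apply, translS_apply, reflS_apply, neg_sub]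
  rw [convM, e, pairing_schwartz, dualBr, conjS_conjS]

theorem distOf_convM_schwartz {u : 𝓢'(V, ℂ)} (hu : MemMInf u) (φ : 𝓢(V, ℂ)) :
    distOf (convM u φ) = convD u φ := by
  obtain ⟨C, hC⟩ := hu
  ext ψ
  rw [distOf_apply (aestronglyMeasurable_convM u (memM1_schwartz φ))
    (norm_convM_le hC (memM1_schwartz φ))]
  -- Pure translations of `reflS φ` with weight `ψ`: their superposition is the convolution in the
  -- definition of `convD`, and `u` may be applied under the integral.
  obtain ⟨F, hF, h⟩ := exists_superposition (μ := (volume : Measure V)) (Z := V) (a := fun x => x)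
    (b := fun _ => 0) (c := ψ) continuous_id continuous_const ψ.continuous (fun k n => by
      have h1 : Integrable (fun x => 2 ^ (k - 1) * (‖x‖ ^ 0 * ‖ψ x‖ + ‖x‖ ^ k * ‖ψ x‖)) :=
        ((ψ.integrable_pow_mul volume 0).add (ψ.integrable_pow_mul volume k)).const_mul _
      refine h1.mono' (Continuous.aestronglyMeasurable (by fun_prop)) (.of_forall fun x => ?_)
      rw [Real.norm_of_nonneg (by positivity), norm_zero, add_zero, one_pow, mul_one]
      have := add_pow_le zero_le_one (norm_nonneg x) k
      rw [one_pow] at this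
      calc _ ≤ (2 ^ (k - 1) * (1 + ‖x‖ ^ k)) * ‖ψ x‖ := by gcongr
        _ = _ := by ring) (reflS φ)
  have e : F = SchwartzMap.convolution (ContinuousLinearMap.mul ℂ ℂ) (reflS φ) ψ := by
    ext t
    rw [hF t, convolution_mul_apply, ← integral_sub_left_eq_self _ _ t]
    congr 1; funext s
    rw [charFn_zero_right, Pi.one_apply, one_mul, sub_sub_cancel, mul_comm]
  have h0 : ∀ χ : 𝓢(V, ℂ), modS 0 χ = χ := fun χ => by
    ext t; rw [modS_apply, charFn_zero_right, Pi.one_apply, one_mul]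
  rw [e] at h
  change _ = u (SchwartzMap.convolution (ContinuousLinearMap.mul ℂ ℂ) (reflS φ) ψ)
  rw [(h u).2]
  congr 1; funext x
  rw [convM_schwartz, h0, mul_comm]

theorem fourierMultS_eq_convD (m : 𝓢'(V, ℂ)) (f : 𝓢(V, ℂ)) :
    fourierMultS m f = convD (𝓕⁻ m) f := by
  ext φ
  change m (SchwartzMap.smulLeftCLM ℂ (𝓕 f : 𝓢(V, ℂ)) (𝓕⁻ φ : 𝓢(V, ℂ))) =
    m (𝓕⁻ (SchwartzMap.convolution (ContinuousLinearMap.mul ℂ ℂ) (reflS f) φ) : 𝓢(V, ℂ))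
  congr 1; ext t
  rw [smulLeftCLM_apply, fourierInv_apply_eq_fourier_neg, fourierInv_apply_eq_fourier_neg,
    fourier_convolution_mul_apply, fourier_reflS_apply, neg_neg]

theorem fourierMultM_schwartz {m : 𝓢'(V, ℂ)} (hm : MemMInf m) (f : 𝓢(V, ℂ)) :
    fourierMultM m f = fourierMultS m f := by
  rw [fourierMultM, distOf_convM_schwartz hm.fourierInv, fourierMultS_eq_convD]

theorem MemMInf.fourierMultM {m : 𝓢'(V, ℂ)} (hm : MemMInf m) {f : V → ℂ} (hf : MemM1 f) :
    MemMInf (fourierMultM m f) := by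
  obtain ⟨C, hC⟩ := hm.fourierInv
  exact memMInf_distOf (aestronglyMeasurable_convM _ hf) (norm_convM_le hC hf)

/-! ### Reduction to Schwartz functions -/

theorem lipschitzM1_pairing {u : 𝓢'(V, ℂ)} (hu : MemMInf u) : LipschitzM1 (pairing u) := by
  obtain ⟨C, hC⟩ := id hu
  exact .of_bound (fun f g hf hg => pairing_sub hu hf hg) fun f hf => norm_pairing_le hC hf

theorem integral_convM_mul_sub {u : 𝓢'(V, ℂ)} (hu : MemMInf u) {f g : V → ℂ} (hf : MemM1 f)
    (hg : MemM1 g) {k : V → ℂ} (hk : Integrable k) :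
    ∫ t, convM u (fun t => f t - g t) t * k t =
      (∫ t, convM u f t * k t) - ∫ t, convM u g t * k t := by
  obtain ⟨C, hC⟩ := id hu
  have h : ∀ {f : V → ℂ}, MemM1 f → Integrable fun t => convM u f t * k t := fun hf =>
    hk.bdd_mul (aestronglyMeasurable_convM u hf) (.of_forall (norm_convM_le hC hf))
  rw [← integral_sub (h hf) (h hg)]
  congr 1; funext t
  rw [convM_sub hu hf hg, sub_mul]

theorem norm_integral_convM_mul_le {u : 𝓢'(V, ℂ)} {C : ℝ}
    (hC : ∀ x ω, ‖stftD (gaussWin V) u x ω‖ ≤ C) {f : V → ℂ} (hf : MemM1 f) {k : V → ℂ}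
    (hk : Integrable k) : ‖∫ t, convM u f t * k t‖ ≤ C * (∫ t, ‖k t‖) * m1Norm f := by
  rw [mul_right_comm, ← integral_const_mul]
  refine norm_integral_le_of_norm_le (hk.norm.const_mul _) (.of_forall fun t => ?_)
  rw [norm_mul]
  gcongr
  exact norm_convM_le hC hf t

theorem lipschitzM1_integral_convM_mul {u : 𝓢'(V, ℂ)} (hu : MemMInf u) {k : V → ℂ}
    (hk : Integrable k) : LipschitzM1 (fun f => ∫ t, convM u f t * k t) := by
  obtain ⟨C, hC⟩ := id hu
  exact .of_bound (fun f g hf hg => integral_convM_mul_sub hu hf hg hk)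
    fun f hf => norm_integral_convM_mul_le hC hf hk

theorem pairing_fourierMultM {D : 𝓢'(V, ℂ)} (hD : MemMInf D) {f g : V → ℂ} (hf : MemM1 f)
    (hg : MemM1 g) : pairing (fourierMultM D f) g = ∫ t, convM (𝓕⁻ D) f t * conj (g t) := by
  obtain ⟨C, hC⟩ := hD.fourierInv
  exact pairing_distOf (aestronglyMeasurable_convM _ hf) (norm_convM_le hC hf) hg

/-- The M¹ counterpart of `existsUnique_and_iff_of_form`. The form is known only on Schwartz pairs;
Lipschitz continuity in each argument carries the identity to all of M¹, while uniqueness and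
recovery of the symbol need only Schwartz test functions. -/
theorem modulation_case {P : (M1 V → MInf V) → Prop} {F : (V → ℂ) → (V → ℂ) → ℂ}
    (hP : ∀ A, P A ↔ ∀ f g : M1 V, pairing (A f).1 g.1 = F f.1 g.1) {D : 𝓢'(V, ℂ)}
    (hD : MemMInf D) (hF : ∀ f g : 𝓢(V, ℂ), F f g = D (fourierProd f g))
    (hleft : ∀ g : 𝓢(V, ℂ), LipschitzM1 fun f => F f g)
    (hright : ∀ f, MemM1 f → LipschitzM1 (F f)) (m : MInf V) :
    (∃! A, P A) ∧ ∀ A, P A → ((∀ f, (A f).1 = fourierMultM m.1 f.1) ↔ m.1 = D) := by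
  have key : ∀ f g : V → ℂ, MemM1 f → MemM1 g → pairing (fourierMultM D f) g = F f g := by
    intro f g hf hg
    -- Density is used in `g` for arbitrary `f`, then in `f` for Schwartz `g`. This order is why
    -- `hright` covers all of M¹ and `hleft` only Schwartz functions.
    refine (lipschitzM1_pairing (hD.fourierMultM hf)).eq_of_eq_on_schwartz (hright f hf)
      (fun ψ => ?_) hg
    rw [pairing_fourierMultM hD hf (memM1_schwartz ψ)]
    refine (lipschitzM1_integral_convM_mul hD.fourierInv
      (integrable_conj (memM1_schwartz ψ).2.1)).eq_of_eq_on_schwartz (hleft ψ) (fun φ => ?_) hf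
    rw [hF, ← dualBr_fourierMultS, ← fourierMultM_schwartz hD, ← pairing_schwartz,
      pairing_fourierMultM hD (memM1_schwartz φ) (memM1_schwartz ψ)]
  have hA : P fun f => ⟨fourierMultM D f.1, hD.fourierMultM f.2⟩ :=
    (hP _).2 fun f g => key f.1 g.1 f.2 g.2
  have huniq : ∀ A, P A → A = fun f => ⟨fourierMultM D f.1, hD.fourierMultM f.2⟩ := fun A h => by
    funext f
    refine Subtype.ext (eq_of_dualBr_eq fun φ => ?_)
    have h1 := (hP _).1 h f ⟨φ, memM1_schwartz φ⟩
    have h2 := (hP _).1 hA f ⟨φ, memM1_schwartz φ⟩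
    rw [← pairing_schwartz, ← pairing_schwartz]
    exact h1.trans h2.symm
  refine ⟨⟨_, hA, huniq⟩, fun A h => ?_⟩
  rw [huniq A h]
  constructor
  · intro h
    refine eq_of_forall_fourierProd fun f g => ?_
    rw [← dualBr_fourierMultS, ← dualBr_fourierMultS, ← fourierMultM_schwartz m.2,
      ← fourierMultM_schwartz hD]
    exact congrArg (fun u => dualBr u g) (h ⟨f, memM1_schwartz f⟩).symm
  · rintro rfl f; rfl

end MInf

/-! ### One window in M^∞: extension from Schwartz functions. -/

section DistributionalWindows

variable {V : Type*} [NormedAddCommGroup V] [InnerProductSpace ℝ V] [FiniteDimensional ℝ V]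
  [MeasurableSpace V] [BorelSpace V]

theorem LipschitzM1.comp_reflFun {L : (V → ℂ) → ℂ} (hL : LipschitzM1 L) :
    LipschitzM1 fun f => L (reflFun f) := by
  obtain ⟨C, hC⟩ := hL
  refine ⟨C, fun f g hf hg => (hC _ _ hf.reflFun hg.reflFun).trans_eq ?_⟩
  rw [← m1Norm_reflFun (fun t => f t - g t)]; rfl

theorem LipschitzM1.comp_conjFun {L : (V → ℂ) → ℂ} (hL : LipschitzM1 L) :
    LipschitzM1 fun f => L (conjFun f) := by
  obtain ⟨C, hC⟩ := hL
  refine ⟨C, fun f g hf hg => (hC _ _ hf.conjFun hg.conjFun).trans_eq ?_⟩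
  rw [← m1Norm_conjFun (fun t => f t - g t)]
  congr 2; funext t; exact (map_sub _ _ _).symm

theorem LipschitzM1.conj {L : (V → ℂ) → ℂ} (hL : LipschitzM1 L) :
    LipschitzM1 fun f => conj (L f) := by
  obtain ⟨C, hC⟩ := hL
  exact ⟨C, fun f g hf hg => by rw [← map_sub, RCLike.norm_conj]; exact hC f g hf hg⟩

theorem norm_stftWinM_le {u : 𝓢'(V, ℂ)} {C : ℝ} (hC : ∀ x ω, ‖stftD (gaussWin V) u x ω‖ ≤ C)
    {f : V → ℂ} (hf : MemM1 f) (x ω : V) : ‖stftWinM u f x ω‖ ≤ C * m1Norm f := by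
  rw [stftWinM, RCLike.norm_conj]
  exact norm_pairing_le (norm_stftD_tfShiftD_le hC x ω) hf

theorem stftWinM_sub {u : 𝓢'(V, ℂ)} (hu : MemMInf u) {f g : V → ℂ} (hf : MemM1 f) (hg : MemM1 g)
    (x ω : V) : stftWinM u (fun t => f t - g t) x ω = stftWinM u f x ω - stftWinM u g x ω := by
  rw [stftWinM, pairing_sub (hu.tfShiftD x ω) hf hg, map_sub]; rfl

theorem stftWinM_schwartz (u : 𝓢'(V, ℂ)) (f : 𝓢(V, ℂ)) (x ω : V) :
    stftWinM u f x ω = stftWinD u f x ω := by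
  rw [stftWinM, pairing_schwartz]; rfl

theorem aestronglyMeasurable_stftWinM (u : 𝓢'(V, ℂ)) {f : V → ℂ} (hf : MemM1 f) :
    AEStronglyMeasurable (fun w : V × V => stftWinM u f w.1 w.2) := by
  simp only [stftWinM, pairing, stftD_tfShiftD]
  refine Complex.continuous_conj.comp_aestronglyMeasurable
    (AEStronglyMeasurable.integral_prod_right' (f := fun p : (V × V) × (V × V) =>
      charFn (p.1.2 - p.2.2) p.1.1 * stftD (gaussWin V) u (p.2.1 - p.1.1) (p.2.2 - p.1.2) *
      conj (stft (gaussWin V) f p.2.1 p.2.2)) (Continuous.aestronglyMeasurable ?_))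
  have h1 : Continuous fun p : (V × V) × (V × V) =>
      stftD (gaussWin V) u (p.2.1 - p.1.1) (p.2.2 - p.1.2) :=
    (continuous_stftD (gaussWin V) u).comp
      (f := fun p : (V × V) × (V × V) => (p.2.1 - p.1.1, p.2.2 - p.1.2)) (by fun_prop)
  exact ((continuous_charFn (by fun_prop) (by fun_prop)).mul h1).mul
    (Complex.continuous_conj.comp (hf.continuous_stft.comp continuous_snd))

/-- The sesquilinear form of the STFT multiplier with symbol `1 ⊗ m`, analysis window `u` in `M^∞`
and synthesis window `g₂`. -/
def windowForm (u : 𝓢'(V, ℂ)) (m g₂ f g : V → ℂ) : ℂ :=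
  ∫ z : V × V, m z.2 * stftWinM u f z.1 z.2 * conj (stft g₂ g z.1 z.2)

variable {u : 𝓢'(V, ℂ)} {m g₂ f g m' g₂' f' g' : V → ℂ}

/-- Symbol and distributional STFT are bounded, and the remaining STFT is integrable. The bound is
linear in each M¹ norm separately, so it yields Lipschitz continuity in every variable. -/
theorem integrable_windowForm_and_norm_le {C : ℝ}
    (hC : ∀ x ω, ‖stftD (gaussWin V) u x ω‖ ≤ C) (hm : MemM1 m) (hg₂ : MemM1 g₂)
    (hf : MemM1 f) (hg : MemM1 g) :
    Integrable (fun z : V × V => m z.2 * stftWinM u f z.1 z.2 * conj (stft g₂ g z.1 z.2)) ∧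
    ‖windowForm u m g₂ f g‖ ≤
      (m1Norm m * gaussSup V) * (C * m1Norm f) * (m1Norm g * m1Norm g₂) := by
  have hC0 : 0 ≤ C := (norm_nonneg _).trans (hC 0 0)
  have hn : ∀ z : V × V, ‖m z.2 * stftWinM u f z.1 z.2‖ ≤
      (m1Norm m * gaussSup V) * (C * m1Norm f) := fun z => by
    rw [norm_mul]
    have := m1Norm_nonneg m
    have := gaussSup_nonneg V
    gcongr
    · exact hm.norm_le _
    · exact norm_stftWinM_le hC hf _ _
  obtain ⟨h1, h2⟩ := hg.integrable_stft hg₂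
  have hp : 0 ≤ (m1Norm m * gaussSup V) * (C * m1Norm f) := (norm_nonneg _).trans (hn 0)
  refine ⟨(integrable_conj h1).bdd_mul ((hm.1.comp continuous_snd).aestronglyMeasurable.mul
    (aestronglyMeasurable_stftWinM u hf)) (.of_forall hn), ?_⟩
  refine le_trans ?_ (mul_le_mul_of_nonneg_left h2 hp)
  rw [windowForm, ← integral_const_mul]
  refine norm_integral_le_of_norm_le (h1.norm.const_mul _) (.of_forall fun z => ?_)
  rw [norm_mul, RCLike.norm_conj]
  gcongr
  exact hn z

theorem integrable_windowForm (hu : MemMInf u) (hm : MemM1 m) (hg₂ : MemM1 g₂)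
    (hf : MemM1 f) (hg : MemM1 g) :
    Integrable (fun z : V × V => m z.2 * stftWinM u f z.1 z.2 * conj (stft g₂ g z.1 z.2)) := by
  obtain ⟨C, hC⟩ := hu
  exact (integrable_windowForm_and_norm_le hC hm hg₂ hf hg).1

theorem lipschitzM1_windowForm_symbol (hu : MemMInf u) (hg₂ : MemM1 g₂) (hf : MemM1 f)
    (hg : MemM1 g) : LipschitzM1 fun m => windowForm u m g₂ f g := by
  obtain ⟨C, hC⟩ := id hu
  refine .of_bound (C := gaussSup V * (C * m1Norm f) * (m1Norm g * m1Norm g₂))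
    (fun m m' hm hm' => ?_) fun m hm => ?_
  · rw [windowForm, windowForm, windowForm, ← integral_sub
      (integrable_windowForm hu hm hg₂ hf hg) (integrable_windowForm hu hm' hg₂ hf hg)]
    congr 1; funext z; ring
  · exact (integrable_windowForm_and_norm_le hC hm hg₂ hf hg).2.trans_eq (by ring)

theorem lipschitzM1_windowForm_window (hu : MemMInf u) (hm : MemM1 m) (hf : MemM1 f)
    (hg : MemM1 g) : LipschitzM1 fun g₂ => windowForm u m g₂ f g := by
  obtain ⟨C, hC⟩ := id hu
  refine .of_bound (C := (m1Norm m * gaussSup V) * (C * m1Norm f) * m1Norm g)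
    (fun g₂ g₂' h h' => ?_) fun g₂ h => ?_
  · rw [windowForm, windowForm, windowForm, ← integral_sub
      (integrable_windowForm hu hm h hf hg) (integrable_windowForm hu hm h' hf hg)]
    congr 1; funext z
    rw [stft_sub_window hg.2.1 h.1 h'.1 h.norm_le h'.norm_le, map_sub, mul_sub]
  · exact (integrable_windowForm_and_norm_le hC hm h hf hg).2.trans_eq (by ring)

theorem lipschitzM1_windowForm_left (hu : MemMInf u) (hm : MemM1 m) (hg₂ : MemM1 g₂)
    (hg : MemM1 g) : LipschitzM1 fun f => windowForm u m g₂ f g := by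
  obtain ⟨C, hC⟩ := id hu
  refine .of_bound (C := (m1Norm m * gaussSup V) * C * (m1Norm g * m1Norm g₂))
    (fun f f' h h' => ?_) fun f h => ?_
  · rw [windowForm, windowForm, windowForm, ← integral_sub
      (integrable_windowForm hu hm hg₂ h hg) (integrable_windowForm hu hm hg₂ h' hg)]
    congr 1; funext z
    rw [stftWinM_sub hu h h']; ring
  · exact (integrable_windowForm_and_norm_le hC hm hg₂ h hg).2.trans_eq (by ring)

theorem lipschitzM1_windowForm_right (hu : MemMInf u) (hm : MemM1 m) (hg₂ : MemM1 g₂)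
    (hf : MemM1 f) : LipschitzM1 fun g => windowForm u m g₂ f g := by
  obtain ⟨C, hC⟩ := id hu
  refine .of_bound (C := (m1Norm m * gaussSup V) * (C * m1Norm f) * m1Norm g₂)
    (fun g g' h h' => ?_) fun g h => ?_
  · rw [windowForm, windowForm, windowForm, ← integral_sub
      (integrable_windowForm hu hm hg₂ hf h) (integrable_windowForm hu hm hg₂ hf h')]
    congr 1; funext z
    rw [stft_sub h.2.1 h'.2.1 hg₂.1 hg₂.norm_le, map_sub, mul_sub]
  · exact (integrable_windowForm_and_norm_le hC hm hg₂ hf h).2.trans_eq (by ring)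

theorem memMInf_distOf_convM (hu : MemMInf u) (hf : MemM1 f) : MemMInf (distOf (convM u f)) := by
  obtain ⟨C, hC⟩ := hu
  exact memMInf_distOf (aestronglyMeasurable_convM u hf) (norm_convM_le hC hf)

theorem distOf_convM_apply (hu : MemMInf u) (hf : MemM1 f) (ψ : 𝓢(V, ℂ)) :
    distOf (convM u f) ψ = ∫ t, convM u f t * ψ t := by
  obtain ⟨C, hC⟩ := hu
  exact distOf_apply (aestronglyMeasurable_convM u hf) (norm_convM_le hC hf) ψ

/-- Identities between functionals of a symbol `m` and a window `g` which are continuous on `M¹`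
extend from Schwartz functions. -/
theorem eq_distOf_convM_apply_of_schwartz {v : 𝓢'(V, ℂ)} (hv : MemMInf v) {T : (V → ℂ) → V → ℂ}
    (hT : ∀ L : (V → ℂ) → ℂ, LipschitzM1 L → LipschitzM1 fun g => L (T g))
    (hTM : ∀ g, MemM1 g → MemM1 (T g)) {B : (V → ℂ) → (V → ℂ) → ℂ}
    (hBm : ∀ g, MemM1 g → LipschitzM1 fun m => B m g)
    (hBg : ∀ m, MemM1 m → LipschitzM1 (B m)) (ψ : 𝓢(V, ℂ))
    (h : ∀ m g : 𝓢(V, ℂ), B m g = convD (𝓕⁻ (distOf (convM v (T g)))) m ψ)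
    (hm : MemM1 m) (hg : MemM1 g) :
    B m g = distOf (convM (𝓕⁻ (distOf (convM v (T g)))) m) ψ := by
  have hw := (memMInf_distOf_convM hv (hTM g hg)).fourierInv
  rw [distOf_convM_apply hw hm]
  refine (hBm g hg).eq_of_eq_on_schwartz
    (lipschitzM1_integral_convM_mul hw ψ.integrable) (fun φ => ?_) hm
  rw [← distOf_convM_apply hw (memM1_schwartz φ), distOf_convM_schwartz hw]
  -- Once the symbol is a Schwartz function `φ`, both 𝓕⁻¹ and the convolution with `φ` move to the
  -- test function. The right side is then an integral of `convM v (T g)` against a fixed function,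
  -- which is Lipschitz in `g`.
  set χ : 𝓢(V, ℂ) := 𝓕⁻ (SchwartzMap.convolution (ContinuousLinearMap.mul ℂ ℂ) (reflS φ) ψ)
    with hχ
  have e : ∀ g : V → ℂ, MemM1 g → convD (𝓕⁻ (distOf (convM v (T g)))) φ ψ =
      ∫ t, convM v (T g) t * χ t := fun g hg => distOf_convM_apply hv (hTM g hg) χ
  rw [e g hg]
  refine (hBg φ (memM1_schwartz φ)).eq_of_eq_on_schwartz
    (hT _ (lipschitzM1_integral_convM_mul hv χ.integrable)) (fun γ => ?_) hg
  rw [h φ γ, e γ (memM1_schwartz γ)]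

theorem modulation_case_left (m m₂ : M1 V) (g₁ : MInf V) (g₂ : M1 V) :
    (∃! A, IsSTFTMultFunM (fun z => m.1 z.2) (stftWinM g₁.1) (stft g₂.1) A) ∧
      ∀ A, IsSTFTMultFunM (fun z => m.1 z.2) (stftWinM g₁.1) (stft g₂.1) A →
        ((∀ f, (A f).1 = fourierMultM (distOf m₂.1) f.1) ↔
          distOf m₂.1 = distOf (convM (𝓕⁻ (distOf (corrMInf1 g₁.1 g₂.1))) m.1)) := by
  refine modulation_case (F := windowForm g₁.1 m.1 g₂.1)
    (fun A => forall₂_congr fun f g =>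
      and_iff_right (integrable_windowForm g₁.2 m.2 g₂.2 f.2 g.2))
    (memMInf_distOf_convM (memMInf_distOf_convM g₁.2.conjD g₂.2.reflFun).fourierInv m.2)
    (fun f g => ?_)
    (fun g => lipschitzM1_windowForm_left g₁.2 m.2 g₂.2 (memM1_schwartz g))
    (fun f hf => lipschitzM1_windowForm_right g₁.2 m.2 g₂.2 hf)
    ⟨distOf m₂.1, memMInf_distOf m₂.2.aestronglyMeasurable m₂.2.norm_le⟩
  refine eq_distOf_convM_apply_of_schwartz (B := fun m g₂ => windowForm g₁.1 m g₂ f g)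
    g₁.2.conjD (T := reflFun) (fun L hL => hL.comp_reflFun) (fun g hg => hg.reflFun)
    (fun g₂ h => lipschitzM1_windowForm_symbol g₁.2 h (memM1_schwartz f) (memM1_schwartz g))
    (fun m h => lipschitzM1_windowForm_window g₁.2 h (memM1_schwartz f) (memM1_schwartz g))
    (fourierProd f g) (fun μ γ => ?_) m.2 g₂.2
  rw [show reflFun ⇑γ = reflS γ from rfl, distOf_convM_schwartz g₁.2.conjD]
  simp only [windowForm, stftWinM_schwartz]
  exact (integral_stftWinD_left μ γ f g g₁.1).2

/-- Conjugation turns the form into `windowForm` with window `g₂`, conjugated symbol, and `f`, `g`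
exchanged, so the estimates for a distributional analysis window apply. -/
theorem modulation_case_right (m m₂ : M1 V) (g₁ : M1 V) (g₂ : MInf V) :
    (∃! A, IsSTFTMultFunM (fun z => m.1 z.2) (stft g₁.1) (stftWinM g₂.1) A) ∧
      ∀ A, IsSTFTMultFunM (fun z => m.1 z.2) (stft g₁.1) (stftWinM g₂.1) A →
        ((∀ f, (A f).1 = fourierMultM (distOf m₂.1) f.1) ↔
          distOf m₂.1 = distOf (convM (𝓕⁻ (distOf (corrM1Inf g₁.1 g₂.1))) m.1)) := by
  have e : ∀ (m g₁ f g : V → ℂ) (z : V × V), m z.2 * stft g₁ f z.1 z.2 *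
      conj (stftWinM g₂.1 g z.1 z.2) = conj (conjFun m z.2 * stftWinM g₂.1 g z.1 z.2 *
        conj (stft g₁ f z.1 z.2)) := fun m g₁ f g z => by
    simp only [map_mul, Complex.conj_conj, conjFun]; ring
  have e' : ∀ m g₁ f g : V → ℂ, ∫ z : V × V, m z.2 * stft g₁ f z.1 z.2 *
      conj (stftWinM g₂.1 g z.1 z.2) = conj (windowForm g₂.1 (conjFun m) g₁ g f) :=
    fun m g₁ f g => by simp only [e, integral_conj, windowForm]
  refine modulation_case (F := fun f g => conj (windowForm g₂.1 (conjFun m.1) g₁.1 g f))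
    (fun A => forall₂_congr fun f g => ?_)
    (memMInf_distOf_convM (memMInf_distOf_convM g₂.2.reflD g₁.2.conjFun).fourierInv m.2)
    (fun f g => ?_)
    (fun g => (lipschitzM1_windowForm_right g₂.2 m.2.conjFun g₁.2 (memM1_schwartz g)).conj)
    (fun f hf => (lipschitzM1_windowForm_left g₂.2 m.2.conjFun g₁.2 hf).conj)
    ⟨distOf m₂.1, memMInf_distOf m₂.2.aestronglyMeasurable m₂.2.norm_le⟩
  · rw [← e', and_iff_right]
    simp only [e]
    exact integrable_conj (integrable_windowForm g₂.2 m.2.conjFun g₁.2 g.2 f.2)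
  refine eq_distOf_convM_apply_of_schwartz
    (B := fun m g₁ => conj (windowForm g₂.1 (conjFun m) g₁ g f))
    g₂.2.reflD (T := conjFun) (fun L hL => hL.comp_conjFun) (fun g hg => hg.conjFun)
    (fun g₁ h => (LipschitzM1.comp_conjFun (lipschitzM1_windowForm_symbol g₂.2 h
      (memM1_schwartz g) (memM1_schwartz f))).conj)
    (fun m h => (lipschitzM1_windowForm_window g₂.2 h.conjFun (memM1_schwartz g)
      (memM1_schwartz f)).conj)
    (fourierProd f g) (fun μ γ => ?_) m.2 g₁.2
  rw [show (conjFun ⇑γ : V → ℂ) = conjS γ from rfl, distOf_convM_schwartz g₂.2.reflD]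
  rw [← e']
  simp only [stftWinM_schwartz]
  exact (integral_stftWinD_right μ γ f g g₂.1).2

end DistributionalWindows

/-! ### Changing the window and multiplying STFTs. -/

section WindowChange

variable {V : Type*} [NormedAddCommGroup V] [InnerProductSpace ℝ V] [FiniteDimensional ℝ V]
  [MeasurableSpace V] [BorelSpace V]

/-- Membership in `M¹` can be tested with any nonzero Schwartz window. -/
theorem memM1_of_integrable_stft_window {F : V → ℂ} (hF : Continuous F) (hFi : Integrable F)
    {C : ℝ} (hC : ∀ t, ‖F t‖ ≤ C) (G : 𝓢(V, ℂ)) (hG : ∫ t, G t * conj (G t) ≠ 0)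
    (h : Integrable (fun z : V × V => stft G F z.1 z.2)) :
    MemM1 F ∧ m1Norm F ≤ ‖∫ t, G t * conj (G t)‖⁻¹ * (∫ z : V × V, ‖stft G F z.1 z.2‖) *
      ∫ z : V × V, ‖stft G (gaussWin V) z.1 z.2‖ := by
  have hγ := integrable_stft_schwartz G (gaussWin V)
  -- Moyal with window `G` on both sides: testing `F` against a shifted Gaussian costs the inverse
  -- squared L² norm of `G`.
  have hle : ∀ w : V × V, ‖stft (gaussWin V) F w.1 w.2‖ ≤ ‖∫ t, G t * conj (G t)‖⁻¹ *
      ∫ z : V × V, ‖stft G F z.1 z.2‖ * ‖stft G (gaussWin V) (z - w).1 (z - w).2‖ := fun w => by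
    set k : 𝓢(V, ℂ) := modS w.2 (translS w.1 (gaussWin V)) with hk
    have hm := (moyal (f := F) (g := G) (h := G) (k := k) hF.aestronglyMeasurable hC G.integrable
      G.continuous k.integrable k.continuous G.continuous (norm_schwartz_le G)
      (integrable_stft_schwartz _ _)).2
    have hkf : (k : V → ℂ) = fun t => charFn w.2 t * gaussWin V (t - w.1) :=
      funext fun t => modS_translS_apply _ _ _ _
    rw [hkf, ← stft_eq_integral_tfShift] at hm
    rw [← div_eq_inv_mul, le_div_iff₀ (norm_pos_iff.2 hG), ← RCLike.norm_conj (∫ t, _),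
      ← norm_mul, ← hm]
    refine (norm_integral_le_integral_norm _).trans_eq ?_
    congr 1; funext z
    rw [norm_mul, RCLike.norm_conj, norm_stft_shift]; rfl
  obtain ⟨h1, h2⟩ := integral_mul_comp_sub h.norm hγ.norm
  have hi : Integrable (fun z : V × V => stft (gaussWin V) F z.1 z.2) :=
    (h1.const_mul _).mono' (TimeFreq.continuous_stft hFi (gaussWin V).continuous
      norm_gaussWin_le).aestronglyMeasurable (.of_forall hle)
  refine ⟨⟨hF, hFi, hi⟩, (integral_mono hi.norm (h1.const_mul _) hle).trans_eq ?_⟩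
  rw [integral_const_mul, h2, mul_assoc]

/-- With the product window, the windowed product splits into the windowed `q` times the conjugate
of the windowed `p`. Parseval makes its Fourier transform a correlation of the two STFT slices in
frequency. -/
theorem stft_mul_eq_integral {p q Γ : V → ℂ} (hp : Continuous p) (hpi : Integrable p)
    (hqi : Integrable q) (hΓ : Continuous Γ) {C : ℝ} (hC : ∀ t, ‖Γ t‖ ≤ C)
    (z ζ : V) (hi : Integrable (stft Γ p z)) :
    stft (fun w => conj (Γ w) * Γ w) (fun w => conj (p w) * q w) z ζ =
      ∫ η, stft Γ q z (η + ζ) * conj (stft Γ p z η) := by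
  have hpz : Continuous fun y => p y * conj (Γ (y - z)) :=
    hp.mul (Complex.continuous_conj.comp (hΓ.comp (by fun_prop)))
  have h := integral_fourier_mul_conj_fourier
    (integrable_stft_integrand hqi hΓ hC z ζ) (integrable_mul_conj_comp_sub' hpi hC hΓ z) hpz hi
  rw [stft_eq]
  refine Eq.trans ?_ (h.symm.trans ?_)
  · congr 1; funext y
    simp only [map_mul, Complex.conj_conj]; ring
  · congr 1; funext η
    rw [stft_eq, fourier_eq_charFn]
    congr 2
    funext y
    rw [charFn_add_right, map_mul]; ring

/-- In frequency the correlation obeys the L¹ convolution inequality for each `z`. Therefore a bound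
for the slices of `p` that is uniform in `z`, together with integrability over `z` for `q`, is
enough. -/
theorem integrable_stft_mul {p q Γ : V → ℂ} (hp : Continuous p) (hpi : Integrable p)
    {Cp : ℝ} (hCp : ∀ t, ‖p t‖ ≤ Cp)
    (hqi : Integrable q) (hΓ : Continuous Γ) {C : ℝ} (hC : ∀ t, ‖Γ t‖ ≤ C)
    (hi : ∀ z, Integrable (stft Γ p z)) {S : ℝ} (hS : ∀ z, ∫ ζ, ‖stft Γ p z ζ‖ ≤ S)
    (hi' : ∀ z, Integrable (stft Γ q z)) (hqS : Integrable fun z => ∫ ζ, ‖stft Γ q z ζ‖) :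
    Integrable (fun z : V × V => stft (fun w => conj (Γ w) * Γ w) (fun w => conj (p w) * q w)
        z.1 z.2) ∧
    ∫ z : V × V, ‖stft (fun w => conj (Γ w) * Γ w) (fun w => conj (p w) * q w) z.1 z.2‖ ≤
      S * ∫ z, ∫ ζ, ‖stft Γ q z ζ‖ := by
  have hcont : Continuous (fun z : V × V => stft (fun w => conj (Γ w) * Γ w)
      (fun w => conj (p w) * q w) z.1 z.2) :=
    continuous_stft (C := C * C) (hqi.bdd_mul (Complex.continuous_conj.comp hp).aestronglyMeasurable
      (.of_forall fun t => (RCLike.norm_conj _).trans_le (hCp t)))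
      ((Complex.continuous_conj.comp hΓ).mul hΓ) (fun t => by
        have := (norm_nonneg _).trans (hC t)
        change ‖conj (Γ t) * Γ t‖ ≤ _
        rw [norm_mul, RCLike.norm_conj]; gcongr <;> exact hC t)
  have hbound : ∀ z, Integrable (stft (fun w => conj (Γ w) * Γ w)
      (fun w => conj (p w) * q w) z) ∧ ∫ ζ, ‖stft (fun w => conj (Γ w) * Γ w)
        (fun w => conj (p w) * q w) z ζ‖ ≤ S * ∫ ζ, ‖stft Γ q z ζ‖ := fun z => by
    obtain ⟨h1, h2⟩ := integral_mul_comp_sub (hi z).norm (hi' z).norm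
    have h1' := h1.comp_neg
    simp only [sub_neg_eq_add] at h1'
    have hle : ∀ ζ, ‖stft (fun w => conj (Γ w) * Γ w) (fun w => conj (p w) * q w) z ζ‖ ≤
        ∫ η, ‖stft Γ p z η‖ * ‖stft Γ q z (η + ζ)‖ := fun ζ => by
      rw [stft_mul_eq_integral hp hpi hqi hΓ hC z ζ (hi z)]
      refine (norm_integral_le_integral_norm _).trans_eq ?_
      congr 1; funext η
      rw [norm_mul, RCLike.norm_conj, mul_comm]
    have hcont' := hcont.comp (f := fun ζ => (z, ζ)) (by fun_prop)
    have hint := h1'.mono' hcont'.aestronglyMeasurable (.of_forall hle)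
    refine ⟨hint, (integral_mono hint.norm h1' hle).trans ?_⟩
    rw [← integral_neg_eq_self]
    simp only [← sub_eq_add_neg]
    rw [h2]
    gcongr
    exact hS z
  have hint : Integrable (fun z : V × V => stft (fun w => conj (Γ w) * Γ w)
      (fun w => conj (p w) * q w) z.1 z.2) (volume.prod volume) := by
    rw [integrable_prod_iff hcont.aestronglyMeasurable]
    refine ⟨.of_forall fun z => (hbound z).1, (hqS.const_mul S).mono'
      hcont.aestronglyMeasurable.norm.integral_prod_right' (.of_forall fun z => ?_)⟩
    rw [Real.norm_of_nonneg (integral_nonneg fun _ => norm_nonneg _)]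
    exact (hbound z).2
  refine ⟨hint, ?_⟩
  rw [Measure.volume_eq_prod, integral_prod _ hint.norm, ← integral_const_mul]
  exact integral_mono hint.norm.integral_prod_left (hqS.const_mul S) fun z => (hbound z).2

end WindowChange

/-! ### M¹ bounds for products of STFTs on the time-frequency plane. -/

section PlaneSTFT

variable {V : Type*} [NormedAddCommGroup V] [InnerProductSpace ℝ V] [FiniteDimensional ℝ V]
  [MeasurableSpace V] [BorelSpace V]

theorem stft_shift_window (g f : V → ℂ) (u₁ u₂ x ω : V) :
    stft (fun y => charFn u₂ y * g (y - u₁)) f x ω =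
      charFn u₂ x * stft g f (x + u₁) (ω + u₂) := by
  rw [stft_eq, stft_eq, ← integral_const_mul]
  congr 1; funext y
  rw [sub_eq_add_neg y x, charFn_add_left, charFn_neg_left, charFn_add_right, map_mul, map_mul,
    map_mul, Complex.conj_conj, show y + -x - u₁ = y - (x + u₁) by abel]
  ring

/-- The STFT with window `V_γ γ` of an STFT. -/
theorem norm_stft_stft {f g : V → ℂ} (hf : MemM1 f) (hg : MemM1 g) (z ζ : Plane V) :
    ‖stft (stftS (gaussWin V) (gaussWin V)) (fun w : Plane V => stft g f w.fst w.snd) z ζ‖ =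
      ‖stft (gaussWin V) f (-ζ.snd) (ζ.fst + z.snd)‖ *
        ‖stft (gaussWin V) g (-ζ.snd - z.fst) ζ.fst‖ := by
  set h : 𝓢(V, ℂ) := modS ζ.fst (translS (-ζ.snd - z.fst) (gaussWin V)) with hh
  set k : 𝓢(V, ℂ) := modS (ζ.fst + z.snd) (translS (-ζ.snd) (gaussWin V)) with hk
  have hhf : (h : V → ℂ) = fun t => charFn ζ.fst t * gaussWin V (t - (-ζ.snd - z.fst)) :=
    funext fun t => modS_translS_apply _ _ _ _
  have hkf : (k : V → ℂ) = fun t => charFn (ζ.fst + z.snd) t * gaussWin V (t - -ζ.snd) :=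
    funext fun t => modS_translS_apply _ _ _ _
  have hm := (moyal (f := f) (g := g) (h := h) (k := k) hf.aestronglyMeasurable hf.norm_le
    hg.2.1 hg.1 k.integrable k.continuous h.continuous (norm_schwartz_le h)
    (integrable_stft_schwartz _ _)).2
  -- A time-frequency shift on the plane of the Gaussian's STFT is, up to a phase, the STFT of one
  -- shifted Gaussian with respect to another. Moyal therefore splits the modulus into two factors.
  have key : ∀ x ω : V, charFn ζ (WithLp.toLp 2 (x, ω)) *
      stftS (gaussWin V) (gaussWin V) (WithLp.toLp 2 (x, ω) - z) =
      charFn z.snd ζ.snd * stft h k x ω := fun x ω => by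
    have e1 : (WithLp.toLp 2 (x, ω) - z : Plane V) = WithLp.toLp 2 (x - z.fst, ω - z.snd) := rfl
    have e2 : charFn ζ (WithLp.toLp 2 (x, ω)) = charFn ζ.fst x * charFn ζ.snd ω :=
      charFn_plane ζ.fst ζ.snd (WithLp.toLp 2 (x, ω))
    rw [e1, stftS_apply, e2, hhf, hkf, stft_shift_window, stft_shift, charFn_neg_left,
      Complex.conj_conj, show x + (-ζ.snd - z.fst) - -ζ.snd = x - z.fst by abel,
      show ω + ζ.fst - (ζ.fst + z.snd) = ω - z.snd by abel, sub_eq_add_neg ω z.snd,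
      charFn_add_right, charFn_neg_right, charFn_comm ω]
    linear_combination (-(charFn ζ.fst x * charFn ζ.snd ω *
      stft (gaussWin V) (gaussWin V) (x - z.fst) (ω + -z.snd))) * charFn_mul_conj z.snd ζ.snd
  rw [stft_eq_integral_tfShift, integral_plane]
  have e : ∀ y : V × V, stft g f (WithLp.toLp 2 y : Plane V).fst (WithLp.toLp 2 y : Plane V).snd *
      conj (charFn ζ (WithLp.toLp 2 y) * stftS (gaussWin V) (gaussWin V) (WithLp.toLp 2 y - z)) =
      conj (charFn z.snd ζ.snd) * (stft g f y.1 y.2 * conj (stft h k y.1 y.2)) := fun y => by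
    rw [key, map_mul]
    change stft g f y.1 y.2 * _ = _
    ring
  simp only [e]
  rw [integral_const_mul, hm, norm_mul, RCLike.norm_conj, norm_charFn, one_mul, norm_mul,
    RCLike.norm_conj, hhf, hkf, ← stft_eq_integral_tfShift, ← stft_eq_integral_tfShift]

theorem stft_bound {f g : V → ℂ} (hf : MemM1 f) (hg : MemM1 g) (x ω : V) :
    ‖stft g f x ω‖ ≤ (m1Norm f * gaussInt V) * (m1Norm g * gaussSup V) :=
  (norm_stft_le hf.2.1 hg.norm_le x ω).trans (by
    have := hf.integral_norm_le
    have := m1Norm_nonneg g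
    have := gaussSup_nonneg V
    gcongr)

theorem continuous_stft_plane {f g : V → ℂ} (hf : MemM1 f) (hg : MemM1 g) :
    Continuous fun w : Plane V => stft g f w.fst w.snd :=
  (continuous_stft hf.2.1 hg.1 hg.norm_le).comp (f := fun w : Plane V => (w.fst, w.snd))
    (by fun_prop)

theorem integrable_stft_plane {f g : V → ℂ} (hf : MemM1 f) (hg : MemM1 g) :
    Integrable fun w : Plane V => stft g f w.fst w.snd :=
  integrable_plane.2 (hf.integrable_stft hg).1

theorem partial_integral_stft_stft {f g : V → ℂ} (hf : MemM1 f) (hg : MemM1 g) :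
    (∀ z : Plane V, Integrable (stft (stftS (gaussWin V) (gaussWin V))
      (fun w : Plane V => stft g f w.fst w.snd) z)) ∧
    ∀ z : Plane V, ∫ ζ, ‖stft (stftS (gaussWin V) (gaussWin V))
      (fun w : Plane V => stft g f w.fst w.snd) z ζ‖ =
        ∫ p : V × V, ‖stft (gaussWin V) f p.1 p.2‖ *
          ‖stft (gaussWin V) g (p.1 - z.fst) (p.2 - z.snd)‖ := by
  have hp : ∀ z : Plane V, Integrable (fun p : V × V => ‖stft (gaussWin V) f p.1 p.2‖ *
      ‖stft (gaussWin V) g (p.1 - z.fst) (p.2 - z.snd)‖) := fun z =>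
    (Integrable.comp_sub_right hg.2.2.norm (z.fst, z.snd)).bdd_mul
      (c := m1Norm f * gaussInt V * gaussSup V)
      hf.continuous_stft.norm.aestronglyMeasurable (.of_forall fun p => by
        rw [norm_norm]
        exact (norm_stft_le hf.2.1 norm_gaussWin_le _ _).trans (by
          have := hf.integral_norm_le
          have := gaussSup_nonneg V
          gcongr))
  -- The substitution `(ζ₁, ζ₂) ↦ (-ζ₂, ζ₁ + z.snd)` converts the arguments in `norm_stft_stft` into
  -- `p` and `p - z`.
  have mp : ∀ z : Plane V, MeasurePreserving (fun p : V × V => (-p.2, p.1 + z.snd)) volume volume :=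
    fun z => ((Measure.measurePreserving_neg (volume : Measure V)).prod
      (measurePreserving_add_right (volume : Measure V) z.snd)).comp
      (Measure.measurePreserving_swap (μ := (volume : Measure V)) (ν := (volume : Measure V)))
  have me : ∀ z : Plane V, MeasurableEmbedding (fun p : V × V => (-p.2, p.1 + z.snd)) := fun z =>
    ((Homeomorph.prodComm V V).trans
      ((Homeomorph.neg V).prodCongr (Homeomorph.addRight z.snd))).measurableEmbedding
  refine ⟨fun z => ?_, fun z => ?_⟩
  · have hc : Continuous (stft (stftS (gaussWin V) (gaussWin V))
        (fun w : Plane V => stft g f w.fst w.snd) z) :=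
      (continuous_stft (integrable_stft_plane hf hg) (stftS (gaussWin V) (gaussWin V)).continuous
        (norm_schwartz_le _)).comp (f := fun ζ => (z, ζ)) (by fun_prop)
    refine (integrable_norm_iff hc.aestronglyMeasurable).1 (integrable_plane.2 ?_)
    refine ((mp z).integrable_comp_of_integrable (hp z)).congr (.of_forall fun p => ?_)
    simp only [Function.comp]
    rw [norm_stft_stft hf hg]
    simp
  · rw [integral_plane]
    refine Eq.trans ?_ ((mp z).integral_comp (me z) fun p => ‖stft (gaussWin V) f p.1 p.2‖ *
      ‖stft (gaussWin V) g (p.1 - z.fst) (p.2 - z.snd)‖)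
    congr 1; funext p
    rw [norm_stft_stft hf hg]
    simp

variable (V) in
/-- The window `|V_γ γ|²` on the time-frequency plane. -/
def ambiguityWin : 𝓢(Plane V, ℂ) :=
  SchwartzMap.smulLeftCLM ℂ (conjS (stftS (gaussWin V) (gaussWin V)))
    (stftS (gaussWin V) (gaussWin V))

theorem ambiguityWin_apply (w : Plane V) : ambiguityWin V w =
    conj (stftS (gaussWin V) (gaussWin V) w) * stftS (gaussWin V) (gaussWin V) w := by
  rw [ambiguityWin, smulLeftCLM_apply, conjS_apply]

theorem ambiguityWin_zero : ambiguityWin V 0 = 1 := by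
  have h : stftS (gaussWin V) (gaussWin V) (0 : Plane V) = 1 := by
    refine (stftS_apply (gaussWin V) (gaussWin V) 0 0).trans ?_
    rw [stft_eq_integral_tfShift, ← integral_gaussWin_mul_self (V := V)]
    congr 1; funext t
    rw [charFn_zero_right, Pi.one_apply, one_mul, sub_zero]
  rw [ambiguityWin_apply, h, map_one, mul_one]

/-- The window is continuous and equals 1 at the origin, so its squared modulus has positive
integral; this makes it admissible in `memM1_of_integrable_stft_window`. -/
theorem integral_ambiguityWin_ne_zero :
    ∫ w, ambiguityWin V w * conj (ambiguityWin V w) ≠ 0 := by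
  have e : ∀ w, ambiguityWin V w * conj (ambiguityWin V w) =
      ((‖ambiguityWin V w‖ ^ 2 : ℝ) : ℂ) := fun w => by
    rw [Complex.mul_conj, Complex.normSq_eq_norm_sq]
  simp only [e, integral_complex_ofReal]
  have hc : Continuous fun w => ‖ambiguityWin V w‖ ^ 2 := (ambiguityWin V).continuous.norm.pow 2
  have hi : Integrable fun w => ‖ambiguityWin V w‖ ^ 2 := by
    simp only [sq]
    exact (ambiguityWin V).integrable.norm.bdd_mul
      (ambiguityWin V).continuous.norm.aestronglyMeasurable
      (.of_forall fun w => by rw [norm_norm]; exact norm_schwartz_le _ w)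
  have := integral_pos_of_integrable_nonneg_nonzero (μ := volume) (x := (0 : Plane V)) hc hi
    (fun w => by positivity) (by simp [ambiguityWin_zero])
  have hne := this.ne'
  exact_mod_cast hne

/-- The product `conj (V_{g₁} f) · V_{g₂} g` on the time-frequency plane. -/
def stftProdFun (g₁ g₂ f g : V → ℂ) (w : Plane V) : ℂ :=
  conj (stft g₁ f w.fst w.snd) * stft g₂ g w.fst w.snd

-- The estimate that lets an M^∞ symbol be paired with the product of STFTs. Measured with the
-- window `ambiguityWin V`, the product is controlled by `integrable_stft_mul`, whose hypotheses
-- come from `partial_integral_stft_stft`; `memM1_of_integrable_stft_window` then returns to the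
-- Gaussian window.
variable (V) in
theorem exists_bound_stftProdFun : ∃ K : ℝ, ∀ g₁ g₂ f g : V → ℂ, MemM1 g₁ → MemM1 g₂ → MemM1 f →
    MemM1 g → MemM1 (stftProdFun g₁ g₂ f g) ∧
      m1Norm (stftProdFun g₁ g₂ f g) ≤ K * (m1Norm g₁ * m1Norm g₂ * m1Norm f * m1Norm g) := by
  refine ⟨‖∫ w, ambiguityWin V w * conj (ambiguityWin V w)‖⁻¹ * (gaussInt V * gaussSup V) *
    ∫ z : Plane V × Plane V, ‖stft (ambiguityWin V) (gaussWin (Plane V)) z.1 z.2‖,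
    fun g₁ g₂ f g h₁ h₂ hf hg => ?_⟩
  set Γ := stftS (gaussWin V) (gaussWin V) with hΓ
  obtain ⟨hi, hS⟩ := partial_integral_stft_stft hf h₁
  obtain ⟨hi', hS'⟩ := partial_integral_stft_stft hg h₂
  obtain ⟨hq, hq'⟩ := integral_mul_comp_sub hg.2.2.norm h₂.2.2.norm
  have hqS : Integrable fun z : Plane V => ∫ ζ, ‖stft Γ
      (fun w : Plane V => stft g₂ g w.fst w.snd) z ζ‖ := by
    simp only [hΓ, hS']
    exact integrable_plane.2 hq
  have hqI : ∫ z : Plane V, ∫ ζ, ‖stft Γ (fun w : Plane V => stft g₂ g w.fst w.snd) z ζ‖ =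
      m1Norm g * m1Norm g₂ := by
    simp only [hΓ, hS']
    rw [integral_plane]
    exact hq'
  -- For this factor a bound uniform in `z` suffices: the STFT of `f` is estimated by its supremum
  -- and that of `g₁` by its integral.
  have hb : ∀ z : Plane V, ∫ ζ, ‖stft Γ (fun w : Plane V => stft g₁ f w.fst w.snd) z ζ‖ ≤
      (m1Norm f * gaussInt V * gaussSup V) * m1Norm g₁ := fun z => by
    rw [hS, m1Norm.eq_def g₁, ← integral_const_mul,
      ← integral_sub_right_eq_self (fun p : V × V => _ * ‖stft (gaussWin V) g₁ p.1 p.2‖)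
        ((z.fst, z.snd) : V × V)]
    refine integral_mono_of_nonneg (.of_forall fun p => by positivity)
      ((Integrable.comp_sub_right h₁.2.2.norm (z.fst, z.snd)).const_mul _)
      (.of_forall fun p => ?_)
    simp only [Prod.fst_sub, Prod.snd_sub]
    gcongr
    refine (norm_stft_le hf.2.1 norm_gaussWin_le _ _).trans ?_
    have := hf.integral_norm_le
    have := gaussSup_nonneg V
    gcongr
  obtain ⟨h, h'⟩ := integrable_stft_mul (continuous_stft_plane hf h₁)
    (integrable_stft_plane hf h₁) (fun w => stft_bound hf h₁ w.fst w.snd)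
    (integrable_stft_plane hg h₂) Γ.continuous (norm_schwartz_le Γ)
    hi hb hi' hqS
  have hG : (ambiguityWin V : Plane V → ℂ) = fun w => conj (Γ w) * Γ w :=
    funext ambiguityWin_apply
  rw [hqI] at h'
  rw [← hG] at h h'
  obtain ⟨hM, hM'⟩ := memM1_of_integrable_stft_window (F := stftProdFun g₁ g₂ f g)
    ((Complex.continuous_conj.comp (continuous_stft_plane hf h₁)).mul (continuous_stft_plane hg h₂))
    ((integrable_stft_plane hg h₂).bdd_mul
      (Complex.continuous_conj.comp (continuous_stft_plane hf h₁)).aestronglyMeasurable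
      (.of_forall fun w => (RCLike.norm_conj _).trans_le (stft_bound hf h₁ w.fst w.snd)))
    (C := (m1Norm f * gaussInt V) * (m1Norm g₁ * gaussSup V) *
      ((m1Norm g * gaussInt V) * (m1Norm g₂ * gaussSup V)))
    (fun w => by
      have h0 := (norm_nonneg _).trans (stft_bound hf h₁ w.fst w.snd)
      rw [stftProdFun, norm_mul, RCLike.norm_conj]
      gcongr
      · exact stft_bound hf h₁ _ _
      · exact stft_bound hg h₂ _ _)
    (ambiguityWin V) integral_ambiguityWin_ne_zero h
  refine ⟨hM, hM'.trans ?_⟩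
  calc _ ≤ ‖∫ w, ambiguityWin V w * conj (ambiguityWin V w)‖⁻¹ *
        ((m1Norm f * gaussInt V * gaussSup V) * m1Norm g₁ * (m1Norm g * m1Norm g₂)) *
        ∫ z : Plane V × Plane V, ‖stft (ambiguityWin V) (gaussWin (Plane V)) z.1 z.2‖ := by
        gcongr
        exact h'
    _ = _ := by ring

end PlaneSTFT

/-! ### Symbols in M^∞ with both windows in M¹. -/

section SymbolCase

variable {V : Type*} [NormedAddCommGroup V] [InnerProductSpace ℝ V] [FiniteDimensional ℝ V]
  [MeasurableSpace V] [BorelSpace V]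

theorem gaussWin_plane (w : Plane V) :
    gaussWin (Plane V) w = gaussWin V w.fst * gaussWin V w.snd := by
  rw [gaussWin_eq_ofReal, gaussWin_eq_ofReal, gaussWin_eq_ofReal, ← Complex.ofReal_mul]
  congr 1
  have h : Module.finrank ℝ (Plane V) = Module.finrank ℝ V + Module.finrank ℝ V := by
    rw [(WithLp.linearEquiv 2 ℝ (V × V)).finrank_eq, Module.finrank_prod]
  rw [h, WithLp.prod_norm_sq_eq_of_L2, mul_add, Real.exp_add]
  push_cast
  rw [add_div, Real.rpow_add two_pos]
  ring

theorem partialInt_conjS_tfShift (z ζ : Plane V) :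
    partialInt V (conjS (modS ζ (translS z (gaussWin (Plane V))))) =
      (∫ x, conj (charFn ζ.fst x) * gaussWin V (x - z.fst)) •
        conjS (modS ζ.snd (translS z.snd (gaussWin V))) := by
  ext ω
  rw [partialInt_apply, _root_.smul_apply, smul_eq_mul, conjS_apply, modS_translS_apply,
    ← integral_mul_const]
  congr 1; funext x
  have e : charFn ζ (WithLp.toLp 2 (x, ω)) = charFn ζ.fst x * charFn ζ.snd ω :=
    charFn_plane ζ.fst ζ.snd (WithLp.toLp 2 (x, ω))
  rw [conjS_apply, modS_translS_apply, gaussWin_plane, e, map_mul, map_mul, map_mul, map_mul,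
    conj_gaussWin, conj_gaussWin, conj_gaussWin]
  change _ * (gaussWin V (x - z.fst) * gaussWin V (ω - z.snd)) = _
  ring

/-- The Gaussian of the plane is a tensor product, so the STFT factors into that of `m` and that of
the constant 1. The latter is a Fourier integral of a translated Gaussian, bounded by `gaussInt V`.
-/
theorem MemMInf.oneTensor {m : 𝓢'(V, ℂ)} (hm : MemMInf m) : MemMInf (oneTensor m) := by
  obtain ⟨C, hC⟩ := hm
  refine ⟨gaussInt V * C, fun z ζ => ?_⟩
  have e : stftD (gaussWin (Plane V)) (TimeFreq.oneTensor m) z ζ =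
      (∫ x, conj (charFn ζ.fst x) * gaussWin V (x - z.fst)) *
        stftD (gaussWin V) m z.snd ζ.snd := by
    rw [stftD, dualBr]
    change m (partialInt V _) = _
    rw [partialInt_conjS_tfShift, map_smul]; rfl
  rw [e, norm_mul]
  have := gaussInt_nonneg V
  gcongr
  · refine (norm_integral_le_integral_norm _).trans_eq ?_
    rw [gaussInt, ← integral_sub_right_eq_self (fun x => ‖gaussWin V x‖) z.fst]
    congr 1; funext x
    rw [norm_mul, RCLike.norm_conj, norm_charFn, one_mul]
  · exact hC _ _

variable {a : 𝓢'(Plane V, ℂ)} {g₁ g₂ f g : V → ℂ}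

theorem memM1_stftProdFun (h₁ : MemM1 g₁) (h₂ : MemM1 g₂) (hf : MemM1 f) (hg : MemM1 g) :
    MemM1 (stftProdFun g₁ g₂ f g) := by
  obtain ⟨K, hK⟩ := exists_bound_stftProdFun V
  exact (hK g₁ g₂ f g h₁ h₂ hf hg).1

theorem exists_bound_pairing_stftProdFun (ha : MemMInf a) : ∃ K : ℝ, ∀ g₁ g₂ f g : V → ℂ,
    MemM1 g₁ → MemM1 g₂ → MemM1 f → MemM1 g → ‖pairing a (stftProdFun g₁ g₂ f g)‖ ≤
      K * (m1Norm g₁ * m1Norm g₂ * m1Norm f * m1Norm g) := by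
  obtain ⟨K, hK⟩ := exists_bound_stftProdFun V
  obtain ⟨C, hC0, hC⟩ := ha.exists_nonneg_bound
  refine ⟨C * K, fun g₁ g₂ f g h₁ h₂ hf hg => ?_⟩
  obtain ⟨h, h'⟩ := hK g₁ g₂ f g h₁ h₂ hf hg
  rw [mul_assoc]
  exact (norm_pairing_le hC h).trans (by gcongr)

theorem lipschitzM1_pairing_stftProdFun_analysis (ha : MemMInf a) (h₂ : MemM1 g₂) (hf : MemM1 f)
    (hg : MemM1 g) : LipschitzM1 fun g₁ => pairing a (stftProdFun g₁ g₂ f g) := by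
  obtain ⟨K, hK⟩ := exists_bound_pairing_stftProdFun ha
  refine .of_bound (C := K * (m1Norm g₂ * m1Norm f * m1Norm g)) (fun g₁ g₁' h h' => ?_)
    fun g₁ h => (hK g₁ g₂ f g h h₂ hf hg).trans_eq (by ring)
  rw [← pairing_sub ha (memM1_stftProdFun h h₂ hf hg) (memM1_stftProdFun h' h₂ hf hg)]
  congr 1; funext w
  simp only [stftProdFun]
  rw [stft_sub_window hf.2.1 h.1 h'.1 h.norm_le h'.norm_le, map_sub, sub_mul]

theorem lipschitzM1_pairing_stftProdFun_synthesis (ha : MemMInf a) (h₁ : MemM1 g₁) (hf : MemM1 f)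
    (hg : MemM1 g) : LipschitzM1 fun g₂ => pairing a (stftProdFun g₁ g₂ f g) := by
  obtain ⟨K, hK⟩ := exists_bound_pairing_stftProdFun ha
  refine .of_bound (C := K * (m1Norm g₁ * m1Norm f * m1Norm g)) (fun g₂ g₂' h h' => ?_)
    fun g₂ h => (hK g₁ g₂ f g h₁ h hf hg).trans_eq (by ring)
  rw [← pairing_sub ha (memM1_stftProdFun h₁ h hf hg) (memM1_stftProdFun h₁ h' hf hg)]
  congr 1; funext w
  simp only [stftProdFun]
  rw [stft_sub_window hg.2.1 h.1 h'.1 h.norm_le h'.norm_le, mul_sub]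

theorem lipschitzM1_pairing_stftProdFun_left (ha : MemMInf a) (h₁ : MemM1 g₁) (h₂ : MemM1 g₂)
    (hg : MemM1 g) : LipschitzM1 fun f => pairing a (stftProdFun g₁ g₂ f g) := by
  obtain ⟨K, hK⟩ := exists_bound_pairing_stftProdFun ha
  refine .of_bound (C := K * (m1Norm g₁ * m1Norm g₂ * m1Norm g)) (fun f f' h h' => ?_)
    fun f h => (hK g₁ g₂ f g h₁ h₂ h hg).trans_eq (by ring)
  rw [← pairing_sub ha (memM1_stftProdFun h₁ h₂ h hg) (memM1_stftProdFun h₁ h₂ h' hg)]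
  congr 1; funext w
  simp only [stftProdFun]
  rw [stft_sub h.2.1 h'.2.1 h₁.1 h₁.norm_le, map_sub, sub_mul]

theorem lipschitzM1_pairing_stftProdFun_right (ha : MemMInf a) (h₁ : MemM1 g₁) (h₂ : MemM1 g₂)
    (hf : MemM1 f) : LipschitzM1 fun g => pairing a (stftProdFun g₁ g₂ f g) := by
  obtain ⟨K, hK⟩ := exists_bound_pairing_stftProdFun ha
  refine .of_bound (C := K * (m1Norm g₁ * m1Norm g₂ * m1Norm f)) (fun g g' h h' => ?_)
    fun g h => (hK g₁ g₂ f g h₁ h₂ hf h).trans_eq (by ring)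
  rw [← pairing_sub ha (memM1_stftProdFun h₁ h₂ hf h) (memM1_stftProdFun h₁ h₂ hf h')]
  congr 1; funext w
  simp only [stftProdFun]
  rw [stft_sub h.2.1 h'.2.1 h₂.1 h₂.norm_le, mul_sub]

/-- Correlation with a fixed M¹ window is bounded on M¹ and 𝓕⁻¹ is isometric there, so this is a
composition of a Lipschitz functional with a bounded linear or conjugate-linear map. -/
theorem lipschitzM1_corrM11_left {u : 𝓢'(V, ℂ)} (hu : MemMInf u) (h₂ : MemM1 g₂) {k : V → ℂ}
    (hk : Integrable k) :
    LipschitzM1 fun g₁ => ∫ t, convM u (𝓕⁻ (corrM11 g₁ g₂)) t * k t := by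
  obtain ⟨C, hC⟩ := lipschitzM1_integral_convM_mul hu hk
  refine ⟨|C| * (gaussInt V * m1Norm g₂), fun f g hf hg => ?_⟩
  refine (hC _ _ (hf.corrM11 h₂).1.fourierInv (hg.corrM11 h₂).1.fourierInv).trans ?_
  rw [← fourierInv_sub_apply (hf.corrM11 h₂).1.2.1 (hg.corrM11 h₂).1.2.1,
    ← corrM11_sub_left hf hg h₂, m1Norm_fourierInv ((hf.sub hg).corrM11 h₂).1.2.1]
  calc _ ≤ |C| * (gaussInt V * m1Norm (fun t => f t - g t) * m1Norm g₂) :=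
        mul_le_mul (le_abs_self C) ((hf.sub hg).corrM11 h₂).2 (m1Norm_nonneg _) (abs_nonneg _)
    _ = _ := by ring

theorem lipschitzM1_corrM11_right {u : 𝓢'(V, ℂ)} (hu : MemMInf u) (h₁ : MemM1 g₁) {k : V → ℂ}
    (hk : Integrable k) :
    LipschitzM1 fun g₂ => ∫ t, convM u (𝓕⁻ (corrM11 g₁ g₂)) t * k t := by
  obtain ⟨C, hC⟩ := lipschitzM1_integral_convM_mul hu hk
  refine ⟨|C| * (gaussInt V * m1Norm g₁), fun f g hf hg => ?_⟩
  refine (hC _ _ (h₁.corrM11 hf).1.fourierInv (h₁.corrM11 hg).1.fourierInv).trans ?_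
  rw [← fourierInv_sub_apply (h₁.corrM11 hf).1.2.1 (h₁.corrM11 hg).1.2.1,
    ← corrM11_sub_right h₁ hf hg, m1Norm_fourierInv (h₁.corrM11 (hf.sub hg)).1.2.1]
  calc _ ≤ |C| * (gaussInt V * m1Norm g₁ * m1Norm (fun t => f t - g t)) :=
        mul_le_mul (le_abs_self C) (h₁.corrM11 (hf.sub hg)).2 (m1Norm_nonneg _) (abs_nonneg _)
    _ = _ := by ring

theorem pairing_stftProdFun_schwartz {m : 𝓢'(V, ℂ)} (hm : MemMInf m) (g₁ g₂ f g : 𝓢(V, ℂ)) :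
    pairing (oneTensor m) (stftProdFun g₁ g₂ f g) =
      distOf (convM m (𝓕⁻ (corrM11 g₁ g₂))) (fourierProd f g) := by
  have e₁ : stftProdFun g₁ g₂ f g = conjS (stftProd g₁ g₂ f g) := by
    funext w
    have := stftProd_apply g₁ g₂ f g w.fst w.snd
    rw [conjS_apply, stftProdFun, ← Complex.conj_conj (stft g₂ g w.fst w.snd), ← map_mul, ← this]
    rfl
  have e₂ : corrM11 g₁ g₂ = corrSS g₁ g₂ := by
    funext t
    rw [corrSS, convS, convolution_mul_apply]; rfl
  rw [e₁, pairing_schwartz, dualBr, conjS_conjS, e₂, ← SchwartzMap.fourierInv_coe,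
    distOf_convM_schwartz hm]
  change m (partialInt V (stftProd g₁ g₂ f g)) = _
  rw [partialInt_stftProd]; rfl

/-- The symbol stays fixed throughout; only the M¹ variables are approximated. For Schwartz `f` and
`g` the identity is extended first in the synthesis window and then in the analysis window, and
`modulation_case` extends it in `f` and `g`. -/
theorem modulation_case_symbol (m m₂ : MInf V) (g₁ g₂ : M1 V) :
    (∃! A, IsSTFTMultM (oneTensor m.1) g₁.1 g₂.1 A) ∧
      ∀ A, IsSTFTMultM (oneTensor m.1) g₁.1 g₂.1 A →
        ((∀ f, (A f).1 = fourierMultM m₂.1 f.1) ↔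
          m₂.1 = distOf (convM m.1 (𝓕⁻ (corrM11 g₁.1 g₂.1)))) := by
  have hm := m.2.oneTensor
  have hw : ∀ {g₁ g₂ : V → ℂ}, MemM1 g₁ → MemM1 g₂ → ∀ ψ : 𝓢(V, ℂ),
      distOf (convM m.1 (𝓕⁻ (corrM11 g₁ g₂))) ψ =
        ∫ t, convM m.1 (𝓕⁻ (corrM11 g₁ g₂)) t * ψ t :=
    fun h₁ h₂ ψ => distOf_convM_apply m.2 (h₁.corrM11 h₂).1.fourierInv ψ
  refine modulation_case (F := fun f g => pairing (oneTensor m.1) (stftProdFun g₁.1 g₂.1 f g))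
    (fun A => forall₂_congr fun f g => and_iff_right (memM1_stftProdFun g₁.2 g₂.2 f.2 g.2))
    (memMInf_distOf_convM m.2 (g₁.2.corrM11 g₂.2).1.fourierInv) (fun f g => ?_)
    (fun g => lipschitzM1_pairing_stftProdFun_left hm g₁.2 g₂.2 (memM1_schwartz g))
    (fun f hf => lipschitzM1_pairing_stftProdFun_right hm g₁.2 g₂.2 hf) m₂
  have hf := memM1_schwartz f
  have hg := memM1_schwartz g
  rw [hw g₁.2 g₂.2]
  refine (lipschitzM1_pairing_stftProdFun_synthesis hm g₁.2 hf hg).eq_of_eq_on_schwartz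
    (lipschitzM1_corrM11_right m.2 g₁.2 (fourierProd f g).integrable) (fun φ₂ => ?_) g₂.2
  refine (lipschitzM1_pairing_stftProdFun_analysis hm (memM1_schwartz φ₂) hf
    hg).eq_of_eq_on_schwartz (lipschitzM1_corrM11_left m.2 (memM1_schwartz φ₂)
      (fourierProd f g).integrable) (fun φ₁ => ?_) g₁.2
  rw [pairing_stftProdFun_schwartz m.2, hw (memM1_schwartz φ₁) (memM1_schwartz φ₂)]

end SymbolCase

end TimeFreq

end

theorem mainTheorem1 (d : ℕ) :
    -- symbols in `𝓢'`, windows in `𝓢`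
    (∀ (m m₂ : 𝓢'(EuclideanSpace ℝ (Fin d), ℂ)) (g₁ g₂ : 𝓢(EuclideanSpace ℝ (Fin d), ℂ)),
      (∃! A, IsSTFTMultS (oneTensor m) g₁ g₂ A) ∧
      ∀ A, IsSTFTMultS (oneTensor m) g₁ g₂ A →
        ((∀ f, A f = fourierMultS m₂ f) ↔ m₂ = convD m (𝓕⁻ (corrSS g₁ g₂)))) ∧
    -- symbols in `M^∞`, windows in `M¹`
    (∀ (m m₂ : MInf (EuclideanSpace ℝ (Fin d))) (g₁ g₂ : M1 (EuclideanSpace ℝ (Fin d))),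
      (∃! A, IsSTFTMultM (oneTensor m.1) g₁.1 g₂.1 A) ∧
      ∀ A, IsSTFTMultM (oneTensor m.1) g₁.1 g₂.1 A →
        ((∀ f, (A f).1 = fourierMultM m₂.1 f.1) ↔
          m₂.1 = distOf (convM m.1 (𝓕⁻ (corrM11 g₁.1 g₂.1))))) ∧
    -- symbols in `𝓢`, `g₁ ∈ 𝓢'`, `g₂ ∈ 𝓢`
    (∀ (m m₂ : 𝓢(EuclideanSpace ℝ (Fin d), ℂ)) (g₁ : 𝓢'(EuclideanSpace ℝ (Fin d), ℂ))
        (g₂ : 𝓢(EuclideanSpace ℝ (Fin d), ℂ)),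
      (∃! A, IsSTFTMultFunS (fun z => m z.2) (stftWinD g₁) (fun f => stft g₂ f) A) ∧
      ∀ A, IsSTFTMultFunS (fun z => m z.2) (stftWinD g₁) (fun f => stft g₂ f) A →
        ((∀ f, A f = fourierMultS (m₂ : 𝓢'(EuclideanSpace ℝ (Fin d), ℂ)) f) ↔
          (m₂ : 𝓢'(EuclideanSpace ℝ (Fin d), ℂ)) = convD (𝓕⁻ (corrDS g₁ g₂)) m)) ∧
    -- symbols in `M¹`, `g₁ ∈ M^∞`, `g₂ ∈ M¹`
    (∀ (m m₂ : M1 (EuclideanSpace ℝ (Fin d))) (g₁ : MInf (EuclideanSpace ℝ (Fin d)))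
        (g₂ : M1 (EuclideanSpace ℝ (Fin d))),
      (∃! A, IsSTFTMultFunM (fun z => m.1 z.2) (stftWinM g₁.1) (stft g₂.1) A) ∧
      ∀ A, IsSTFTMultFunM (fun z => m.1 z.2) (stftWinM g₁.1) (stft g₂.1) A →
        ((∀ f, (A f).1 = fourierMultM (distOf m₂.1) f.1) ↔
          distOf m₂.1 = distOf (convM (𝓕⁻ (distOf (corrMInf1 g₁.1 g₂.1))) m.1))) ∧
    -- symbols in `𝓢`, `g₁ ∈ 𝓢`, `g₂ ∈ 𝓢'`
    (∀ (m m₂ : 𝓢(EuclideanSpace ℝ (Fin d), ℂ)) (g₁ : 𝓢(EuclideanSpace ℝ (Fin d), ℂ))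
        (g₂ : 𝓢'(EuclideanSpace ℝ (Fin d), ℂ)),
      (∃! A, IsSTFTMultFunS (fun z => m z.2) (fun f => stft g₁ f) (stftWinD g₂) A) ∧
      ∀ A, IsSTFTMultFunS (fun z => m z.2) (fun f => stft g₁ f) (stftWinD g₂) A →
        ((∀ f, A f = fourierMultS (m₂ : 𝓢'(EuclideanSpace ℝ (Fin d), ℂ)) f) ↔
          (m₂ : 𝓢'(EuclideanSpace ℝ (Fin d), ℂ)) = convD (𝓕⁻ (corrSD g₁ g₂)) m)) ∧
    -- symbols in `M¹`, `g₁ ∈ M¹`, `g₂ ∈ M^∞`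
    (∀ (m m₂ : M1 (EuclideanSpace ℝ (Fin d))) (g₁ : M1 (EuclideanSpace ℝ (Fin d)))
        (g₂ : MInf (EuclideanSpace ℝ (Fin d))),
      (∃! A, IsSTFTMultFunM (fun z => m.1 z.2) (stft g₁.1) (stftWinM g₂.1) A) ∧
      ∀ A, IsSTFTMultFunM (fun z => m.1 z.2) (stft g₁.1) (stftWinM g₂.1) A →
        ((∀ f, (A f).1 = fourierMultM (distOf m₂.1) f.1) ↔
          distOf m₂.1 = distOf (convM (𝓕⁻ (distOf (corrM1Inf g₁.1 g₂.1))) m.1))) := 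
  ⟨schwartz_case, modulation_case_symbol, schwartz_case_left, modulation_case_left,
    schwartz_case_right, modulation_case_right⟩
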